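/- For coprime integers $p>q>0$ let $p/q=a_1-\cfrac{1}{a_2-\cfrac{1}{\ddots-\cfrac{1}{a_n}}}$ with all $a_j\ge 2$ be the negative continued fraction expansion. Let $X(p,q)$ be the canonical negative-definite plumbing bounded by the lens space $L(p,q)$, that is, the plumbing of disk bundles over spheres along the path on $n$ vertices with weights $-a_1,\dots,-a_n$. The canonical plumbing graph of a connected sum $L=\#_i L(p_i,q_i)$ (finitely many summands) is the disjoint union of these weighted paths, and it is the plumbing graph of the boundary connected sum $\natural_i X(p_i,q_i)$. For a plumbing $X$ along a weighted graph, the lattice $Q_X$ is the free abelian group on the vertices with the intersection form for which $v\cdot v$ is the weight of $v$, and, for $u\neq v$, $u\cdot v=1$ if $u,v$ are adjacent and $u\cdot v=0$ otherwise; $b_2(X)$ is its rank. For a positive integer $k$, say that $L$ has Property $X_k$ if the lattice $Q_{\natural_i X(p_i,p_i-q_i)}$ does not embed isometrically in the standard negative lattice $(\mathbb{Z}^{n_k},-\mathrm{Id})$, where $$n_k=b_2(\natural_i X(p_i,q_i))+b_2(\natural_i X(p_i,p_i-q_i))-k$$ (if $n_k<0$, there is no such embedding and the property holds). A minimal configuration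 for $k$ is a weighted graph that is the canonical plumbing graph of some connected sum of lens spaces without Property $X_k$, and that contains no other such graph, up to isomorphism of weighted graphs, as an induced subgraph (with the induced weights). Theorem A. For each positive integer $k$ there is a finite set $S_k$ of pairwise non-isomorphic minimal configurations for $k$ such that: 1. a connected sum of lens spaces $L$ has Property $X_k$ if and only if its canonical plumbing graph contains no configuration from $S_k$ as an induced subgraph; 2. every vertex weight of every configuration in $S_k$ has absolute value at most $2k+7$; 3. every configuration in $S_k$ has at most $13k$ vertices. -/

import Mathlib

/-- The parameters of a lens space `L(p,q)`: coprime integers `p > q > 0`. -/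
structure LensSpace where
  p : ℕ
  q : ℕ
  q_pos : 0 < q
  q_lt_p : q < p
  coprime : Nat.Coprime p q

/-- The parameters `(p, p - q)` of the orientation reversal `-L(p,q) = L(p,p-q)`. -/
def LensSpace.reverse (L : LensSpace) : LensSpace where
  p := L.p
  q := L.p - L.q
  q_pos := Nat.sub_pos_of_lt L.q_lt_p
  q_lt_p := Nat.sub_lt (lt_trans L.q_pos L.q_lt_p) L.q_pos
  coprime := (Nat.coprime_self_sub_right L.q_lt_p.le).mpr L.coprime

/-- The negative (Hirzebruch–Jung) continued fraction expansion `[a₁, …, aₙ]` of `p / q`: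
`a₁ = ⌈p / q⌉`, followed by the expansion of `q / (a₁ q - p)`, where `a₁ q - p < q`.
(For a denominator `q + 1` one has `⌈p / (q + 1)⌉ = ⌊(p + q) / (q + 1)⌋` and
`⌈p / (q + 1)⌉ (q + 1) - p = q - (p + q) % (q + 1)`.) -/
def hjExpansion (p : ℕ) : ℕ → List ℕ
  | 0 => []
  | q + 1 => ((p + q) / (q + 1)) :: hjExpansion (q + 1) (q - (p + q) % (q + 1))
termination_by q => q
decreasing_by omega

/-- The value `a₁ - 1 / (a₂ - 1 / (⋯ - 1 / aₙ))` of a negative continued fraction. -/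
def hjValue : List ℕ → ℚ
  | [] => 0
  | [a] => a
  | a :: b :: l => a - 1 / hjValue (b :: l)

theorem hjExpansion_eq_nil_iff (p q : ℕ) : hjExpansion p q = [] ↔ q = 0 := by
  cases q <;> simp [hjExpansion]

/-- The entries of the expansion of `p / q` are at least `2` when `p > q`. -/
theorem two_le_of_mem_hjExpansion {q : ℕ} : ∀ {p : ℕ}, q < p →
    ∀ a ∈ hjExpansion p q, 2 ≤ a := by
  induction q using Nat.strong_induction_on with
  | _ q ih =>
    intro p hpq a ha
    cases q with
    | zero => simp [hjExpansion] at ha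
    | succ q =>
      rw [hjExpansion, List.mem_cons] at ha
      rcases ha with rfl | ha
      · rw [Nat.le_div_iff_mul_le (Nat.succ_pos q)]
        omega
      · exact ih _ (by omega) (by omega) a ha

/-- The expansion of `p / q` has value `p / q`. -/
theorem hjValue_hjExpansion {q : ℕ} : ∀ {p : ℕ}, q < p → 0 < q →
    hjValue (hjExpansion p q) = (p : ℚ) / q := by
  induction q using Nat.strong_induction_on with
  | _ q ih =>
    intro p hpq hq
    cases q with
    | zero => omega
    | succ q =>
      rw [hjExpansion]
      have hdiv := Nat.div_add_mod (p + q) (q + 1)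
      have hlt : (p + q) % (q + 1) < q + 1 := Nat.mod_lt _ (Nat.succ_pos q)
      set a := (p + q) / (q + 1) with ha
      set r := q - (p + q) % (q + 1) with hr
      have key : (q + 1) * a = p + r := by omega
      have keyQ : ((q : ℚ) + 1) * a = p + r := by exact_mod_cast key
      have hq0 : (q : ℚ) + 1 ≠ 0 := by positivity
      rcases Nat.eq_zero_or_pos r with h0 | h0
      · rw [h0] at keyQ ⊢
        rw [hjExpansion, hjValue]
        push_cast at keyQ ⊢
        field_simp
        linarith
      · have h := ih r (by omega) (p := q + 1) (by omega) h0
        cases hl : hjExpansion (q + 1) r with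
        | nil => rw [hjExpansion_eq_nil_iff] at hl; omega
        | cons b l =>
          rw [hjValue, ← hl, h]
          have hr0 : (r : ℚ) ≠ 0 := by exact_mod_cast h0.ne'
          push_cast
          field_simp
          linarith

/-- The coefficients `a₁, …, aₙ ≥ 2` with `p / q = a₁ - 1 / (a₂ - 1 / (⋯ - 1 / aₙ))`. -/
def LensSpace.coeffs (L : LensSpace) : List ℕ := hjExpansion L.p L.q

/-- A simple graph with integer weights on its vertices. -/
structure WeightedGraph (V : Type*) where
  graph : SimpleGraph V
  weight : V → ℤ

namespace WeightedGraph

variable {V W : Type*}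

/-- `G` is (isomorphic to) an induced subgraph of `H`, with the same weights. -/
def IsInducedSubgraph (G : WeightedGraph V) (H : WeightedGraph W) : Prop :=
  ∃ f : G.graph ↪g H.graph, ∀ v, H.weight (f v) = G.weight v

/-- `G` and `H` are isomorphic weighted graphs. -/
def IsIsomorphic (G : WeightedGraph V) (H : WeightedGraph W) : Prop :=
  ∃ f : G.graph ≃g H.graph, ∀ v, H.weight (f v) = G.weight v

open Classical in
/-- The intersection form `Q` of the plumbing of disk bundles over spheres along a forest `G`, on
its second homology, the free abelian group on the vertices: the matrix has the weights on the
diagonal, and off the diagonal `1` for adjacent and `0` for non-adjacent vertices. -/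
noncomputable def intersectionForm [Fintype V] (G : WeightedGraph V) :
    LinearMap.BilinForm ℤ (V → ℤ) :=
  Matrix.toBilin' (Matrix.of fun u v : V =>
    if u = v then G.weight u else if G.graph.Adj u v then 1 else 0)

/-- The second Betti number of the plumbing along `G`. -/
noncomputable def bettiTwo [Fintype V] (_G : WeightedGraph V) : ℕ :=
  Module.finrank ℤ (V → ℤ)

end WeightedGraph

/-- The standard negative-definite lattice `(ℤⁿ, -Id)`. -/
def standardNegativeForm (n : ℕ) : LinearMap.BilinForm ℤ (Fin n → ℤ) :=
  Matrix.toBilin' (-1)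

/-- There is an embedding of integral lattices `(M, B) ↪ (N, C)`. -/
def LatticeEmbeds {M N : Type*} [AddCommGroup M] [AddCommGroup N]
    (B : LinearMap.BilinForm ℤ M) (C : LinearMap.BilinForm ℤ N) : Prop :=
  ∃ f : M →ₗ[ℤ] N, Function.Injective f ∧ ∀ x y, C (f x) (f y) = B x y

/-- The canonical plumbing graph of the connected sum `#ᵢ L(pᵢ,qᵢ)`: the disjoint union over `i` of
the paths with weights `-a₁, …, -aₙ`, where `[a₁, …, aₙ]` is the expansion of `pᵢ / qᵢ`. -/
def canonicalPlumbingGraph {m : ℕ} (L : Fin m → LensSpace) :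
    WeightedGraph (Σ i : Fin m, Fin (L i).coeffs.length) where
  graph :=
    { Adj := fun u v => u.1 = v.1 ∧ (u.2.val + 1 = v.2.val ∨ v.2.val + 1 = u.2.val)
      symm := ⟨fun _ _ h => ⟨h.1.symm, h.2.symm⟩⟩
      loopless := ⟨fun _ h => by omega⟩ }
  weight := fun v => -((L v.1).coeffs.get v.2 : ℤ)

/-- The canonical plumbing graph of `#ᵢ L(pᵢ,pᵢ-qᵢ)`. -/
def dualPlumbingGraph {m : ℕ} (L : Fin m → LensSpace) :
    WeightedGraph (Σ i : Fin m, Fin (L i).reverse.coeffs.length) :=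
  canonicalPlumbingGraph fun i => (L i).reverse

/-- Property `X_k` of `#ᵢ L(pᵢ,qᵢ)`: the lattice `Q` of `♮ᵢ X(pᵢ,pᵢ-qᵢ)` has no embedding into
`(ℤⁿ, -Id)` for `n = b₂(♮ᵢ X(pᵢ,qᵢ)) + b₂(♮ᵢ X(pᵢ,pᵢ-qᵢ)) - k`. The difference is taken in `ℤ`;
if it is negative, there is no such lattice and the property holds. -/
def PropertyX (k : ℕ) {m : ℕ} (L : Fin m → LensSpace) : Prop :=
  ¬ ∃ n : ℕ,
    (n : ℤ) = (canonicalPlumbingGraph L).bettiTwo + (dualPlumbingGraph L).bettiTwo - k ∧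
    LatticeEmbeds (dualPlumbingGraph L).intersectionForm (standardNegativeForm n)

/-- `G` is a minimal configuration for `k`: it is the canonical plumbing graph of a connected sum
of lens spaces without Property `X_k`, and it contains no other such graph as an induced subgraph. -/
def IsMinimalConfiguration (k : ℕ) {V : Type*} (G : WeightedGraph V) : Prop :=
  (∃ (m : ℕ) (L : Fin m → LensSpace),
    G.IsIsomorphic (canonicalPlumbingGraph L) ∧ ¬ PropertyX k L) ∧
  ∀ (m : ℕ) (L : Fin m → LensSpace), ¬ PropertyX k L →
    (canonicalPlumbingGraph L).IsInducedSubgraph G →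
    (canonicalPlumbingGraph L).IsIsomorphic G

/-! Put the vertices at integer positions, adjacent exactly when the positions are consecutive, and
give a vertex of weight `-a` a block of `a` coordinates of a standard lattice, neighbouring blocks
sharing one coordinate. Up to signs, which do not matter on a forest, the indicator vectors of the
blocks span the plumbing lattice. By Riemenschneider duality their orthogonal complement, the
lattice of flows, is the negated lattice of the reversed lens spaces, and the number of coordinates
is the sum of the two Betti numbers. So Property `X_k` fails exactly when the flows embed
isometrically in a standard lattice with `k` fewer coordinates (`propertyX_iff_not_compressible`).
This compressibility passes to larger sets of positions and along embeddings of weighted graphs. It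
remains to bound the minimal compressible sets (`IsMinimal.bounds`): bounded weights and sizes leave
finitely many isomorphism classes.

The first half of the bound is constructive. A `-2`, a `-4` or an adjacent pair of `-3` is a cheap
piece, and `k + 1` pairwise nonadjacent pieces are already compressible for `k`
(`IsPack.compressible`). Hence a minimal set either consists of such pieces or contains at most `k`
nonadjacent ones. In particular, runs of `-2` are short, since every other vertex of a run is a
piece.

The second half is rigidity. Suppose a vertex `X` has at least three coordinates of its own. Their
differences have square `2`, and in the cases needed their images share a unit vector
(`exists_unit_of_star`). This yields orthonormal vectors `U c` with `φ x ⬝ᵥ U c = x c + τ x`, where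
the correction `τ` does not depend on `c`. If `τ` vanished, dropping these directions would compress
the set without `X` (`compressible_erase`), against minimality. Flows are generated by differences
of own coordinates and by alternating flows along runs (`flow_induction`), and `τ` kills the former,
so `τ` is nonzero on some run flow. Bessel's inequality then plays the many vectors `U c` against
the small norm of a run flow. For one vertex this bounds the weight. For the sparse vertices, which
lie far from all pieces, the systems `U` are mutually orthogonal, so the run flows can serve no more
sparse vertices than a pack has pieces (`IsMinimal.card_sparse_le`). Every vertex lies near a sparse
vertex or near a piece, which gives `3 k + 10 k` vertices. -/

open scoped Matrix

/-! ### Coordinates, flows and compressibility. -/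

namespace LinearPlumbing

/-- The coordinates met by the vertex at position `i`, of weight `-a i`: consecutive vertices share
the coordinate `(i + 1, 0)`. -/
def block (a : ℤ → ℕ) (i : ℤ) : Finset (ℤ × ℕ) :=
  insert (i + 1, 0) ((Finset.range (a i - 1)).image fun t => (i, t))

/-- All coordinates met by the vertices at the positions in `P`. -/
def cells (a : ℤ → ℕ) (P : Finset ℤ) : Finset (ℤ × ℕ) := P.biUnion (block a)

/-- The orthogonal complement of the vertices at the positions in `P`. -/
def IsFlow (a : ℤ → ℕ) (P : Finset ℤ) (x : ℤ × ℕ → ℤ) : Prop := ∀ i ∈ P, ∑ c ∈ block a i, x c = 0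

/-- The standard form on the coordinates met by `P`. -/
def pairing (a : ℤ → ℕ) (P : Finset ℤ) (x y : ℤ × ℕ → ℤ) : ℤ := ∑ c ∈ cells a P, x c * y c

/-- The lattice of flows embeds in a standard lattice of corank `k` in the one it is defined in. -/
def Compressible (a : ℤ → ℕ) (P : Finset ℤ) (k : ℕ) : Prop :=
  ∃ (J : Type) (_ : Fintype J) (φ : (ℤ × ℕ → ℤ) → J → ℤ), Fintype.card J + k = (cells a P).card ∧
    ∀ x y, IsFlow a P x → IsFlow a P y → φ x ⬝ᵥ φ y = pairing a P x y

variable {a : ℤ → ℕ} {P Q R : Finset ℤ} {k l : ℕ}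

theorem mem_block {i : ℤ} {c : ℤ × ℕ} :
    c ∈ block a i ↔ c = (i + 1, 0) ∨ (c.1 = i ∧ c.2 < a i - 1) := by
  rcases c with ⟨p, t⟩
  simp only [block, Finset.mem_insert, Finset.mem_image, Finset.mem_range, Prod.mk.injEq]
  constructor
  · rintro (h | ⟨s, hs, rfl, rfl⟩)
    · exact Or.inl h
    · exact Or.inr ⟨rfl, hs⟩
  · rintro (h | ⟨rfl, hs⟩)
    · exact Or.inl h
    · exact Or.inr ⟨t, hs, rfl, rfl⟩

theorem mem_cells {c : ℤ × ℕ} : c ∈ cells a P ↔ ∃ i ∈ P, c ∈ block a i := by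
  simp [cells]

theorem eq_of_mem_block_of_mem_block {i j : ℤ} {c : ℤ × ℕ} (hi : c ∈ block a i)
    (hj : c ∈ block a j) (hij : i < j) : j = i + 1 ∧ c = (j, 0) := by
  rw [mem_block] at hi hj
  rcases hi with rfl | ⟨h1, h2⟩ <;> rcases hj with h | ⟨h3, h4⟩
  · simp at h; omega
  · simp at h3; subst h3; simp
  · subst h; simp at h1; omega
  · omega

theorem sum_block {M : Type*} [AddCommMonoid M] (a : ℤ → ℕ) (i : ℤ) (f : ℤ × ℕ → M) :
    ∑ c ∈ block a i, f c = f (i + 1, 0) + ∑ t ∈ Finset.range (a i - 1), f (i, t) := by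
  rw [block, Finset.sum_insert, Finset.sum_image]
  · simp
  · simp

theorem block_subset_cells {i : ℤ} (hi : i ∈ P) : block a i ⊆ cells a P :=
  Finset.subset_biUnion_of_mem (block a) hi

theorem cells_mono (h : Q ⊆ P) : cells a Q ⊆ cells a P :=
  Finset.biUnion_subset_biUnion_of_subset_left _ h

theorem IsFlow.mono {x : ℤ × ℕ → ℤ} (hx : IsFlow a P x) (h : Q ⊆ P) : IsFlow a Q x :=
  fun i hi => hx i (h hi)

theorem IsFlow.add {x y : ℤ × ℕ → ℤ} (hx : IsFlow a P x) (hy : IsFlow a P y) :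
    IsFlow a P (x + y) := fun i hi => by
  simp [Finset.sum_add_distrib, hx i hi, hy i hi]

theorem IsFlow.smul {x : ℤ × ℕ → ℤ} (hx : IsFlow a P x) (n : ℤ) : IsFlow a P (n • x) :=
  fun i hi => by simp [← Finset.mul_sum, hx i hi]

theorem IsFlow.sub {x y : ℤ × ℕ → ℤ} (hx : IsFlow a P x) (hy : IsFlow a P y) :
    IsFlow a P (x - y) := fun i hi => by
  simp [Finset.sum_sub_distrib, hx i hi, hy i hi]

/-- A flow on the larger set restricts to a flow on the smaller one; the additional coordinates are
kept unchanged. -/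
theorem Compressible.superset (h : Compressible a Q k) (hQ : Q ⊆ P) : Compressible a P k := by
  obtain ⟨J, _, φ, hJ, hφ⟩ := h
  refine ⟨J ⊕ {c // c ∈ cells a P \ cells a Q}, inferInstance,
    fun x => Sum.elim (φ x) fun c => x c.1, ?_, fun x y hx hy => ?_⟩
  · have := Finset.card_sdiff_add_card_eq_card (cells_mono (a := a) hQ)
    simp only [Fintype.card_sum, Fintype.card_coe]
    omega
  · have h1 := hφ x y (hx.mono hQ) (hy.mono hQ)
    rw [dotProduct] at h1
    rw [dotProduct, Fintype.sum_sum_type]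
    simp only [Sum.elim_inl, Sum.elim_inr]
    rw [h1, pairing, pairing, ← Finset.sum_sdiff (cells_mono (a := a) hQ), add_comm]
    congr 1
    exact Finset.sum_coe_sort (cells a P \ cells a Q) fun c => x c * y c

theorem Compressible.mono (h : Compressible a P k) (hl : l ≤ k) : Compressible a P l := by
  obtain ⟨J, _, φ, hJ, hφ⟩ := h
  refine ⟨J ⊕ Fin (k - l), inferInstance, fun x => Sum.elim (φ x) 0, ?_, fun x y hx hy => ?_⟩
  · simp; omega
  · rw [← hφ x y hx hy]
    simp [dotProduct]

theorem compressible_zero : Compressible a P 0 :=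
  ⟨{c // c ∈ cells a P}, inferInstance, fun x c => x c.1, by simp, fun x y _ _ =>
    Finset.sum_coe_sort (cells a P) fun c => x c * y c⟩

theorem disjoint_cells (h : ∀ i ∈ Q, ∀ j ∈ R, i + 2 ≤ j ∨ j + 2 ≤ i) :
    Disjoint (cells a Q) (cells a R) := by
  rw [Finset.disjoint_left]
  intro c hc hd
  obtain ⟨i, hi, hci⟩ := mem_cells.1 hc
  obtain ⟨j, hj, hcj⟩ := mem_cells.1 hd
  rcases h i hi j hj with h | h
  · have := (eq_of_mem_block_of_mem_block hci hcj (by omega)).1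
    omega
  · have := (eq_of_mem_block_of_mem_block hcj hci (by omega)).1
    omega

theorem Compressible.union (hQ : Compressible a Q k) (hR : Compressible a R l)
    (h : ∀ i ∈ Q, ∀ j ∈ R, i + 2 ≤ j ∨ j + 2 ≤ i) : Compressible a (Q ∪ R) (k + l) := by
  obtain ⟨J, _, φ, hJ, hφ⟩ := hQ
  obtain ⟨K, _, ψ, hK, hψ⟩ := hR
  have hd := disjoint_cells (a := a) h
  have hu : cells a (Q ∪ R) = cells a Q ∪ cells a R := Finset.union_biUnion ..
  refine ⟨J ⊕ K, inferInstance, fun x => Sum.elim (φ x) (ψ x), ?_, fun x y hx hy => ?_⟩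
  · rw [hu, Finset.card_union_of_disjoint hd]
    simp; omega
  · have h1 := hφ x y (hx.mono Finset.subset_union_left) (hy.mono Finset.subset_union_left)
    have h2 := hψ x y (hx.mono Finset.subset_union_right) (hy.mono Finset.subset_union_right)
    rw [pairing, hu, Finset.sum_union hd]
    simpa [dotProduct, pairing] using congrArg₂ (· + ·) h1 h2

/-- The flows form the root lattice `A₃ = D₃`, which lies in `ℤ³`. -/
theorem compressible_four {p : ℤ} (h : a p = 4) : Compressible a {p} 1 := by
  have hc : cells a {p} = {(p, 0), (p, 1), (p, 2), (p + 1, 0)} := by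
    ext ⟨i, t⟩
    simp [mem_cells, mem_block, h]
    omega
  refine ⟨Fin 3, inferInstance, fun x => ![x (p, 0) + x (p, 1), x (p, 0) + x (p, 2),
    x (p, 1) + x (p, 2)], ?_, fun x y hx hy => ?_⟩
  · rw [hc]; simp [Finset.card_insert_of_notMem]
  · have h1 := hx p (by simp)
    have h2 := hy p (by simp)
    rw [sum_block, h] at h1 h2
    simp [Finset.sum_range_succ] at h1 h2
    rw [pairing, hc]
    have e1 : x (p + 1, 0) = -(x (p, 0) + x (p, 1) + x (p, 2)) := by linarith
    have e2 : y (p + 1, 0) = -(y (p, 0) + y (p, 1) + y (p, 2)) := by linarith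
    simp [dotProduct, Fin.sum_univ_three, e1, e2]
    ring

/-- Each vertex carries a root on its two own coordinates. These two orthogonal roots are placed in
one plane as `(1, 1)` and `(1, -1)`, and the flow through the shared coordinate, with its value
doubled up in two further directions, completes the rank `3` lattice in `ℤ⁴`. -/
theorem compressible_three_three {p : ℤ} (h : a p = 3) (h' : a (p + 1) = 3) :
    Compressible a {p, p + 1} 1 := by
  have hc : cells a {p, p + 1} = {(p, 0), (p, 1), (p + 1, 0), (p + 1, 1), (p + 2, 0)} := by
    ext ⟨i, t⟩
    simp [mem_cells, mem_block, h, h']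
    omega
  refine ⟨Fin 4, inferInstance, fun x => ![x (p, 0) + x (p + 1, 1) + x (p + 1, 0),
    x (p, 0) - x (p + 1, 1), x (p + 1, 0), x (p + 1, 0)], ?_, fun x y hx hy => ?_⟩
  · rw [hc]; simp [Finset.card_insert_of_notMem]
  · have h1 := hx p (by simp)
    have h2 := hy p (by simp)
    have h3 := hx (p + 1) (by simp)
    have h4 := hy (p + 1) (by simp)
    rw [sum_block, h] at h1 h2
    rw [sum_block, h', show p + 1 + 1 = p + 2 by ring] at h3 h4
    simp [Finset.sum_range_succ] at h1 h2 h3 h4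
    rw [pairing, hc]
    have e1 : x (p, 1) = -(x (p + 1, 0) + x (p, 0)) := by linarith
    have e2 : y (p, 1) = -(y (p + 1, 0) + y (p, 0)) := by linarith
    have e3 : x (p + 2, 0) = -(x (p + 1, 0) + x (p + 1, 1)) := by linarith
    have e4 : y (p + 2, 0) = -(y (p + 1, 0) + y (p + 1, 1)) := by linarith
    simp [dotProduct, Fin.sum_univ_four, e1, e2, e3, e4]
    ring

/-- Two orthogonal vectors of square `2` fit in a plane as `(1, 1)` and `(1, -1)`, so a pair of `-2`
saves two coordinates although a single one saves none. -/
theorem compressible_two_two {p q : ℤ} (hp : a p = 2) (hq : a q = 2) (hpq : p + 2 ≤ q) :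
    Compressible a {p, q} 2 := by
  have hc : cells a {p, q} = {(p, 0), (p + 1, 0), (q, 0), (q + 1, 0)} := by
    ext ⟨i, t⟩
    simp [mem_cells, mem_block, hp, hq]
    omega
  have n1 : ¬ (p = q) := by omega
  have n2 : ¬ (p = q + 1) := by omega
  have n3 : ¬ (p + 1 = q) := by omega
  refine ⟨Fin 2, inferInstance, fun x => ![x (p, 0) + x (q, 0), x (p, 0) - x (q, 0)], ?_,
    fun x y hx hy => ?_⟩
  · rw [hc]; simp [Finset.card_insert_of_notMem, n1, n2, n3]
  · have h1 := hx p (by simp)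
    have h2 := hy p (by simp)
    have h3 := hx q (by simp)
    have h4 := hy q (by simp)
    rw [sum_block, hp] at h1 h2
    rw [sum_block, hq] at h3 h4
    simp at h1 h2 h3 h4
    rw [pairing, hc]
    have e1 : x (p + 1, 0) = -(x (p, 0)) := by linarith
    have e2 : y (p + 1, 0) = -(y (p, 0)) := by linarith
    have e3 : x (q + 1, 0) = -(x (q, 0)) := by linarith
    have e4 : y (q + 1, 0) = -(y (q, 0)) := by linarith
    simp [dotProduct, n1, n2, n3, e1, e2, e3, e4]
    ring

/-! ### Invariance under embeddings of weighted graphs. -/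

/-- Maps of positions that preserve adjacency and weights preserve compressibility. -/
theorem Compressible.image {a' : ℤ → ℕ} (h : Compressible a' P k) (f : ℤ → ℤ)
    (h2 : ∀ i ∈ P, 2 ≤ a' i) (hinj : ∀ i ∈ P, ∀ j ∈ P, f i = f j → i = j)
    (hadj : ∀ i ∈ P, ∀ j ∈ P, (f j = f i + 1 ∨ f i = f j + 1) ↔ (j = i + 1 ∨ i = j + 1))
    (hw : ∀ i ∈ P, a (f i) = a' i) : Compressible a (P.image f) k := by
  classical
  -- On each component `f` is a translation or a reflection; `rev` detects reflections. A reflection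
  -- exchanges the two end coordinates `(i, 0)` and `(i + 1, 0)` of a block, and the inner
  -- coordinates keep their index. A coordinate `(p, 0)` with `p ∉ P` can only be the right end of
  -- the block at `p - 1`.
  let rev : ℤ → Prop := fun i =>
    (i + 1 ∈ P ∧ f i = f (i + 1) + 1) ∨ (i - 1 ∈ P ∧ f (i - 1) = f i + 1)
  let κ : ℤ × ℕ → ℤ × ℕ := fun c =>
    if c.2 = 0 then
      if c.1 ∈ P then (if rev c.1 then (f c.1 + 1, 0) else (f c.1, 0))
      else (if rev (c.1 - 1) then (f (c.1 - 1), 0) else (f (c.1 - 1) + 1, 0))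
    else (f c.1, c.2)
  have hl : ∀ i ∈ P, κ (i, 0) = if rev i then (f i + 1, 0) else (f i, 0) := by
    intro i hi
    simp [κ, hi]
  have hr : ∀ i ∈ P, κ (i + 1, 0) = if rev i then (f i, 0) else (f i + 1, 0) := by
    intro i hi
    by_cases hi' : i + 1 ∈ P
    · rw [hl _ hi']
      rcases (hadj i hi (i + 1) hi').2 (Or.inl rfl) with hf | hf
      · have r1 : ¬ rev i := by
          rintro (⟨_, h⟩ | ⟨h1, h⟩)
          · omega
          · have := hinj _ h1 _ hi' (by omega)
            omega
        have r2 : ¬ rev (i + 1) := by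
          rintro (⟨h1, h⟩ | ⟨_, h⟩)
          · have := hinj _ h1 _ hi (by omega)
            omega
          · rw [add_sub_cancel_right] at h
            omega
        simp [r1, r2, hf]
      · have r1 : rev i := Or.inl ⟨hi', hf⟩
        have r2 : rev (i + 1) := Or.inr ⟨by simpa using hi, by simpa using hf⟩
        simp [r1, r2, hf]
    · simp [κ, hi']
  have hm : ∀ i t, t ≠ 0 → κ (i, t) = (f i, t) := by
    intro i t ht
    simp [κ, ht]
  have hcases : ∀ i ∈ P, ∀ c ∈ block a' i, c = (i + 1, 0) ∨ c = (i, 0) ∨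
      (c.1 = i ∧ c.2 ≠ 0 ∧ c.2 < a' i - 1) := by
    rintro i hi ⟨p, t⟩ hc
    rw [mem_block] at hc
    by_cases ht : t = 0
    · subst ht
      rcases hc with hc | ⟨hc, _⟩
      · exact Or.inl hc
      · exact Or.inr (Or.inl (by simpa using hc))
    · rcases hc with hc | hc
      · simp at hc; omega
      · exact Or.inr (Or.inr ⟨hc.1, ht, hc.2⟩)
  have hmaps : ∀ i ∈ P, ∀ c ∈ block a' i, κ c ∈ block a (f i) := by
    intro i hi c hc
    have h2i := h2 i hi
    rw [mem_block, hw i hi]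
    rcases hcases i hi c hc with rfl | rfl | ⟨rfl, h1, h3⟩
    · rw [hr i hi]
      split_ifs
      · right; simp; omega
      · left; rfl
    · rw [hl i hi]
      split_ifs
      · left; rfl
      · right; simp; omega
    · right
      rw [show c = (c.1, c.2) from rfl, hm _ _ h1]
      exact ⟨rfl, h3⟩
  have hblock : ∀ i ∈ P, ∀ c ∈ block a' i, ∀ d ∈ block a' i, κ c = κ d → c = d := by
    intro i hi c hc d hd hcd
    rcases hcases i hi c hc with rfl | rfl | ⟨h1, h2, h3⟩ <;>
      rcases hcases i hi d hd with rfl | rfl | ⟨h4, h5, h6⟩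
    · rfl
    · rw [hl i hi, hr i hi] at hcd
      split_ifs at hcd <;> simp at hcd
    · rw [show d = (d.1, d.2) from rfl, hr i hi, hm _ _ h5] at hcd
      split_ifs at hcd <;> simp at hcd <;> omega
    · rw [hl i hi, hr i hi] at hcd
      split_ifs at hcd <;> simp at hcd
    · rfl
    · rw [show d = (d.1, d.2) from rfl, hl i hi, hm _ _ h5] at hcd
      split_ifs at hcd <;> simp at hcd <;> omega
    · rw [show c = (c.1, c.2) from rfl, hr i hi, hm _ _ h2] at hcd
      split_ifs at hcd <;> simp at hcd <;> omega
    · rw [show c = (c.1, c.2) from rfl, hl i hi, hm _ _ h2] at hcd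
      split_ifs at hcd <;> simp at hcd <;> omega
    · rw [show c = (c.1, c.2) from rfl, show d = (d.1, d.2) from rfl, hm _ _ h2, hm _ _ h5] at hcd
      ext
      · rw [h1, h4]
      · simpa using (Prod.ext_iff.1 hcd).2
  -- Images of coordinates from blocks at neighbouring positions can coincide only in the coordinate
  -- shared by the image blocks, and this is the image of the coordinate shared by the original
  -- blocks.
  have hsucc : ∀ i ∈ P, ∀ j ∈ P, ∀ c ∈ block a' i, ∀ d ∈ block a' j, κ c = κ d →
      f j = f i + 1 → c = d := by
    intro i hi j hj c hc d hd hcd hf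
    have hk := hmaps i hi c hc
    have hk' := hmaps j hj d hd
    have hκ := (eq_of_mem_block_of_mem_block hk (hcd ▸ hk') (by omega)).2
    have hshare : ∃ e, e ∈ block a' i ∧ e ∈ block a' j := by
      have h2i := h2 i hi
      have h2j := h2 j hj
      rcases (hadj i hi j hj).1 (Or.inl hf) with rfl | rfl
      · exact ⟨(i + 1, 0), mem_block.2 (Or.inl rfl), mem_block.2 (Or.inr ⟨rfl, by simp; omega⟩)⟩
      · exact ⟨(j + 1, 0), mem_block.2 (Or.inr ⟨rfl, by simp; omega⟩), mem_block.2 (Or.inl rfl)⟩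
    obtain ⟨e, hei, hej⟩ := hshare
    have he := (eq_of_mem_block_of_mem_block (hmaps i hi e hei) (hmaps j hj e hej) (by omega)).2
    rw [hblock i hi c hc e hei (hκ.trans he.symm), hblock j hj d hd e hej (hcd ▸ hκ.trans he.symm)]
  have hκinj : ∀ c ∈ cells a' P, ∀ d ∈ cells a' P, κ c = κ d → c = d := by
    intro c hc d hd hcd
    obtain ⟨i, hi, hci⟩ := mem_cells.1 hc
    obtain ⟨j, hj, hdj⟩ := mem_cells.1 hd
    have hk := hmaps i hi c hci
    have hk' := hmaps j hj d hdj
    rw [← hcd] at hk'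
    rcases lt_trichotomy (f i) (f j) with hf | hf | hf
    · exact hsucc i hi j hj c hci d hdj hcd (eq_of_mem_block_of_mem_block hk hk' hf).1
    · obtain rfl := hinj i hi j hj hf
      exact hblock i hi c hci d hdj hcd
    · exact (hsucc j hj i hi d hdj c hci hcd.symm
        (eq_of_mem_block_of_mem_block hk' hk hf).1).symm
  have hcard : ∀ (b : ℤ → ℕ) i, 2 ≤ b i → (block b i).card = b i := by
    intro b i hb
    rw [Finset.card_eq_sum_ones, sum_block]
    simp; omega
  have himage : ∀ i ∈ P, (block a' i).image κ = block a (f i) := by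
    intro i hi
    have h2i := h2 i hi
    refine Finset.eq_of_subset_of_card_le ?_ ?_
    · intro c hc
      obtain ⟨d, hd, rfl⟩ := Finset.mem_image.1 hc
      exact hmaps i hi d hd
    · rw [Finset.card_image_of_injOn (fun c hc d hd => hblock i hi c hc d hd), hcard _ _ h2i,
        hcard _ _ (by rw [hw i hi]; exact h2i), hw i hi]
  have hcells : (cells a' P).image κ = cells a (P.image f) := by
    ext c
    simp only [Finset.mem_image, mem_cells]
    constructor
    · rintro ⟨d, ⟨i, hi, hd⟩, rfl⟩
      exact ⟨f i, ⟨i, hi, rfl⟩, hmaps i hi d hd⟩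
    · rintro ⟨_, ⟨i, hi, rfl⟩, hc⟩
      rw [← himage i hi, Finset.mem_image] at hc
      obtain ⟨d, hd, rfl⟩ := hc
      exact ⟨d, ⟨i, hi, hd⟩, rfl⟩
  have hflow : ∀ x, IsFlow a (P.image f) x → IsFlow a' P (x ∘ κ) := by
    intro x hx i hi
    rw [← hx (f i) (Finset.mem_image_of_mem f hi), ← himage i hi,
      Finset.sum_image (fun c hc d hd => hblock i hi c hc d hd)]
    rfl
  obtain ⟨J, _, φ, hJ, hφ⟩ := h
  refine ⟨J, inferInstance, fun x => φ (x ∘ κ), ?_, fun x y hx hy => ?_⟩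
  · rw [hJ, ← hcells, Finset.card_image_of_injOn (fun c hc d hd => hκinj c hc d hd)]
  · rw [hφ _ _ (hflow x hx) (hflow y hy), pairing, pairing, ← hcells,
      Finset.sum_image (fun c hc d hd => hκinj c hc d hd)]
    rfl

end LinearPlumbing

/-! ### Integral vectors in standard lattices. -/

namespace LinearPlumbing

section Vectors

variable {J : Type} [Fintype J]

theorem dotProduct_self_nonneg_int (x : J → ℤ) : 0 ≤ x ⬝ᵥ x :=
  Finset.sum_nonneg fun i _ => mul_self_nonneg (x i)

theorem bessel {ι : Type*} [DecidableEq ι] (s : Finset ι) (U : ι → J → ℤ)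
    (hU : ∀ i ∈ s, ∀ j ∈ s, U i ⬝ᵥ U j = if i = j then 1 else 0) (x : J → ℤ) :
    ∑ i ∈ s, (x ⬝ᵥ U i) ^ 2 ≤ x ⬝ᵥ x := by
  set y := ∑ i ∈ s, (x ⬝ᵥ U i) • U i with hy
  have hxy : x ⬝ᵥ y = ∑ i ∈ s, (x ⬝ᵥ U i) ^ 2 := by
    rw [hy, dotProduct_sum]
    exact Finset.sum_congr rfl fun i _ => by rw [dotProduct_smul, smul_eq_mul, sq]
  have hyy : y ⬝ᵥ y = ∑ i ∈ s, (x ⬝ᵥ U i) ^ 2 := by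
    conv_lhs => rw [hy]
    rw [sum_dotProduct]
    refine Finset.sum_congr rfl fun i hi => ?_
    rw [smul_dotProduct, dotProduct_sum, Finset.sum_eq_single i]
    · rw [dotProduct_smul, hU i hi i hi, if_pos rfl]; simp [sq]
    · intro j hj hji
      rw [dotProduct_smul, hU i hi j hj, if_neg hji.symm, smul_zero]
    · exact fun h => absurd hi h
  have h := dotProduct_self_nonneg_int (x - y)
  rw [sub_dotProduct, dotProduct_sub, dotProduct_sub, dotProduct_comm y x, hxy, hyy] at h
  linarith

theorem exists_eq_single_of_dotProduct_self [DecidableEq J] {u : J → ℤ} (hu : u ⬝ᵥ u = 1) :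
    ∃ j ε, ε * ε = 1 ∧ u = Pi.single j ε := by
  obtain ⟨j, hj⟩ : ∃ j, u j ≠ 0 := by
    by_contra! h
    simp [dotProduct, h] at hu
  have hsplit := Finset.add_sum_erase Finset.univ (fun i => u i * u i) (Finset.mem_univ j)
  have hs : ∑ i, u i * u i = 1 := hu
  have h0 : 0 ≤ ∑ i ∈ Finset.univ.erase j, u i * u i :=
    Finset.sum_nonneg fun i _ => mul_self_nonneg (u i)
  have h1 : 1 ≤ u j * u j := by
    have := mul_self_pos.2 hj
    omega
  refine ⟨j, u j, by linarith, ?_⟩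
  ext i
  by_cases hij : i = j
  · subst hij; simp
  · rw [Pi.single_eq_of_ne hij]
    have hz : ∑ i ∈ Finset.univ.erase j, u i * u i = 0 := by linarith
    rw [Finset.sum_eq_zero_iff_of_nonneg fun i _ => mul_self_nonneg (u i)] at hz
    exact mul_self_eq_zero.1 (hz i (by simp [hij]))

/-- Vectors of square `2` have entries in `{-1, 0, 1}`, and a positive product forces a coordinate
where the two entries agree and are nonzero. -/
theorem exists_common_unit {r s : J → ℤ} (hr : r ⬝ᵥ r = 2) (hs : s ⬝ᵥ s = 2) (hrs : r ⬝ᵥ s = 1) :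
    ∃ u : J → ℤ, u ⬝ᵥ u = 1 ∧ u ⬝ᵥ r = 1 ∧ u ⬝ᵥ s = 1 := by
  classical
  have hbound : ∀ t : J → ℤ, t ⬝ᵥ t = 2 → ∀ i, -1 ≤ t i ∧ t i ≤ 1 := by
    intro t ht i
    have h : t i * t i ≤ 2 := ht ▸ Finset.single_le_sum
      (f := fun i => t i * t i) (fun i _ => mul_self_nonneg (t i)) (Finset.mem_univ i)
    constructor <;> nlinarith
  obtain ⟨i, hi⟩ : ∃ i, 0 < r i * s i := by
    by_contra! h
    have : r ⬝ᵥ s ≤ 0 := Finset.sum_nonpos fun i _ => h i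
    omega
  have hri := hbound r hr i
  have hsi := hbound s hs i
  rcases pos_and_pos_or_neg_and_neg_of_mul_pos hi with ⟨h1, h2⟩ | ⟨h1, h2⟩
  · exact ⟨Pi.single i 1, by simp, by simp; omega, by simp; omega⟩
  · exact ⟨Pi.single i (-1), by simp, by simp; omega, by simp; omega⟩

/-- Vectors of square `2` with pairwise products `1` have a common unit vector, unless three of
them form a triangle. -/
theorem exists_unit_of_star {ι : Type*} (s : Finset ι) (r : ι → J → ℤ)
    (hr : ∀ i ∈ s, r i ⬝ᵥ r i = 2) (hrr : ∀ i ∈ s, ∀ j ∈ s, i ≠ j → r i ⬝ᵥ r j = 1)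
    (hs : 2 ≤ s.card)
    (hex : ∀ i ∈ s, ∀ j ∈ s, ∀ l ∈ s, i ≠ j → i ≠ l → j ≠ l →
      ∃ y, y ⬝ᵥ r i = 1 ∧ y ⬝ᵥ r j = 1 ∧ y ⬝ᵥ r l = 1) :
    ∃ u : J → ℤ, u ⬝ᵥ u = 1 ∧ ∀ i ∈ s, u ⬝ᵥ r i = 1 := by
  obtain ⟨i, hi, j, hj, hij⟩ := Finset.one_lt_card.1 hs
  obtain ⟨u, hu, hui, huj⟩ := exists_common_unit (hr i hi) (hr j hj) (hrr i hi j hj hij)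
  refine ⟨u, hu, fun l hl => ?_⟩
  by_cases hli : i = l
  · rw [← hli, hui]
  by_cases hlj : j = l
  · rw [← hlj, huj]
  have hil := hrr i hi l hl hli
  have hjl := hrr j hj l hl hlj
  have hll := hr l hl
  have hii := hr i hi
  have hjj := hr j hj
  have hij' := hrr i hi j hj hij
  have c1 := dotProduct_comm u (r i)
  have c2 := dotProduct_comm u (r j)
  have c3 := dotProduct_comm u (r l)
  have c4 := dotProduct_comm (r i) (r j)
  have c5 := dotProduct_comm (r i) (r l)
  have c6 := dotProduct_comm (r j) (r l)
  set α := u ⬝ᵥ r l with hα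
  -- The vectors `u`, `r i - u`, `r j - u` are orthonormal, and for `β = 1 - α` this is the square
  -- of the part of `r l` orthogonal to them. Its nonnegativity leaves `α = 0` or `α = 1`.
  have key : ∀ β : ℤ, β = 1 - α →
      (r l - α • u - β • (r i - u) - β • (r j - u)) ⬝ᵥ
        (r l - α • u - β • (r i - u) - β • (r j - u)) = 2 - α ^ 2 - 2 * (1 - α) ^ 2 := by
    intro β hβ
    simp only [sub_dotProduct, dotProduct_sub, smul_dotProduct, dotProduct_smul, smul_eq_mul]
    rw [hll, hii, hjj, hu, ← c1, ← c2, ← c3, ← c4, ← c5, ← c6, hui, huj, hil, hjl, hij', hβ]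
    ring
  have h0 := dotProduct_self_nonneg_int
    (r l - α • u - (1 - α) • (r i - u) - (1 - α) • (r j - u))
  rw [key _ rfl] at h0
  have hα0 : 0 ≤ α := by nlinarith
  have hα1 : α ≤ 1 := by nlinarith
  by_contra hne
  have hα' : α = 0 := by omega
  have h1 := key 1 (by omega)
  -- For `α = 0` this is the triangle `r l = (r i - u) + (r j - u)`. A vector with product `1` with
  -- all three would give `1 = 2 (1 - y ⬝ᵥ u)`, which fails by parity.
  rw [hα', zero_smul, one_smul, one_smul, sub_zero] at h1
  replace h1 := dotProduct_self_eq_zero.1 (h1.trans (by norm_num))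
  obtain ⟨y, hy1, hy2, hy3⟩ := hex i hi j hj l hl hij hli hlj
  have h2 : y ⬝ᵥ (r l - (r i - u) - (r j - u)) = 0 := by rw [h1]; simp
  simp only [dotProduct_sub] at h2
  omega

theorem int_eq_zero_of_sq₁ {r : ℤ} (h : r ^ 2 + r ^ 2 + r ^ 2 + (1 + 2 * r) ^ 2 ≤ 3) : r = 0 := by
  have h1 : -1 < r := by nlinarith
  have h2 : r < 1 := by nlinarith
  omega

theorem int_eq_zero_of_sq₂ {r : ℤ} (h : r ^ 2 + r ^ 2 + r ^ 2 + (2 * r) ^ 2 ≤ 3) : r = 0 := by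
  have h1 : -1 < r := by nlinarith
  have h2 : r < 1 := by nlinarith
  omega

theorem int_eq_zero_of_sq₃ {r s : ℤ} (h : r ^ 2 + r ^ 2 + r ^ 2 + s ^ 2 ≤ 2) : r = 0 := by
  have h1 : -1 < r := by nlinarith [sq_nonneg s]
  have h2 : r < 1 := by nlinarith [sq_nonneg s]
  omega

theorem int_eq_of_sq {r : ℤ} (h : (r + 1) ^ 2 + r ^ 2 + r ^ 2 + (1 + 2 * r) ^ 2 ≤ 3) :
    r = 0 ∨ r = -1 := by
  have h1 : -2 < r := by nlinarith
  have h2 : r < 1 := by nlinarith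
  omega

/-- A configuration of vectors around a vertex of weight `-5` that does not occur. -/
theorem false_of_nonstandard_five (U₁ U₂ U₃ u v w y z z' : J → ℤ)
    (h11 : U₁ ⬝ᵥ U₁ = 1) (h22 : U₂ ⬝ᵥ U₂ = 1) (h33 : U₃ ⬝ᵥ U₃ = 1)
    (h12 : U₁ ⬝ᵥ U₂ = 0) (h13 : U₁ ⬝ᵥ U₃ = 0) (h23 : U₂ ⬝ᵥ U₃ = 0)
    (hv : v ⬝ᵥ v = 3) (hv1 : v ⬝ᵥ U₁ = -1) (hv2 : v ⬝ᵥ U₂ = -1) (hv3 : v ⬝ᵥ U₃ = 0)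
    (hu : u ⬝ᵥ u = 3) (hu1 : u ⬝ᵥ U₁ = u ⬝ᵥ U₂ + 1) (hu3 : u ⬝ᵥ U₃ = u ⬝ᵥ U₂)
    (huv : u ⬝ᵥ v = 0)
    (hw : w ⬝ᵥ w = 2 ∨ w ⬝ᵥ w = 3 ∧ z' ⬝ᵥ z' = 2 ∧ z' ⬝ᵥ w = 1)
    (hw1 : w ⬝ᵥ U₁ = w ⬝ᵥ U₂) (hw3 : w ⬝ᵥ U₃ = w ⬝ᵥ U₂) (hwv : w ⬝ᵥ v = 1) (hwu : w ⬝ᵥ u = 0)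
    (hy : y ⬝ᵥ y = 2 ∨ y ⬝ᵥ y = 3 ∧ z ⬝ᵥ z = 2 ∧ z ⬝ᵥ y = 1)
    (hy1 : y ⬝ᵥ U₁ = y ⬝ᵥ U₂) (hy3 : y ⬝ᵥ U₃ = y ⬝ᵥ U₂) (hyu : y ⬝ᵥ u = 1) (hyv : y ⬝ᵥ v = 0)
    (hyw : y ⬝ᵥ w = 0)
    (hz1 : z ⬝ᵥ U₁ = z ⬝ᵥ U₂) (hz3 : z ⬝ᵥ U₃ = z ⬝ᵥ U₂) (hzu : z ⬝ᵥ u = 0) (hzv : z ⬝ᵥ v = 0)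
    (hzw : z ⬝ᵥ w = 0)
    (hz1' : z' ⬝ᵥ U₁ = z' ⬝ᵥ U₂) (hz3' : z' ⬝ᵥ U₃ = z' ⬝ᵥ U₂) (hzu' : z' ⬝ᵥ u = 0)
    (hzv' : z' ⬝ᵥ v = 0) (hzy' : z' ⬝ᵥ y = 0) (hzz : z ⬝ᵥ z' = 0) : False := by
  have expand : ∀ x g : J → ℤ, g ⬝ᵥ g = 1 → U₁ ⬝ᵥ g = 0 → U₂ ⬝ᵥ g = 0 → U₃ ⬝ᵥ g = 0 →
      (x - (x ⬝ᵥ U₁) • U₁ - (x ⬝ᵥ U₂) • U₂ - (x ⬝ᵥ U₃) • U₃ - (x ⬝ᵥ g) • g) ⬝ᵥ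
      (x - (x ⬝ᵥ U₁) • U₁ - (x ⬝ᵥ U₂) • U₂ - (x ⬝ᵥ U₃) • U₃ - (x ⬝ᵥ g) • g) =
      x ⬝ᵥ x - (x ⬝ᵥ U₁) ^ 2 - (x ⬝ᵥ U₂) ^ 2 - (x ⬝ᵥ U₃) ^ 2 - (x ⬝ᵥ g) ^ 2 := by
    intro x g hg h1 h2 h3
    simp only [sub_dotProduct, dotProduct_sub, smul_dotProduct, dotProduct_smul, smul_eq_mul]
    rw [dotProduct_comm U₁ x, dotProduct_comm U₂ x, dotProduct_comm U₃ x, dotProduct_comm g x,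
      dotProduct_comm g U₁, dotProduct_comm g U₂, dotProduct_comm g U₃, dotProduct_comm U₂ U₁,
      dotProduct_comm U₃ U₁, dotProduct_comm U₃ U₂, h11, h22, h33, h12, h13, h23, hg, h1, h2, h3]
    ring
  have hbes : ∀ x g : J → ℤ, g ⬝ᵥ g = 1 → U₁ ⬝ᵥ g = 0 → U₂ ⬝ᵥ g = 0 → U₃ ⬝ᵥ g = 0 →
      (x ⬝ᵥ U₁) ^ 2 + (x ⬝ᵥ U₂) ^ 2 + (x ⬝ᵥ U₃) ^ 2 + (x ⬝ᵥ g) ^ 2 ≤ x ⬝ᵥ x := by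
    intro x g hg h1 h2 h3
    have h := dotProduct_self_nonneg_int
      (x - (x ⬝ᵥ U₁) • U₁ - (x ⬝ᵥ U₂) • U₂ - (x ⬝ᵥ U₃) • U₃ - (x ⬝ᵥ g) • g)
    rw [expand x g hg h1 h2 h3] at h
    linarith
  -- The proof determines the vectors one after another in an orthonormal system. Here `v = g - U₁ -
  -- U₂` with a unit vector `g` orthogonal to the `Uᵢ`.
  obtain ⟨g, G⟩ : ∃ g, ∀ x, x ⬝ᵥ g = x ⬝ᵥ v + x ⬝ᵥ U₁ + x ⬝ᵥ U₂ :=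
    ⟨v + U₁ + U₂, fun x => by simp only [dotProduct_add]⟩
  have hgU1 : U₁ ⬝ᵥ g = 0 := by rw [G, dotProduct_comm U₁ v]; omega
  have hgU2 : U₂ ⬝ᵥ g = 0 := by rw [G, dotProduct_comm U₂ v, dotProduct_comm U₂ U₁]; omega
  have hgU3 : U₃ ⬝ᵥ g = 0 := by
    rw [G, dotProduct_comm U₃ v, dotProduct_comm U₃ U₁, dotProduct_comm U₃ U₂]; omega
  have hgv : v ⬝ᵥ g = 1 := by rw [G]; omega
  have hgg : g ⬝ᵥ g = 1 := by
    rw [G, dotProduct_comm g v, dotProduct_comm g U₁, dotProduct_comm g U₂]; omega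
  have b := fun x => hbes x g hgg hgU1 hgU2 hgU3
  have hw0 : w ⬝ᵥ U₂ = 0 := by
    have hcw := b w
    rw [hw1, hw3, show w ⬝ᵥ g = 1 + 2 * (w ⬝ᵥ U₂) by rw [G]; omega] at hcw
    have : w ⬝ᵥ w ≤ 3 := by omega
    exact int_eq_zero_of_sq₁ (hcw.trans this)
  have hwg : w ⬝ᵥ g = 1 := by rw [G]; omega
  have hug : u ⬝ᵥ g = 1 + 2 * (u ⬝ᵥ U₂) := by rw [G]; omega
  have hu0 : u ⬝ᵥ U₂ = 0 := by
    have hs : u ⬝ᵥ U₂ = 0 ∨ u ⬝ᵥ U₂ = -1 := by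
      have hcu := b u
      rw [hu1, hu3, hug, hu] at hcu
      exact int_eq_of_sq hcu
    -- The value `-1` makes Bessel's inequality an equality, so `u = -U₂ - U₃ - g`; this has product
    -- `-1` with `w`, which is orthogonal to `u`.
    rcases hs with hs | hs
    · exact hs
    · exfalso
      have h := expand u g hgg hgU1 hgU2 hgU3
      rw [hug, hu1, hu3, hu, hs] at h
      replace h := dotProduct_self_eq_zero.1 (h.trans (by norm_num))
      have h' : w ⬝ᵥ 0 = 0 := dotProduct_zero w
      rw [← h] at h'
      simp only [dotProduct_sub, dotProduct_smul, smul_eq_mul] at h'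
      rw [hwu, hw1, hw3, hw0, hwg] at h'
      norm_num at h'
  have hy0 : y ⬝ᵥ U₂ = 0 := by
    have hcy := b y
    rw [hy1, hy3, show y ⬝ᵥ g = 2 * (y ⬝ᵥ U₂) by rw [G]; omega] at hcy
    have : y ⬝ᵥ y ≤ 3 := by omega
    exact int_eq_zero_of_sq₂ (hcy.trans this)
  have small : ∀ x : J → ℤ, x ⬝ᵥ x = 2 → x ⬝ᵥ U₁ = x ⬝ᵥ U₂ → x ⬝ᵥ U₃ = x ⬝ᵥ U₂ → x ⬝ᵥ U₂ = 0 := by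
    intro x hx h1 h3
    have hcx := b x
    rw [h1, h3, hx] at hcx
    exact int_eq_zero_of_sq₃ hcx
  have hyg : y ⬝ᵥ g = 0 := by rw [G]; omega
  -- Now `u = U₁ + g + g'` with a further unit vector `g'`.
  obtain ⟨g', G'⟩ : ∃ g', ∀ x, x ⬝ᵥ g' = x ⬝ᵥ u - x ⬝ᵥ U₁ - x ⬝ᵥ g :=
    ⟨u - U₁ - g, fun x => by simp only [dotProduct_sub]⟩
  have hug' : u ⬝ᵥ g' = 1 := by rw [G']; omega
  have hgg' : g ⬝ᵥ g' = 0 := by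
    rw [G', dotProduct_comm g u, dotProduct_comm g U₁]; omega
  have hU1g' : U₁ ⬝ᵥ g' = 0 := by rw [G', dotProduct_comm U₁ u]; omega
  have hg'g' : g' ⬝ᵥ g' = 1 := by
    rw [G', dotProduct_comm g' u, dotProduct_comm g' U₁, dotProduct_comm g' g]; omega
  have hwg' : w ⬝ᵥ g' = -1 := by rw [G']; omega
  have hyg' : y ⬝ᵥ g' = 1 := by rw [G']; omega
  -- Write `w = g - g' + h`. Since `y` is orthogonal to `w` but not to `g'`, it meets `h`; so `h ≠
  -- 0` and `w` has square `3`. The remainder `k` of `y = g' + h + k` is then nonzero because `z'`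
  -- meets it.
  obtain ⟨h, H⟩ : ∃ h, ∀ x, x ⬝ᵥ h = x ⬝ᵥ w - x ⬝ᵥ g + x ⬝ᵥ g' :=
    ⟨w - g + g', fun x => by simp only [dotProduct_sub, dotProduct_add]⟩
  have hwh : w ⬝ᵥ h = w ⬝ᵥ w - 2 := by rw [H]; omega
  have hgh : g ⬝ᵥ h = 0 := by rw [H, dotProduct_comm g w]; omega
  have hg'h : g' ⬝ᵥ h = 0 := by
    rw [H, dotProduct_comm g' w, dotProduct_comm g' g]; omega
  have hhh : h ⬝ᵥ h = w ⬝ᵥ w - 2 := by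
    rw [H, dotProduct_comm h w, dotProduct_comm h g, dotProduct_comm h g']; omega
  have hyh : y ⬝ᵥ h = 1 := by rw [H]; omega
  obtain ⟨k, K⟩ : ∃ k, ∀ x, x ⬝ᵥ k = x ⬝ᵥ y - x ⬝ᵥ g' - x ⬝ᵥ h :=
    ⟨y - g' - h, fun x => by simp only [dotProduct_sub]⟩
  have hyk : y ⬝ᵥ k = y ⬝ᵥ y - 2 := by rw [K]; omega
  have hg'k : g' ⬝ᵥ k = 0 := by rw [K, dotProduct_comm g' y]; omega
  rcases hw with hw | ⟨hw, hz'z', hz'w⟩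
  · rw [hw, sub_self, dotProduct_self_eq_zero] at hhh
    rw [hhh, dotProduct_zero] at hyh
    omega
  have hhk : h ⬝ᵥ k = 0 := by rw [K, dotProduct_comm h y, dotProduct_comm h g']; omega
  have hkk : k ⬝ᵥ k = y ⬝ᵥ y - 2 := by
    rw [K, dotProduct_comm k y, dotProduct_comm k g', dotProduct_comm k h]; omega
  have hz'0 := small z' hz'z' hz1' hz3'
  have hz'g : z' ⬝ᵥ g = 0 := by rw [G]; omega
  have hz'g' : z' ⬝ᵥ g' = 0 := by rw [G']; omega
  have hz'h : z' ⬝ᵥ h = 1 := by rw [H]; omega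
  have hz'k : z' ⬝ᵥ k = -1 := by rw [K]; omega
  rcases hy with hy | ⟨hy, hzz2, hzy⟩
  · rw [hy, sub_self, dotProduct_self_eq_zero] at hkk
    rw [hkk, dotProduct_zero] at hz'k
    omega
  have hz0 := small z hzz2 hz1 hz3
  have hzg : z ⬝ᵥ g = 0 := by rw [G]; omega
  have hzg' : z ⬝ᵥ g' = 0 := by rw [G']; omega
  have hzh : z ⬝ᵥ h = 0 := by rw [H]; omega
  have hzk : z ⬝ᵥ k = 1 := by rw [K]; omega
  -- Finally `z' = h - k`, while `z` meets `k` and not `h`, so `z` is not orthogonal to `z'`.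
  have hsq : (z' - h + k) ⬝ᵥ (z' - h + k) = 0 := by
    simp only [sub_dotProduct, dotProduct_sub, add_dotProduct, dotProduct_add]
    rw [dotProduct_comm h z', dotProduct_comm k z', dotProduct_comm k h]
    omega
  rw [dotProduct_self_eq_zero] at hsq
  have hz := dotProduct_zero z
  rw [← hsq] at hz
  simp only [dotProduct_sub, dotProduct_add] at hz
  omega

end Vectors

end LinearPlumbing

/-! ### Isometric representations of flows and removal of a vertex. -/

namespace LinearPlumbing

variable {a : ℤ → ℕ} {P Q : Finset ℤ} {k : ℕ} {X : ℤ} {x y : ℤ × ℕ → ℤ}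

theorem pairing_comm (x y : ℤ × ℕ → ℤ) : pairing a P x y = pairing a P y x :=
  Finset.sum_congr rfl fun _ _ => mul_comm _ _

theorem pairing_add_left (x x' y : ℤ × ℕ → ℤ) :
    pairing a P (x + x') y = pairing a P x y + pairing a P x' y := by
  simp [pairing, add_mul, Finset.sum_add_distrib]

theorem pairing_sub_left (x x' y : ℤ × ℕ → ℤ) :
    pairing a P (x - x') y = pairing a P x y - pairing a P x' y := by
  simp [pairing, sub_mul, Finset.sum_sub_distrib]

theorem pairing_smul_left (n : ℤ) (x y : ℤ × ℕ → ℤ) :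
    pairing a P (n • x) y = n * pairing a P x y := by
  simp [pairing, Finset.mul_sum, mul_assoc]

theorem pairing_single_left {c : ℤ × ℕ} (hc : c ∈ cells a P) (y : ℤ × ℕ → ℤ) :
    pairing a P (Pi.single c 1) y = y c := by
  rw [pairing, Finset.sum_eq_single c]
  · simp
  · intro d _ hd
    simp [Pi.single_eq_of_ne hd]
  · exact fun h => absurd hc h

/-- `φ` is an isometry from the flows on `P` to a standard lattice. -/
def IsRep {J : Type} [Fintype J] (a : ℤ → ℕ) (P : Finset ℤ) (φ : (ℤ × ℕ → ℤ) → J → ℤ) : Prop :=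
  ∀ x y, IsFlow a P x → IsFlow a P y → φ x ⬝ᵥ φ y = pairing a P x y

section Rep

variable {J : Type} [Fintype J] {φ : (ℤ × ℕ → ℤ) → J → ℤ}

/-- Linearity is not part of the definition. It follows because the target is definite and the
defect of additivity has square `0`. -/
theorem IsRep.add (hφ : IsRep a P φ) (hx : IsFlow a P x) (hy : IsFlow a P y) :
    φ (x + y) = φ x + φ y := by
  rw [← sub_eq_zero, ← dotProduct_self_eq_zero]
  simp only [sub_dotProduct, dotProduct_sub, add_dotProduct, dotProduct_add]
  rw [hφ _ _ (hx.add hy) (hx.add hy), hφ _ _ hx (hx.add hy), hφ _ _ hy (hx.add hy),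
    hφ _ _ (hx.add hy) hx, hφ _ _ (hx.add hy) hy, hφ _ _ hx hx, hφ _ _ hx hy, hφ _ _ hy hx,
    hφ _ _ hy hy]
  simp only [pairing_add_left, pairing_comm _ (x + y)]
  ring

theorem IsRep.smul (hφ : IsRep a P φ) (hx : IsFlow a P x) (n : ℤ) : φ (n • x) = n • φ x := by
  rw [← sub_eq_zero, ← dotProduct_self_eq_zero]
  simp only [sub_dotProduct, dotProduct_sub, smul_dotProduct, dotProduct_smul, smul_eq_mul]
  rw [hφ _ _ (hx.smul n) (hx.smul n), hφ _ _ hx (hx.smul n), hφ _ _ (hx.smul n) hx, hφ _ _ hx hx]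
  simp only [pairing_smul_left, pairing_comm _ (n • x)]
  ring

theorem IsRep.eq_zero (hφ : IsRep a P φ) (hx : IsFlow a P x) (h : ∀ c ∈ cells a P, x c = 0) :
    φ x = 0 := by
  rw [← dotProduct_self_eq_zero, hφ x x hx hx, pairing]
  exact Finset.sum_eq_zero fun c hc => by simp [h c hc]

/-- The coordinates met by `X` only. -/
def own (a : ℤ → ℕ) (P : Finset ℤ) (X : ℤ) : Finset (ℤ × ℕ) := block a X \ cells a (P.erase X)

theorem cells_eq_union_own (hX : X ∈ P) : cells a P = cells a (P.erase X) ∪ own a P X := by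
  rw [own, Finset.union_sdiff_self_eq_union]
  conv_lhs => rw [← Finset.insert_erase hX]
  rw [cells, Finset.biUnion_insert, Finset.union_comm, cells]

theorem disjoint_cells_own : Disjoint (cells a (P.erase X)) (own a P X) :=
  Finset.disjoint_sdiff

theorem notMem_own_of_mem_block {c : ℤ × ℕ} {Y : ℤ} (hY : Y ∈ P) (hne : Y ≠ X)
    (hc : c ∈ block a Y) : c ∉ own a P X := by
  intro h
  exact (Finset.mem_sdiff.1 h).2 (mem_cells.2 ⟨Y, Finset.mem_erase.2 ⟨hne, hY⟩, hc⟩)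

/-- The vectors `U c` are signed basis vectors on which `φ` merely records the own coordinates of
`X`. Deleting these directions together with the own coordinates preserves the corank. -/
theorem compressible_erase (hX : X ∈ P) (hφ : IsRep a P φ)
    (hk : Fintype.card J + k = (cells a P).card) (U : ℤ × ℕ → J → ℤ) {c₀ : ℤ × ℕ}
    (hc₀ : c₀ ∈ own a P X)
    (hU : ∀ c ∈ own a P X, ∀ d ∈ own a P X, U c ⬝ᵥ U d = if c = d then 1 else 0)
    (hUx : ∀ x, IsFlow a P x → ∀ c ∈ own a P X, φ x ⬝ᵥ U c = x c) :
    Compressible a (P.erase X) k := by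
  classical
  have hs : ∀ c : ℤ × ℕ, ∃ j ε, c ∈ own a P X → ε * ε = 1 ∧ U c = Pi.single j ε := by
    intro c
    by_cases hc : c ∈ own a P X
    · obtain ⟨j, ε, h1, h2⟩ := exists_eq_single_of_dotProduct_self
        (u := U c) (by rw [hU c hc c hc, if_pos rfl])
      exact ⟨j, ε, fun _ => ⟨h1, h2⟩⟩
    · obtain ⟨j, -⟩ := exists_eq_single_of_dotProduct_self
        (u := U c₀) (by rw [hU c₀ hc₀ c₀ hc₀, if_pos rfl])
      exact ⟨j, 0, fun h => absurd h hc⟩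
  choose ι ε hι using hs
  have hinj : Set.InjOn ι (own a P X) := by
    intro c hc d hd hcd
    by_contra hne
    have h := hU c hc d hd
    rw [if_neg hne, (hι c hc).2, (hι d hd).2, hcd] at h
    simp at h
    have h1 := (hι c hc).1
    have h2 := (hι d hd).1
    rcases h with h | h <;> simp [h] at h1 h2
  -- A flow without the condition at `X` becomes a flow on `P` if the own coordinate `c₀` takes the
  -- value that balances the block of `X` and the other own coordinates are `0`.
  let ext' : (ℤ × ℕ → ℤ) → (ℤ × ℕ → ℤ) := fun z c => if c ∈ own a P X then
    (if c = c₀ then -∑ d ∈ block a X \ own a P X, z d else 0) else z c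
  have hext : ∀ z, IsFlow a (P.erase X) z → IsFlow a P (ext' z) := by
    intro z hz i hi
    by_cases hiX : i = X
    · subst hiX
      have hsub : own a P i ⊆ block a i := Finset.sdiff_subset
      rw [← Finset.sum_sdiff hsub,
        Finset.sum_congr rfl (g := z), Finset.sum_eq_single (s := own a P i) c₀]
      · simp [ext', hc₀]
      · intro d hd hne
        simp [ext', hd, hne]
      · exact fun h => absurd hc₀ h
      · intro c hc
        simp [ext', (Finset.mem_sdiff.1 hc).2]
    · rw [← hz i (Finset.mem_erase.2 ⟨hiX, hi⟩)]
      refine Finset.sum_congr rfl fun c hc => ?_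
      simp [ext', notMem_own_of_mem_block hi hiX hc]
  have hcells : ∀ c ∈ cells a (P.erase X), ∀ z, ext' z c = z c := by
    intro c hc z
    have : c ∉ own a P X := fun h => Finset.disjoint_left.1 disjoint_cells_own hc h
    simp [ext', this]
  refine ⟨{j // j ∈ (Finset.univ \ (own a P X).image ι : Finset J)}, inferInstance,
    fun z j => φ (ext' z) j, ?_, fun z w hz hw => ?_⟩
  · have h1 := Finset.card_union_of_disjoint (disjoint_cells_own (a := a) (P := P) (X := X))
    rw [← cells_eq_union_own hX] at h1
    have h2 := Finset.card_sdiff_add_card_eq_card (Finset.subset_univ ((own a P X).image ι))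
    rw [Finset.card_image_of_injOn hinj, Finset.card_univ] at h2
    rw [Fintype.card_coe]
    omega
  · have h1 := hφ _ _ (hext z hz) (hext w hw)
    rw [pairing, cells_eq_union_own hX, Finset.sum_union disjoint_cells_own, dotProduct,
      ← Finset.sum_sdiff (Finset.subset_univ ((own a P X).image ι)), Finset.sum_image hinj] at h1
    have h2 : ∑ c ∈ own a P X, φ (ext' z) (ι c) * φ (ext' w) (ι c) =
        ∑ c ∈ own a P X, ext' z c * ext' w c := by
      refine Finset.sum_congr rfl fun c hc => ?_
      rw [← hUx _ (hext z hz) c hc, ← hUx _ (hext w hw) c hc, (hι c hc).2]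
      simp only [dotProduct_single]
      linear_combination (-(φ (ext' z) (ι c) * φ (ext' w) (ι c))) * (hι c hc).1
    rw [h2] at h1
    rw [dotProduct, Finset.sum_coe_sort (Finset.univ \ (own a P X).image ι)
      (fun j => φ (ext' z) j * φ (ext' w) j), add_right_cancel h1, pairing]
    exact Finset.sum_congr rfl fun c hc => by rw [hcells c hc, hcells c hc]

/-- The difference of two basis vectors. -/
def diff (c d : ℤ × ℕ) : ℤ × ℕ → ℤ := Pi.single c 1 - Pi.single d 1

theorem isFlow_diff {c d : ℤ × ℕ} (hX : X ∈ P) (hc : c ∈ own a P X) (hd : d ∈ own a P X) :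
    IsFlow a P (diff c d) := by
  intro i hi
  have h : ∀ e ∈ own a P X, ∑ b ∈ block a i, (Pi.single e 1 : ℤ × ℕ → ℤ) b =
      if i = X then 1 else 0 := by
    intro e he
    split_ifs with hiX
    · subst hiX
      rw [Finset.sum_eq_single e]
      · simp
      · intro b _ hb; simp [Pi.single_eq_of_ne hb]
      · exact fun h => absurd (Finset.mem_sdiff.1 he).1 h
    · refine Finset.sum_eq_zero fun b hb => Pi.single_eq_of_ne ?_ _
      rintro rfl
      exact notMem_own_of_mem_block hi hiX hb he
  simp [diff, Finset.sum_sub_distrib, h c hc, h d hd]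

theorem own_subset_cells (hX : X ∈ P) : own a P X ⊆ cells a P := by
  rw [cells_eq_union_own hX]; exact Finset.subset_union_right

theorem pairing_diff {c d : ℤ × ℕ} (hc : c ∈ cells a P) (hd : d ∈ cells a P) (y : ℤ × ℕ → ℤ) :
    pairing a P (diff c d) y = y c - y d := by
  rw [diff, pairing_sub_left, pairing_single_left hc, pairing_single_left hd]

/-- The differences of `c₀` with the other own coordinates form a star of vectors of square `2` with
products `1`. A common unit vector `u` of their images plays the role of the basis vector at `c₀`,
and `τ` measures the discrepancy. The extra flow for four own coordinates excludes the exceptional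
symmetry of `A₃`. -/
theorem exists_units (hφ : IsRep a P φ) (hX : X ∈ P) {c₀ : ℤ × ℕ} (hc₀ : c₀ ∈ own a P X)
    (h3 : 3 ≤ (own a P X).card)
    (hex : (own a P X).card = 4 →
      ∃ y, IsFlow a P y ∧ y c₀ = 1 ∧ ∀ c ∈ own a P X, c ≠ c₀ → y c = 0) :
    ∃ (U : ℤ × ℕ → J → ℤ) (τ : (ℤ × ℕ → ℤ) → ℤ),
      (∀ c ∈ own a P X, ∀ d ∈ own a P X, U c ⬝ᵥ U d = if c = d then 1 else 0) ∧
      ∀ x, IsFlow a P x → ∀ c ∈ own a P X, φ x ⬝ᵥ U c = x c + τ x := by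
  set σ := own a P X with hσ
  have hcell : ∀ c ∈ σ, c ∈ cells a P := fun c hc => own_subset_cells hX hc
  have hflow : ∀ c ∈ σ, IsFlow a P (diff c₀ c) := fun c hc => isFlow_diff hX hc₀ hc
  have hdot : ∀ x, IsFlow a P x → ∀ c ∈ σ, φ x ⬝ᵥ φ (diff c₀ c) = x c₀ - x c := by
    intro x hx c hc
    rw [dotProduct_comm, hφ _ _ (hflow c hc) hx, pairing_diff (hcell _ hc₀) (hcell _ hc)]
  have hr : ∀ c ∈ σ.erase c₀, φ (diff c₀ c) ⬝ᵥ φ (diff c₀ c) = 2 := by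
    intro c hc
    obtain ⟨h1, h2⟩ := Finset.mem_erase.1 hc
    rw [hdot _ (hflow c h2) c h2]
    simp [diff, h1, h1.symm]
  have hrr : ∀ c ∈ σ.erase c₀, ∀ d ∈ σ.erase c₀, c ≠ d →
      φ (diff c₀ c) ⬝ᵥ φ (diff c₀ d) = 1 := by
    intro c hc d hd hcd
    obtain ⟨h1, h2⟩ := Finset.mem_erase.1 hc
    obtain ⟨h3, h4⟩ := Finset.mem_erase.1 hd
    rw [hdot _ (hflow c h2) d h4]
    simp [diff, h1.symm, h3, hcd.symm]
  obtain ⟨u, huu, hu⟩ := exists_unit_of_star (σ.erase c₀) (fun c => φ (diff c₀ c)) hr hrr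
    (by rw [Finset.card_erase_of_mem hc₀]; omega) (by
      intro i hi j hj l hl hij hil hjl
      have hsub : ({i, j, l} : Finset (ℤ × ℕ)) ⊆ σ.erase c₀ := by
        intro e he
        simp only [Finset.mem_insert, Finset.mem_singleton] at he
        rcases he with rfl | rfl | rfl <;> assumption
      have hc3 : ({i, j, l} : Finset (ℤ × ℕ)).card = 3 := by
        rw [Finset.card_eq_three]; exact ⟨i, j, l, hij, hil, hjl, rfl⟩
      have hle := Finset.card_le_card hsub
      rw [hc3, Finset.card_erase_of_mem hc₀] at hle
      -- With four own coordinates the star has only three members and the given flow excludes a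
      -- triangle; with more, a further member of the star does.
      by_cases h4 : σ.card = 4
      · obtain ⟨y, hy, hy0, hyc⟩ := hex h4
        refine ⟨φ y, ?_, ?_, ?_⟩ <;>
        · rw [hdot y hy _ (Finset.mem_of_mem_erase ‹_›), hy0,
            hyc _ (Finset.mem_of_mem_erase ‹_›) (Finset.ne_of_mem_erase ‹_›)]
          norm_num
      · obtain ⟨m, hm, hm'⟩ := Finset.exists_mem_notMem_of_card_lt_card
          (s := {i, j, l}) (t := σ.erase c₀)
          (by rw [hc3, Finset.card_erase_of_mem hc₀]; omega)
        simp only [Finset.mem_insert, Finset.mem_singleton, not_or] at hm'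
        exact ⟨φ (diff c₀ m), hrr m hm i hi hm'.1, hrr m hm j hj hm'.2.1, hrr m hm l hl hm'.2.2⟩)
  have hu' : ∀ c ∈ σ, u ⬝ᵥ φ (diff c₀ c) = if c₀ = c then 0 else 1 := by
    intro c hc
    split_ifs with h
    · subst h
      rw [hφ.eq_zero (hflow c₀ hc₀) (by simp [diff]), dotProduct_zero]
    · exact hu c (Finset.mem_erase.2 ⟨Ne.symm h, hc⟩)
  refine ⟨fun c => u - φ (diff c₀ c), fun x => φ x ⬝ᵥ u - x c₀, ?_, ?_⟩
  · intro c hc d hd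
    simp only [sub_dotProduct, dotProduct_sub]
    rw [dotProduct_comm (φ (diff c₀ c)) u, huu, hu' c hc, hu' d hd, hdot _ (hflow c hc) d hd]
    by_cases h1 : c₀ = c
    · subst h1
      by_cases h2 : c₀ = d <;> simp [diff, h2]
    · by_cases h2 : c₀ = d
      · subst h2
        simp [diff, h1, Ne.symm h1]
      · by_cases h3 : c = d
        · subst h3
          simp [diff, h1, Ne.symm h1]
        · simp [diff, h1, h2, Ne.symm h2, h3, Ne.symm h3]
  · intro x hx c hc
    simp only [dotProduct_sub]
    rw [hdot x hx c hc]
    ring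

end Rep

end LinearPlumbing

/-! ### Runs of weight `-2` and generators of the flows. -/

namespace LinearPlumbing

variable {a : ℤ → ℕ} {P Q : Finset ℤ} {k : ℕ} {X : ℤ} {x y : ℤ × ℕ → ℤ}

/-- Only the end coordinates of a block can be shared. Weights at least `2` at the neighbours are
needed so that the right neighbour really contains `(X + 1, 0)`. -/
theorem mem_own (hX : X ∈ P) (h2 : 2 ≤ a X) (h2' : X - 1 ∈ P → 2 ≤ a (X - 1))
    (h2'' : X + 1 ∈ P → 2 ≤ a (X + 1)) {c : ℤ × ℕ} :
    c ∈ own a P X ↔ (c.1 = X ∧ c.2 ≠ 0 ∧ c.2 < a X - 1) ∨ (c = (X, 0) ∧ X - 1 ∉ P) ∨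
      (c = (X + 1, 0) ∧ X + 1 ∉ P) := by
  rcases c with ⟨p, t⟩
  rw [own, Finset.mem_sdiff, mem_cells]
  constructor
  · rintro ⟨hb, hn⟩
    rw [mem_block] at hb
    rcases hb with hb | ⟨hb, ht⟩
    · obtain ⟨rfl, rfl⟩ := Prod.mk.inj hb
      refine Or.inr (Or.inr ⟨rfl, fun h => hn ⟨X + 1, by simp [h], mem_block.2 (Or.inr ⟨rfl, ?_⟩)⟩⟩)
      have := h2'' h
      simp; omega
    · simp only at hb ht
      subst hb
      by_cases h0 : t = 0
      · subst h0
        exact Or.inr (Or.inl ⟨rfl, fun h => hn ⟨p - 1, by simp [h], mem_block.2 (Or.inl (by simp))⟩⟩)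
      · exact Or.inl ⟨rfl, h0, ht⟩
  · rintro (⟨h1, h3, h4⟩ | ⟨h1, h3⟩ | ⟨h1, h3⟩)
    · refine ⟨mem_block.2 (Or.inr ⟨h1, h4⟩), ?_⟩
      rintro ⟨i, hi, hb⟩
      rw [mem_block] at hb
      obtain ⟨hne, hi⟩ := Finset.mem_erase.1 hi
      rcases hb with hb | ⟨hb, -⟩
      · simp at hb; exact h3 hb.2
      · exact hne (hb.symm.trans h1)
    · obtain ⟨rfl, rfl⟩ := Prod.mk.inj h1
      refine ⟨mem_block.2 (Or.inr ⟨rfl, by simp; omega⟩), ?_⟩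
      rintro ⟨i, hi, hb⟩
      rw [mem_block] at hb
      obtain ⟨hne, hi⟩ := Finset.mem_erase.1 hi
      rcases hb with hb | ⟨hb, -⟩
      · have hpi : p = i + 1 := (Prod.mk.inj hb).1
        exact h3 (by rwa [hpi, add_sub_cancel_right])
      · exact hne hb.symm
    · obtain ⟨rfl, rfl⟩ := Prod.mk.inj h1
      refine ⟨mem_block.2 (Or.inl rfl), ?_⟩
      rintro ⟨i, hi, hb⟩
      rw [mem_block] at hb
      obtain ⟨hne, hi⟩ := Finset.mem_erase.1 hi
      rcases hb with hb | ⟨hb, -⟩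
      · simp at hb; exact hne hb.symm
      · subst hb; exact h3 hi

/-- The positions strictly between `i` and `j` form a maximal run of weights `-2`; the run may be
empty if `i` and `j` are vertices. -/
structure IsRun (a : ℤ → ℕ) (P : Finset ℤ) (i j : ℤ) : Prop where
  lt : i < j
  two : ∀ p, i < p → p < j → p ∈ P ∧ a p = 2
  left : i ∈ P → 3 ≤ a i
  right : j ∈ P → 3 ≤ a j
  nonempty : i + 1 = j → i ∈ P ∧ j ∈ P

/-- The flow along a run. -/
noncomputable def runFlow (a : ℤ → ℕ) (P : Finset ℤ) (i j : ℤ) : ℤ × ℕ → ℤ := fun c =>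
  if c.2 = 0 then (if i < c.1 ∧ c.1 ≤ j then ((c.1 - i).negOnePow : ℤ) else 0)
  else if c = (i, a i - 2) ∧ i ∈ P then 1
  else if c = (j, 1) ∧ j ∈ P then -((j - i).negOnePow : ℤ) else 0

theorem isFlow_runFlow {i j : ℤ} (h : IsRun a P i j) : IsFlow a P (runFlow a P i j) := by
  intro p hp
  rw [sum_block]
  have hij := h.lt
  rcases lt_trichotomy p i with hpi | rfl | hpi
  · rw [Finset.sum_eq_zero]
    · simp [runFlow]; omega
    · intro t ht
      simp [runFlow]
      split_ifs <;> omega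
  · have h3 := h.left hp
    rw [Finset.sum_eq_single (a p - 2)]
    · have : a p - 2 ≠ 0 := by omega
      simp [runFlow, this, hp, hij]
    · intro t _ ht
      simp [runFlow, ht, hij.ne]
    · intro ht
      simp at ht; omega
  · rcases lt_trichotomy p j with hpj | rfl | hpj
    · obtain ⟨-, h2⟩ := h.two p hpi hpj
      rw [h2]
      have e : p + 1 - i = p - i + 1 := by ring
      simp [runFlow, hpi, hpj.le, show i < p + 1 by omega, show p + 1 ≤ j by omega, e,
        Int.negOnePow_succ]
    · have h3 := h.right hp
      rw [show a p - 1 = (a p - 3) + 1 + 1 by omega, Finset.sum_range_succ', Finset.sum_range_succ',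
        Finset.sum_eq_zero]
      · simp [runFlow, hp, hij, hij.ne']
      · intro t _
        simp [runFlow, hij.ne']
    · rw [Finset.sum_eq_zero]
      · simp [runFlow]; omega
      · intro t ht
        simp [runFlow]
        split_ifs <;> omega

theorem runFlow_sq_le (i j : ℤ) (c : ℤ × ℕ) : runFlow a P i j c * runFlow a P i j c ≤ 1 := by
  have h : ∀ n : ℤ, (n.negOnePow : ℤ) * n.negOnePow = 1 := fun n => by
    rw [← abs_mul_abs_self, Int.abs_negOnePow]; rfl
  unfold runFlow
  split_ifs <;> simp [h]

/-- There are `j - i` alternating values `±1` along the run, and at most two more close the flow at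
its ends. -/
theorem pairing_runFlow_le {i j : ℤ} (h : IsRun a P i j) :
    pairing a P (runFlow a P i j) (runFlow a P i j) ≤ j - i + 2 := by
  classical
  set S : Finset (ℤ × ℕ) := (Finset.Ioc i j).image (fun p => (p, 0)) ∪ {(i, a i - 2), (j, 1)}
  have h0 : ∀ c, c ∉ S → runFlow a P i j c = 0 := by
    rintro ⟨p, t⟩ hc
    simp only [S, Finset.mem_union, Finset.mem_image, Finset.mem_Ioc, Finset.mem_insert,
      Finset.mem_singleton, not_or, Prod.mk.injEq, not_exists, not_and] at hc
    have h1 : t = 0 → ¬ (i < p ∧ p ≤ j) := fun h0 h1 => hc.1 p h1 rfl h0.symm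
    simp only [runFlow]
    split_ifs with h2 h3 h4 h5
    · exact absurd h3 (h1 h2)
    · rfl
    · simp at h4; exact absurd h4.1.2 (hc.2.1 h4.1.1)
    · simp at h5; exact absurd h5.1.2 (hc.2.2 h5.1.1)
    · rfl
  calc pairing a P (runFlow a P i j) (runFlow a P i j)
      ≤ ∑ c ∈ S, runFlow a P i j c * runFlow a P i j c := by
        rw [pairing]
        rw [Finset.sum_subset (Finset.subset_union_right (s₁ := cells a P) (s₂ := S)) fun c _ hc => by
          rw [h0 c hc, mul_zero]]
        exact Finset.sum_le_sum_of_subset_of_nonneg Finset.subset_union_left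
          fun c _ _ => mul_self_nonneg _
    _ ≤ ∑ c ∈ S, 1 := Finset.sum_le_sum fun c _ => runFlow_sq_le i j c
    _ ≤ j - i + 2 := by
        have h1 : S.card ≤ (Finset.Ioc i j).card + 2 :=
          (Finset.card_union_le _ _).trans (add_le_add Finset.card_image_le Finset.card_le_two)
        rw [Int.card_Ioc] at h1
        have := h.lt
        simp only [Finset.sum_const, nsmul_eq_mul, mul_one]
        omega

/-- The alternating part of a run flow meets a vertex of weight at most `-3` only in coordinates
shared with a neighbour, so only the closing values at the ends of the run can be seen. -/
theorem runFlow_own {i j : ℤ} (h : IsRun a P i j) (hX : X ∈ P) (h3 : 3 ≤ a X)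
    (h2' : X - 1 ∈ P → 2 ≤ a (X - 1)) (h2'' : X + 1 ∈ P → 2 ≤ a (X + 1)) {c : ℤ × ℕ}
    (hc : c ∈ own a P X) (h0 : runFlow a P i j c ≠ 0) :
    (X = i ∧ c = (i, a i - 2)) ∨ (X = j ∧ c = (j, 1)) := by
  rw [mem_own hX (by omega) h2' h2''] at hc
  have hij := h.lt
  rcases hc with ⟨h1, h4, h5⟩ | ⟨rfl, h4⟩ | ⟨rfl, h4⟩
  · simp only [runFlow, h4, if_false] at h0
    split_ifs at h0 with h6 h7
    · exact Or.inl ⟨by rw [← h1, h6.1], h6.1⟩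
    · exact Or.inr ⟨by rw [← h1, h7.1], h7.1⟩
    · exact absurd rfl h0
  · exfalso
    simp only [runFlow, if_true] at h0
    split_ifs at h0 with h6
    · by_cases hXj : X < j
      · have := (h.two X h6.1 hXj).2; omega
      · obtain rfl : X = j := by omega
        by_cases hi : i + 1 = X
        · apply h4
          rw [← hi, add_sub_cancel_right]
          exact (h.nonempty hi).1
        · exact h4 (h.two (X - 1) (by omega) (by omega)).1
    · exact h0 rfl
  · exfalso
    simp only [runFlow, if_true] at h0
    split_ifs at h0 with h6
    · by_cases hXi : X = i
      · subst hXi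
        by_cases hj : X + 1 = j
        · exact h4 (hj ▸ (h.nonempty hj).2)
        · exact h4 (h.two (X + 1) (by omega) (by omega)).1
      · have := (h.two X (by omega) (by omega)).2; omega
    · exact h0 rfl

theorem exists_run_end (P : Finset ℤ) (i : ℤ) :
    ∃ j, i < j ∧ (∀ p, i < p → p < j → p ∈ P ∧ a p = 2) ∧ ¬ (j ∈ P ∧ a j = 2) := by
  classical
  have hex : ∃ n : ℕ, ¬ (i + 1 + n ∈ P ∧ a (i + 1 + n) = 2) := by
    by_contra! h
    obtain ⟨b, hb⟩ := P.bddAbove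
    have := hb (h (b - i).toNat).1
    omega
  refine ⟨i + 1 + Nat.find hex, by omega, fun p h1 h2 => ?_, Nat.find_spec hex⟩
  have := Nat.find_min hex (m := (p - i - 1).toNat) (by omega)
  rw [not_not, show i + 1 + ((p - i - 1).toNat : ℤ) = p by omega] at this
  exact this

/-- Flows are generated by differences of coordinates met by the same vertex only and by flows along
runs. -/
theorem flow_induction (h2 : ∀ i ∈ P, 2 ≤ a i) {p : (ℤ × ℕ → ℤ) → Prop}
    (hadd : ∀ x y, IsFlow a P x → IsFlow a P y → p x → p y → p (x + y))
    (hsmul : ∀ (n : ℤ) x, IsFlow a P x → p x → p (n • x))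
    (hzero : ∀ x, IsFlow a P x → (∀ c ∈ cells a P, x c = 0) → p x)
    (hdiff : ∀ X ∈ P, ∀ c ∈ own a P X, ∀ d ∈ own a P X, p (diff c d))
    (hrun : ∀ i j, IsRun a P i j → p (runFlow a P i j)) (x : ℤ × ℕ → ℤ) (hx : IsFlow a P x) :
    p x := by
  classical
  -- The induction is on the number of coordinates from the first nonzero one on, in the
  -- lexicographic order. A generator with leading value `±1` at that coordinate clears it.
  induction hn : ((cells a P).filter fun c => ∃ d ∈ cells a P, x d ≠ 0 ∧ toLex d ≤ toLex c).card
    using Nat.strong_induction_on generalizing x with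
  | _ n ih =>
  by_cases h0 : ∀ c ∈ cells a P, x c = 0
  · exact hzero x hx h0
  push Not at h0
  obtain ⟨c, hc, hmin⟩ := Finset.exists_min_image ((cells a P).filter fun c => x c ≠ 0) toLex
    (by obtain ⟨c, hc⟩ := h0; exact ⟨c, by simpa using hc⟩)
  obtain ⟨hc, hxc⟩ := Finset.mem_filter.1 hc
  have hlow : ∀ d ∈ cells a P, toLex d < toLex c → x d = 0 := by
    intro d hd hdc
    by_contra hne
    exact absurd (hmin d (Finset.mem_filter.2 ⟨hd, hne⟩)) (not_le.2 hdc)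
  have hlow' : ∀ d ∈ cells a P, (d.1 < c.1 ∨ d.1 = c.1 ∧ d.2 < c.2) → x d = 0 :=
    fun d hd hdc => hlow d hd (Prod.Lex.toLex_lt_toLex.2 hdc)
  obtain ⟨g, hg, hpg, hgc, hglow⟩ : ∃ g, IsFlow a P g ∧ p g ∧ g c * g c = 1 ∧
      ∀ d, (d.1 < c.1 ∨ d.1 = c.1 ∧ d.2 < c.2) → g d = 0 := by
    obtain ⟨i, t⟩ := c
    -- If the leading coordinate were shared with `i - 1`, all other coordinates of that block would
    -- precede it, and the condition at `i - 1` would make it vanish.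
    have hi' : ¬ (i - 1 ∈ P ∧ t = 0) := by
      rintro ⟨hi, rfl⟩
      have hs := hx (i - 1) hi
      rw [sum_block, sub_add_cancel, Finset.sum_eq_zero, add_zero] at hs
      · exact hxc hs
      · intro t ht
        exact hlow' _ (block_subset_cells hi (mem_block.2 (Or.inr ⟨rfl, by simpa using ht⟩)))
          (Or.inl (by simp))
    obtain ⟨hi, ht⟩ : i ∈ P ∧ t < a i - 1 := by
      obtain ⟨q, hq, hcq⟩ := mem_cells.1 hc
      rw [mem_block] at hcq
      rcases hcq with h | ⟨h, h'⟩
      · obtain ⟨rfl, rfl⟩ := Prod.mk.inj h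
        exact absurd ⟨by simpa using hq, rfl⟩ hi'
      · simp only at h h'
        subst h
        exact ⟨hq, h'⟩
    have hai := h2 i hi
    have hown : ∀ {d}, d ∈ own a P i ↔ (d.1 = i ∧ d.2 ≠ 0 ∧ d.2 < a i - 1) ∨
        (d = (i, 0) ∧ i - 1 ∉ P) ∨ (d = (i + 1, 0) ∧ i + 1 ∉ P) :=
      mem_own hi hai (h2 _) (h2 _)
    have hct : (i, t) ∈ own a P i := by
      rw [hown]
      by_cases h : t = 0
      · subst h
        exact Or.inr (Or.inl ⟨rfl, fun h => hi' ⟨h, rfl⟩⟩)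
      · exact Or.inl ⟨rfl, h, ht⟩
    have hdiffcase : ∀ d ∈ own a P i, (i < d.1 ∨ i = d.1 ∧ t < d.2) →
        ∃ g, IsFlow a P g ∧ p g ∧ g (i, t) * g (i, t) = 1 ∧
          ∀ e : ℤ × ℕ, (e.1 < i ∨ e.1 = i ∧ e.2 < t) → g e = 0 := by
      intro d hd hlt
      refine ⟨diff (i, t) d, isFlow_diff hi hct hd, hdiff i hi _ hct _ hd, ?_, ?_⟩
      · have : (i, t) ≠ d := by rintro rfl; simp at hlt
        simp [diff, this]
      · intro e he
        have h1 : e ≠ (i, t) := by rintro rfl; simp at he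
        have h2 : e ≠ d := by rintro rfl; omega
        simp [diff, h1, h2]
    by_cases ht' : t + 1 < a i - 1
    · exact hdiffcase (i, t + 1) (hown.2 (Or.inl ⟨rfl, by simp, ht'⟩)) (Or.inr ⟨rfl, by simp⟩)
    -- The leading coordinate is now the last of its block before `(i + 1, 0)`. If that one is
    -- shared, the flow must continue into the next vertex, and a run flow replaces a difference.
    by_cases hi1 : i + 1 ∈ P
    swap
    · exact hdiffcase (i + 1, 0) (hown.2 (Or.inr (Or.inr ⟨rfl, hi1⟩))) (Or.inl (by simp))
    have hsq : ∀ n : ℤ, (n.negOnePow : ℤ) * n.negOnePow = 1 := fun n => by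
      rw [← abs_mul_abs_self, Int.abs_negOnePow]; rfl
    by_cases h3 : 3 ≤ a i
    · obtain ⟨j, hj1, hj2, hj3⟩ := exists_run_end (a := a) P i
      have hr : IsRun a P i j := by
        refine ⟨hj1, hj2, fun _ => h3, fun hj => ?_, fun h => ⟨hi, h ▸ hi1⟩⟩
        have := h2 j hj
        have h' : a j ≠ 2 := fun h => hj3 ⟨hj, h⟩
        omega
      refine ⟨_, isFlow_runFlow hr, hrun i j hr, ?_, ?_⟩
      · have : t = a i - 2 := by omega
        have h0 : a i - 2 ≠ 0 := by omega
        simp [runFlow, this, h0, hi]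
      · rintro ⟨q, s⟩ he
        simp only at he
        simp only [runFlow, Prod.mk.injEq]
        split_ifs <;> first | rfl | omega
    -- Here the leading coordinate `(i, 0)` is the free left end of a run of `-2`, so the run is
    -- bounded on the left by the empty position `i - 1`.
    · have hai2 : a i = 2 := by omega
      have ht0 : t = 0 := by omega
      subst ht0
      have him : i - 1 ∉ P := fun h => hi' ⟨h, rfl⟩
      obtain ⟨j, hj1, hj2, hj3⟩ := exists_run_end (a := a) P i
      have hr : IsRun a P (i - 1) j := by
        refine ⟨by omega, fun q hq1 hq2 => ?_, fun h => absurd h him, fun hj => ?_,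
          fun h => by omega⟩
        · by_cases hq : q = i
          · subst hq; exact ⟨hi, hai2⟩
          · exact hj2 q (by omega) hq2
        · have := h2 j hj
          have h' : a j ≠ 2 := fun h => hj3 ⟨hj, h⟩
          omega
      refine ⟨_, isFlow_runFlow hr, hrun _ j hr, ?_, ?_⟩
      · have : i - 1 < i ∧ i ≤ j := by omega
        simp [runFlow, this]
      · rintro ⟨q, s⟩ he
        simp only at he
        simp only [runFlow, Prod.mk.injEq, him, and_false, if_false]
        split_ifs <;> first | rfl | omega
  have hglow' : ∀ d, toLex d < toLex c → g d = 0 :=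
    fun d hd => hglow d (Prod.Lex.toLex_lt_toLex.1 hd)
  have hx' : IsFlow a P (x - (x c * g c) • g) := hx.sub (hg.smul _)
  have hx'c : (x - (x c * g c) • g) c = 0 := by
    simp only [Pi.sub_apply, Pi.smul_apply, smul_eq_mul]
    linear_combination (-(x c)) * hgc
  have hx'low : ∀ d ∈ cells a P, (x - (x c * g c) • g) d ≠ 0 → toLex c < toLex d := by
    intro d hd hne
    by_contra hlt
    rcases lt_or_eq_of_le (not_lt.1 hlt) with h | h
    · exact hne (by simp [hlow d hd h, hglow' d h])
    · rw [toLex_inj] at h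
      exact hne (h ▸ hx'c)
  have hp' : p (x - (x c * g c) • g) := by
    refine ih _ ?_ _ hx' rfl
    rw [← hn]
    refine Finset.card_lt_card (Finset.ssubset_iff_of_subset ?_ |>.2 ⟨c, ?_, ?_⟩)
    · intro e he
      obtain ⟨he, d, hd, hne, hde⟩ := Finset.mem_filter.1 he
      exact Finset.mem_filter.2 ⟨he, c, hc, hxc, (hx'low d hd hne).le.trans hde⟩
    · exact Finset.mem_filter.2 ⟨hc, c, hc, hxc, le_rfl⟩
    · intro hmem
      obtain ⟨-, d, hd, hne, hde⟩ := Finset.mem_filter.1 hmem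
      exact absurd (hx'low d hd hne) (not_lt.2 hde)
  have := hadd _ _ hx' (hg.smul (x c * g c)) hp' (hsmul _ g hg hpg)
  rwa [sub_add_cancel] at this

end LinearPlumbing

/-! ### Packs of cheap pieces and minimal sets. -/

namespace LinearPlumbing

variable {a : ℤ → ℕ} {P Q : Finset ℤ} {k : ℕ} {X : ℤ} {x y : ℤ × ℕ → ℤ}

/-- The positions in `T` are the vertices of weight `-2` and `-4` and the first vertices of the pairs
of weights `-3` in a disjoint union of pairwise nonadjacent pieces of these types. -/
structure IsPack (a : ℤ → ℕ) (P T : Finset ℤ) : Prop where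
  piece : ∀ p ∈ T, p ∈ P ∧ (a p = 2 ∨ a p = 4 ∨ a p = 3 ∧ p + 1 ∈ P ∧ a (p + 1) = 3)
  sep : ∀ p ∈ T, ∀ q ∈ T, p < q → p + 2 ≤ q ∧ (a p = 3 → p + 3 ≤ q)

/-- The vertices of a pack. -/
def packSupport (a : ℤ → ℕ) (T : Finset ℤ) : Finset ℤ :=
  T ∪ (T.filter fun p => a p = 3).image (· + 1)

theorem mem_packSupport {T : Finset ℤ} {p : ℤ} :
    p ∈ packSupport a T ↔ p ∈ T ∨ p - 1 ∈ T ∧ a (p - 1) = 3 := by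
  simp only [packSupport, Finset.mem_union, Finset.mem_image, Finset.mem_filter]
  refine or_congr_right ⟨?_, fun h => ⟨p - 1, h, by ring⟩⟩
  rintro ⟨q, h, rfl⟩
  simpa using h

theorem IsPack.mono {T T' : Finset ℤ} (h : IsPack a P T) (hT : T' ⊆ T) : IsPack a P T' :=
  ⟨fun p hp => h.piece p (hT hp), fun p hp q hq => h.sep p (hT hp) q (hT hq)⟩

theorem packSupport_union (T T' : Finset ℤ) :
    packSupport a (T ∪ T') = packSupport a T ∪ packSupport a T' := by
  ext p
  simp only [mem_packSupport, Finset.mem_union]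
  tauto

theorem IsPack.separated {T T' : Finset ℤ} (h : IsPack a P (T ∪ T')) (hd : Disjoint T T') :
    ∀ i ∈ packSupport a T, ∀ j ∈ packSupport a T', i + 2 ≤ j ∨ j + 2 ≤ i := by
  have key : ∀ p ∈ T, ∀ q ∈ T', p + 2 ≤ q ∧ (a p = 3 → p + 3 ≤ q) ∨
      q + 2 ≤ p ∧ (a q = 3 → q + 3 ≤ p) := by
    intro p hp q hq
    have hp' := Finset.mem_union_left T' hp
    have hq' := Finset.mem_union_right T hq
    rcases lt_trichotomy p q with hpq | rfl | hpq
    · exact Or.inl (h.sep p hp' q hq' hpq)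
    · exact absurd hq (Finset.disjoint_left.1 hd hp)
    · exact Or.inr (h.sep q hq' p hp' hpq)
  intro i hi j hj
  rw [mem_packSupport] at hi hj
  rcases hi with hi | ⟨hi, hi3⟩ <;> rcases hj with hj | ⟨hj, hj3⟩ <;>
  · rcases key _ hi _ hj with ⟨h1, h2⟩ | ⟨h1, h2⟩ <;> omega

/-- A `-4` or a pair of `-3` saves one coordinate, and two of the `-2` save two together; at most
one `-2` is left over, hence the loss of one. -/
theorem IsPack.compressible {T : Finset ℤ} (h : IsPack a P T) :
    Compressible a (packSupport a T) (T.card - 1) := by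
  induction hn : T.card using Nat.strong_induction_on generalizing T with
  | _ n ih =>
  by_cases h2 : ∃ p ∈ T, a p ≠ 2
  · obtain ⟨p, hp, hp2⟩ := h2
    have hT : T.erase p ∪ {p} = T := by
      rw [Finset.union_comm, ← Finset.insert_eq, Finset.insert_erase hp]
    have hd : Disjoint (T.erase p) {p} := by simp
    have hc := Finset.card_erase_add_one hp
    have h1 : Compressible a (packSupport a {p}) 1 := by
      rcases (h.piece p hp).2 with hp | hp | ⟨hp, -, hp'⟩
      · exact absurd hp hp2
      · have : packSupport a {p} = {p} := by
          ext q; simp only [mem_packSupport, Finset.mem_singleton]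
          refine ⟨?_, Or.inl⟩
          rintro (h | ⟨h, h'⟩)
          · exact h
          · rw [h] at h'; omega
        rw [this]; exact compressible_four hp
      · have : packSupport a {p} = {p, p + 1} := by
          ext q; simp only [mem_packSupport, Finset.mem_singleton, Finset.mem_insert]
          refine or_congr_right ⟨fun h => by omega, ?_⟩
          rintro rfl
          simpa using hp
        rw [this]; exact compressible_three_three hp hp'
    have h3 := (ih _ (by omega) (h.mono (Finset.erase_subset p T)) rfl).union h1
      (IsPack.separated (P := P) (by rwa [hT]) hd)
    rw [← packSupport_union, hT] at h3
    exact h3.mono (by omega)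
  · push Not at h2
    by_cases hcard : n ≤ 1
    · exact compressible_zero.mono (by omega)
    obtain ⟨p, hp, q, hq, hpq⟩ := Finset.one_lt_card.1 (show 1 < T.card by omega)
    wlog hlt : p < q generalizing p q
    · exact this q hq p hp hpq.symm (by omega)
    have hsub : {p, q} ⊆ T := by
      intro e he
      simp only [Finset.mem_insert, Finset.mem_singleton] at he
      rcases he with rfl | rfl <;> assumption
    have hT : T \ {p, q} ∪ {p, q} = T := Finset.sdiff_union_of_subset hsub
    have hc := Finset.card_sdiff_add_card_eq_card hsub
    rw [Finset.card_pair hpq] at hc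
    have h1 : packSupport a {p, q} = {p, q} := by
      ext e
      rw [mem_packSupport]
      refine ⟨?_, Or.inl⟩
      rintro (he | ⟨he, he'⟩)
      · exact he
      · rw [h2 _ (hsub he)] at he'; omega
    have h3 := (ih _ (by omega) (h.mono (Finset.sdiff_subset (t := {p, q}))) rfl).union
      (h1 ▸ compressible_two_two (h2 p hp) (h2 q hq) (h.sep p hp q hq hlt).1)
      (IsPack.separated (P := P) (by rwa [hT]) Finset.sdiff_disjoint)
    rw [← packSupport_union, hT] at h3
    exact h3.mono (by omega)

/-- `P` is minimal among the sets of positions whose plumbing is compressible. -/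
structure IsMinimal (a : ℤ → ℕ) (P : Finset ℤ) (k : ℕ) : Prop where
  two_le : ∀ i ∈ P, 2 ≤ a i
  compressible : Compressible a P k
  erase : ∀ i ∈ P, ¬ Compressible a (P.erase i) k

theorem IsMinimal.eq_of_subset (h : IsMinimal a P k) (hQ : Q ⊆ P) (hc : Compressible a Q k) :
    Q = P := by
  by_contra hne
  obtain ⟨i, hi, hiQ⟩ := Finset.exists_of_ssubset (hQ.ssubset_of_ne hne)
  exact h.erase i hi (hc.superset fun j hj => Finset.mem_erase.2
    ⟨fun e => hiQ (e ▸ hj), hQ hj⟩)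

/-- The support of a pack of exactly `k + 1` pieces is already compressible for `k`, so by
minimality it is all of `P`; a piece has at most two vertices and weights at least `-4`. -/
theorem IsMinimal.pack_card_le (h : IsMinimal a P k) :
    (∀ T, IsPack a P T → T.card ≤ k) ∨ P.card ≤ 2 * (k + 1) ∧ ∀ i ∈ P, a i ≤ 4 := by
  by_contra! hcon
  obtain ⟨⟨T, hT, hk⟩, h'⟩ := hcon
  obtain ⟨T', hT', hk'⟩ := Finset.exists_subset_card_eq (show k + 1 ≤ T.card by omega)
  have hp := hT.mono hT'
  have hsub : packSupport a T' ⊆ P := by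
    intro p hpp
    rcases mem_packSupport.1 hpp with hpp | ⟨hpp, h3⟩
    · exact (hp.piece p hpp).1
    · rcases (hp.piece _ hpp).2 with h | h | ⟨-, h, -⟩
      · omega
      · omega
      · simpa using h
  have hc := hp.compressible
  rw [hk', Nat.add_sub_cancel] at hc
  have hP := h.eq_of_subset hsub hc
  obtain ⟨i, hi, h4⟩ := h' (by
    rw [← hP, packSupport]
    refine (Finset.card_union_le _ _).trans ?_
    have := (Finset.card_image_le (s := T'.filter fun p => a p = 3) (f := (· + 1))).trans
      (Finset.card_filter_le _ _)
    omega)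
  rw [← hP, mem_packSupport] at hi
  rcases hi with hi | ⟨hi, h3⟩
  · rcases (hp.piece i hi).2 with h | h | h <;> omega
  · rcases (hp.piece _ hi).2 with h | h | ⟨-, -, h⟩
    · omega
    · omega
    · rw [sub_add_cancel] at h; omega

theorem exists_run_start (P : Finset ℤ) (j : ℤ) :
    ∃ i, i < j ∧ (∀ p, i < p → p < j → p ∈ P ∧ a p = 2) ∧ ¬ (i ∈ P ∧ a i = 2) := by
  obtain ⟨i, h1, h2, h3⟩ := exists_run_end (a := fun p => a (-p)) (P.image fun p => -p) (-j)
  have hmem : ∀ p, p ∈ P.image (fun p => -p) ↔ -p ∈ P := by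
    intro p
    simp only [Finset.mem_image]
    exact ⟨by rintro ⟨q, hq, rfl⟩; simpa using hq, fun h => ⟨-p, h, by ring⟩⟩
  refine ⟨-i, by omega, fun p hp hq => ?_, ?_⟩
  · have := h2 (-p) (by omega) (by omega)
    rwa [hmem, neg_neg] at this
  · rwa [hmem] at h3

theorem exists_isRun_right (h2 : ∀ i ∈ P, 2 ≤ a i) {i : ℤ} (hi : i ∈ P) (h3 : 3 ≤ a i)
    (hi' : i + 1 ∈ P) : ∃ j, IsRun a P i j := by
  obtain ⟨j, h4, h5, h6⟩ := exists_run_end (a := a) P i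
  refine ⟨j, h4, h5, fun _ => h3, fun hj => ?_, fun h => ⟨hi, h ▸ hi'⟩⟩
  have := h2 j hj
  have : a j ≠ 2 := fun h => h6 ⟨hj, h⟩
  omega

theorem exists_isRun_left (h2 : ∀ i ∈ P, 2 ≤ a i) {j : ℤ} (hj : j ∈ P) (h3 : 3 ≤ a j)
    (hj' : j - 1 ∈ P) : ∃ i, IsRun a P i j := by
  obtain ⟨i, h4, h5, h6⟩ := exists_run_start (a := a) P j
  refine ⟨i, h4, h5, fun hi => ?_, fun _ => h3, fun h => ⟨?_, hj⟩⟩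
  · have := h2 i hi
    have : a i ≠ 2 := fun h => h6 ⟨hi, h⟩
    omega
  · rwa [← h, add_sub_cancel_right] at hj'

theorem IsRun.le_of_lt {i j i' j' : ℤ} (h : IsRun a P i j) (h' : IsRun a P i' j') (hlt : i < i') :
    j ≤ i' := by
  by_contra! hj
  obtain ⟨h1, h2⟩ := h.two i' hlt hj
  have := h'.left h1
  omega

/-- Every other vertex of a run. -/
noncomputable def runPack (i j : ℤ) : Finset ℤ :=
  (Finset.range ((j - i) / 2).toNat).image fun t : ℕ => i + 1 + 2 * t

theorem mem_runPack {i j p : ℤ} :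
    p ∈ runPack i j ↔ ∃ t : ℕ, 2 * (t : ℤ) + 2 ≤ j - i ∧ p = i + 1 + 2 * t := by
  simp only [runPack, Finset.mem_image, Finset.mem_range]
  refine exists_congr fun t => and_congr ?_ eq_comm
  omega

/-- The run has `j - i - 1` vertices, and taking every other one starting with the first gives half
of them, rounded up. -/
theorem card_runPack {i j : ℤ} (h : i < j) : ((runPack i j).card : ℤ) = (j - i) / 2 := by
  rw [runPack, Finset.card_image_of_injective _ fun s t hst => by simpa using hst,
    Finset.card_range]
  omega

/-- Two different runs are separated by a position that is empty or has weight at most `-3`, so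
their packs can be combined. -/
theorem isPack_biUnion_runPack (I : Finset ℤ) (J : ℤ → ℤ) (h : ∀ i ∈ I, IsRun a P i (J i)) :
    IsPack a P (I.biUnion fun i => runPack i (J i)) := by
  have h2 : ∀ i ∈ I, ∀ p ∈ runPack i (J i), p ∈ P ∧ a p = 2 := by
    intro i hi p hp
    obtain ⟨t, ht, rfl⟩ := mem_runPack.1 hp
    exact (h i hi).two _ (by omega) (by omega)
  refine ⟨fun p hp => ?_, fun p hp q hq hpq => ?_⟩
  · obtain ⟨i, hi, hp⟩ := Finset.mem_biUnion.1 hp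
    exact ⟨(h2 i hi p hp).1, Or.inl (h2 i hi p hp).2⟩
  · obtain ⟨i, hi, hp⟩ := Finset.mem_biUnion.1 hp
    obtain ⟨i', hi', hq⟩ := Finset.mem_biUnion.1 hq
    refine ⟨?_, fun h3 => ?_⟩
    · obtain ⟨t, ht, rfl⟩ := mem_runPack.1 hp
      obtain ⟨s, hs, rfl⟩ := mem_runPack.1 hq
      rcases lt_trichotomy i i' with hii | rfl | hii
      · have := (h i hi).le_of_lt (h i' hi') hii
        omega
      · omega
      · have := (h i' hi').le_of_lt (h i hi) hii
        omega
    · have := (h2 i hi p hp).2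
      omega

theorem card_biUnion_runPack (I : Finset ℤ) (J : ℤ → ℤ) (h : ∀ i ∈ I, IsRun a P i (J i)) :
    ((I.biUnion fun i => runPack i (J i)).card : ℤ) = ∑ i ∈ I, (J i - i) / 2 := by
  rw [Finset.card_biUnion]
  · push_cast
    exact Finset.sum_congr rfl fun i hi => card_runPack (h i hi).lt
  · intro i hi i' hi' hne
    refine Finset.disjoint_left.2 fun p hp hq => ?_
    obtain ⟨t, ht, rfl⟩ := mem_runPack.1 hp
    obtain ⟨s, hs, hst⟩ := mem_runPack.1 hq
    rcases lt_or_gt_of_ne hne with hii | hii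
    · have := (h i hi).le_of_lt (h i' hi') hii
      omega
    · have := (h i' hi').le_of_lt (h i hi) hii
      omega

/-- Greedy choice: take the least element and discard everything at distance at most `3` above it.
-/
theorem exists_spaced_subset (A : Finset ℤ) : ∃ S ⊆ A, (∀ s ∈ S, ∀ t ∈ S, s < t → s + 4 ≤ t) ∧
    ∀ t ∈ A, ∃ s ∈ S, s ≤ t ∧ t ≤ s + 3 := by
  induction hn : A.card using Nat.strong_induction_on generalizing A with
  | _ n ih =>
  rcases A.eq_empty_or_nonempty with rfl | hA
  · exact ⟨∅, by simp⟩
  set m := A.min' hA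
  have hm : m ∈ A := A.min'_mem hA
  obtain ⟨S, hS, h1, h2⟩ := ih _ (by
    rw [← hn]
    exact Finset.card_lt_card (Finset.filter_ssubset.2 ⟨m, hm, by simp⟩))
    (A.filter fun t => m + 4 ≤ t) rfl
  have hS' : ∀ s ∈ S, m + 4 ≤ s := fun s hs => (Finset.mem_filter.1 (hS hs)).2
  refine ⟨insert m S, ?_, ?_, ?_⟩
  · exact Finset.insert_subset hm (hS.trans (Finset.filter_subset _ _))
  · intro s hs t ht hst
    rw [Finset.mem_insert] at hs ht
    rcases hs with rfl | hs <;> rcases ht with rfl | ht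
    · omega
    · exact hS' t ht
    · have := hS' s hs; omega
    · exact h1 s hs t ht hst
  · intro t ht
    by_cases h : m + 4 ≤ t
    · obtain ⟨s, hs, h3⟩ := h2 t (Finset.mem_filter.2 ⟨ht, h⟩)
      exact ⟨s, Finset.mem_insert_of_mem hs, h3⟩
    · exact ⟨m, Finset.mem_insert_self _ _, A.min'_le t ht, by omega⟩

end LinearPlumbing

/-! ### Corrections, Bessel's inequality and the bound on weights. -/

namespace LinearPlumbing

variable {a : ℤ → ℕ} {P Q : Finset ℤ} {k : ℕ} {X : ℤ} {x y : ℤ × ℕ → ℤ}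

theorem card_block {i : ℤ} (h : 1 ≤ a i) : (block a i).card = a i := by
  have := sum_block a i (fun _ => 1)
  simp at this
  omega

theorem pairing_eq_zero (h : ∀ c, x c = 0 ∨ y c = 0) : pairing a P x y = 0 :=
  Finset.sum_eq_zero fun c _ => by rcases h c with h | h <;> simp [h]

theorem pairing_diff_self {c d : ℤ × ℕ} (hc : c ∈ cells a P) (hd : d ∈ cells a P) (h : c ≠ d) :
    pairing a P (diff c d) (diff c d) = 2 := by
  rw [pairing_diff hc hd]
  simp [diff, h, h.symm]

/-- The values of a representation along orthonormal vectors that correspond to the coordinates met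
by `X` only, up to a common correction `τ`. -/
structure IsUnits {J : Type} [Fintype J] (a : ℤ → ℕ) (P : Finset ℤ) (φ : (ℤ × ℕ → ℤ) → J → ℤ)
    (X : ℤ) (U : ℤ × ℕ → J → ℤ) (τ : (ℤ × ℕ → ℤ) → ℤ) : Prop where
  orth : ∀ c ∈ own a P X, ∀ d ∈ own a P X, U c ⬝ᵥ U d = if c = d then 1 else 0
  eval : ∀ x, IsFlow a P x → ∀ c ∈ own a P X, φ x ⬝ᵥ U c = x c + τ x

section Rep

variable {J : Type} [Fintype J] {φ : (ℤ × ℕ → ℤ) → J → ℤ} {U : ℤ × ℕ → J → ℤ}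
  {τ : (ℤ × ℕ → ℤ) → ℤ}

theorem IsUnits.bessel (hU : IsUnits a P φ X U τ) (hφ : IsRep a P φ) (hx : IsFlow a P x) :
    ∑ c ∈ own a P X, (x c + τ x) ^ 2 ≤ pairing a P x x := by
  rw [← hφ x x hx hx]
  refine le_trans (le_of_eq ?_) (LinearPlumbing.bessel (own a P X) U hU.orth (φ x))
  exact Finset.sum_congr rfl fun c hc => by rw [hU.eval x hx c hc]

theorem IsUnits.bessel_of_zero (hU : IsUnits a P φ X U τ) (hφ : IsRep a P φ) (hx : IsFlow a P x)
    (h0 : ∀ c ∈ own a P X, x c = 0) : (own a P X).card * τ x ^ 2 ≤ pairing a P x x := by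
  refine le_trans (le_of_eq ?_) (hU.bessel hφ hx)
  rw [Finset.sum_congr rfl (g := fun _ => τ x ^ 2) fun c hc => by rw [h0 c hc, zero_add]]
  simp

theorem IsUnits.bessel_of_one (hU : IsUnits a P φ X U τ) (hφ : IsRep a P φ) (hx : IsFlow a P x)
    {e : ℤ × ℕ} (he : e ∈ own a P X) (h0 : ∀ c ∈ own a P X, c ≠ e → x c = 0) :
    (x e + τ x) ^ 2 + ((own a P X).card - 1) * τ x ^ 2 ≤ pairing a P x x := by
  refine le_trans (le_of_eq ?_) (hU.bessel hφ hx)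
  rw [← Finset.add_sum_erase _ _ he, Finset.sum_congr rfl (g := fun _ => τ x ^ 2) fun c hc => by
    rw [h0 c (Finset.mem_of_mem_erase hc) (Finset.ne_of_mem_erase hc), zero_add]]
  have := Finset.card_erase_add_one he
  rw [Finset.sum_const, nsmul_eq_mul, ← this]
  push_cast
  ring

/-- The entries of the difference over the own coordinates of `X` sum to `0`, so the mixed terms in
Bessel's inequality cancel and leave at least `3 τ²` on one side against `2` on the other. -/
theorem IsUnits.tau_diff (hU : IsUnits a P φ X U τ) (hφ : IsRep a P φ) (hX : X ∈ P)
    (h3 : 3 ≤ (own a P X).card) {Y : ℤ} (hY : Y ∈ P) {c d : ℤ × ℕ} (hc : c ∈ own a P Y)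
    (hd : d ∈ own a P Y) : τ (diff c d) = 0 := by
  have hcd := isFlow_diff hY hc hd
  have hb := hU.bessel hφ hcd
  have hc' := own_subset_cells hY hc
  have hd' := own_subset_cells hY hd
  have hs : ∑ e ∈ own a P X, diff c d e = 0 := by
    by_cases hXY : Y = X
    · subst hXY
      simp [diff, Finset.sum_sub_distrib, hc, hd]
    · refine Finset.sum_eq_zero fun e he => ?_
      have h1 : ∀ b ∈ own a P Y, e ≠ b := by
        rintro b hb rfl
        exact notMem_own_of_mem_block hY hXY (Finset.mem_sdiff.1 hb).1 he
      simp [diff, h1 c hc, h1 d hd]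
  have he : ∑ e ∈ own a P X, (diff c d e + τ (diff c d)) ^ 2 =
      ∑ e ∈ own a P X, diff c d e ^ 2 + (own a P X).card * τ (diff c d) ^ 2 := by
    simp only [add_sq, Finset.sum_add_distrib, ← Finset.sum_mul, ← Finset.mul_sum, hs]
    simp
  rw [he] at hb
  have h4 : 0 ≤ ∑ e ∈ own a P X, diff c d e ^ 2 := Finset.sum_nonneg fun _ _ => sq_nonneg _
  have h5 : pairing a P (diff c d) (diff c d) ≤ 2 := by
    by_cases h : c = d
    · subst h
      rw [pairing_diff hc' hc']; simp
    · rw [pairing_diff_self hc' hd' h]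
  have h6 : (3 : ℤ) ≤ (own a P X).card := by exact_mod_cast h3
  by_contra hne
  have : 0 < τ (diff c d) ^ 2 := by positivity
  nlinarith

theorem IsUnits.tau_add (hU : IsUnits a P φ X U τ) (hφ : IsRep a P φ) {c : ℤ × ℕ}
    (hc : c ∈ own a P X) (hx : IsFlow a P x) (hy : IsFlow a P y) : τ (x + y) = τ x + τ y := by
  have h := hU.eval _ (hx.add hy) c hc
  rw [hφ.add hx hy, add_dotProduct, hU.eval x hx c hc, hU.eval y hy c hc] at h
  simp only [Pi.add_apply] at h
  linarith

theorem IsUnits.tau_smul (hU : IsUnits a P φ X U τ) (hφ : IsRep a P φ) {c : ℤ × ℕ}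
    (hc : c ∈ own a P X) (hx : IsFlow a P x) (n : ℤ) : τ (n • x) = n * τ x := by
  have h := hU.eval _ (hx.smul n) c hc
  rw [hφ.smul hx, smul_dotProduct, hU.eval x hx c hc] at h
  simp only [Pi.smul_apply, smul_eq_mul] at h
  linarith

/-- If `τ` vanished on all run flows, it would vanish on all generators, hence on all flows, and `X`
could be removed. -/
theorem IsUnits.exists_run (hU : IsUnits a P φ X U τ) (hφ : IsRep a P φ) (h : IsMinimal a P k)
    (hk : Fintype.card J + k = (cells a P).card) (hX : X ∈ P) (h3 : 3 ≤ (own a P X).card) :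
    ∃ i j, IsRun a P i j ∧ τ (runFlow a P i j) ≠ 0 := by
  by_contra! hcon
  obtain ⟨c, hc⟩ : (own a P X).Nonempty := Finset.card_pos.1 (by omega)
  have hτ : ∀ x, IsFlow a P x → τ x = 0 := by
    refine flow_induction h.two_le ?_ ?_ ?_ ?_ ?_
    · intro x y hx hy hpx hpy
      rw [hU.tau_add hφ hc hx hy, hpx, hpy, add_zero]
    · intro n x hx hpx
      rw [hU.tau_smul hφ hc hx, hpx, mul_zero]
    · intro x hx h0
      have := hU.eval x hx c hc
      rw [hφ.eq_zero hx h0, zero_dotProduct, h0 c (own_subset_cells hX hc)] at this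
      linarith
    · exact fun Y hY c hc d hd => hU.tau_diff hφ hX h3 hY hc hd
    · exact hcon
  exact h.erase X hX (compressible_erase hX hφ hk U hc hU.orth fun x hx c hc => by
    rw [hU.eval x hx c hc, hτ x hx, add_zero])

/-- At most the two end coordinates of a block are shared. -/
theorem le_card_own (hX : X ∈ P) (h2 : ∀ i ∈ P, 2 ≤ a i) : a X ≤ (own a P X).card + 2 := by
  have hsub : block a X \ own a P X ⊆ {(X, 0), (X + 1, 0)} := by
    intro c hc
    obtain ⟨h1, h3⟩ := Finset.mem_sdiff.1 hc
    rw [mem_own hX (h2 X hX) (h2 _) (h2 _)] at h3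
    rw [mem_block] at h1
    rcases c with ⟨p, t⟩
    simp at h1 h3 ⊢
    by_contra hcon
    rcases h1 with h1 | h1
    · omega
    · exact absurd (h3.1 h1.1 (by rintro rfl; exact hcon (Or.inl ⟨h1.1, rfl⟩))) (by omega)
  have h1 := Finset.card_le_card hsub
  have h3 := Finset.card_sdiff_add_card_eq_card (s := own a P X) (t := block a X)
    Finset.sdiff_subset
  rw [card_block (by have := h2 X hX; omega)] at h3
  have := Finset.card_le_two (a := ((X, 0) : ℤ × ℕ)) (b := (X + 1, 0))
  omega

theorem runFlow_own_or (h2 : ∀ i ∈ P, 2 ≤ a i) (hX : X ∈ P) (h3 : 3 ≤ a X) {i j : ℤ}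
    (h : IsRun a P i j) : (∀ c ∈ own a P X, runFlow a P i j c = 0) ∨
      ∃ e ∈ own a P X, ∀ c ∈ own a P X, c ≠ e → runFlow a P i j c = 0 := by
  by_cases h0 : ∀ c ∈ own a P X, runFlow a P i j c = 0
  · exact Or.inl h0
  push Not at h0
  obtain ⟨e, he, h0⟩ := h0
  refine Or.inr ⟨e, he, fun c hc hne => ?_⟩
  by_contra hc0
  have hij := h.lt
  rcases runFlow_own h hX h3 (h2 _) (h2 _) he h0 with ⟨h5, h6⟩ | ⟨h5, h6⟩ <;>
  rcases runFlow_own h hX h3 (h2 _) (h2 _) hc hc0 with ⟨h7, h8⟩ | ⟨h7, h8⟩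
  · exact hne (h8.trans h6.symm)
  · omega
  · omega
  · exact hne (h8.trans h6.symm)

theorem IsMinimal.weight_le (h : IsMinimal a P k) (hp : ∀ T, IsPack a P T → T.card ≤ k)
    (hX : X ∈ P) : a X ≤ 2 * k + 7 := by
  by_contra! hlt
  obtain ⟨J, _, φ, hk, hφ⟩ := h.compressible
  have hown := le_card_own hX h.two_le
  obtain ⟨c, hc⟩ : (own a P X).Nonempty := Finset.card_pos.1 (by omega)
  -- A weight beyond the bound leaves at least `2 k + 6` own coordinates, so the case of four does
  -- not arise.
  obtain ⟨U, τ, h1, h2⟩ := exists_units hφ hX hc (by omega) (by omega)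
  have hU : IsUnits a P φ X U τ := ⟨h1, h2⟩
  obtain ⟨i, j, hr, hτ⟩ := hU.exists_run hφ h hk hX (by omega)
  -- The pack bound gives `j - i ≤ 2 k + 1`, so the run flow has square at most `2 k + 3`. It is
  -- nonzero on at most one own coordinate, and the others contribute at least `2 k + 5` to Bessel's
  -- inequality.
  have hlen := card_biUnion_runPack {i} (fun _ => j) (by simpa using hr)
  have hlen' := hp _ (isPack_biUnion_runPack {i} (fun _ => j) (by simpa using hr))
  rw [Finset.sum_singleton] at hlen
  have hle := pairing_runFlow_le hr
  have hf := isFlow_runFlow hr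
  have hpos : 0 < τ (runFlow a P i j) ^ 2 := by positivity
  have hcard : ((2 * k + 6 : ℕ) : ℤ) ≤ (own a P X).card := by exact_mod_cast (by omega)
  push_cast at hcard
  rcases runFlow_own_or h.two_le hX (by omega) hr with h0 | ⟨e, he, h0⟩
  · have := hU.bessel_of_zero hφ hf h0
    have : (own a P X).card * 1 ≤ (own a P X).card * τ (runFlow a P i j) ^ 2 := by
      gcongr; omega
    omega
  · have h5 := hU.bessel_of_one hφ hf he h0
    have h6 : 0 ≤ (runFlow a P i j e + τ (runFlow a P i j)) ^ 2 := sq_nonneg _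
    have : (((own a P X).card : ℤ) - 1) * 1 ≤ ((own a P X).card - 1) * τ (runFlow a P i j) ^ 2 := by
      gcongr
      · omega
      · omega
    omega

end Rep

end LinearPlumbing

/-! ### Test flows and sparse vertices. -/

namespace LinearPlumbing

variable {a : ℤ → ℕ} {P Q : Finset ℤ} {k : ℕ} {X Y : ℤ} {x y : ℤ × ℕ → ℤ}

/-- Equality in Bessel's inequality puts `v` in the span of the orthonormal system. -/
theorem dotProduct_eq_sum_of_bessel_eq {ι : Type*} {J : Type} [DecidableEq ι] [Fintype J] (s : Finset ι)
    (U : ι → J → ℤ) (hU : ∀ i ∈ s, ∀ j ∈ s, U i ⬝ᵥ U j = if i = j then 1 else 0) {v : J → ℤ}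
    (hv : v ⬝ᵥ v ≤ ∑ i ∈ s, (v ⬝ᵥ U i) ^ 2) (w : J → ℤ) :
    w ⬝ᵥ v = ∑ i ∈ s, (v ⬝ᵥ U i) * (w ⬝ᵥ U i) := by
  set r := ∑ i ∈ s, (v ⬝ᵥ U i) • U i with hr
  have hdot : ∀ z, z ⬝ᵥ r = ∑ i ∈ s, (v ⬝ᵥ U i) * (z ⬝ᵥ U i) := by
    intro z
    rw [hr, dotProduct_sum]
    exact Finset.sum_congr rfl fun i _ => by rw [dotProduct_smul, smul_eq_mul]
  have hvr : v ⬝ᵥ r = ∑ i ∈ s, (v ⬝ᵥ U i) ^ 2 := by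
    rw [hdot]; exact Finset.sum_congr rfl fun i _ => by ring
  have hrr : r ⬝ᵥ r = ∑ i ∈ s, (v ⬝ᵥ U i) ^ 2 := by
    rw [hdot]
    refine Finset.sum_congr rfl fun i hi => ?_
    rw [dotProduct_comm, dotProduct_comm _ (U i), hdot,
      Finset.sum_eq_single i]
    · rw [hU i hi i hi, if_pos rfl, dotProduct_comm v]; ring
    · intro j hj hji
      rw [hU i hi j hj, if_neg hji.symm, mul_zero]
    · exact fun h => absurd hi h
  have h0 : v - r = 0 := by
    rw [← dotProduct_self_eq_zero]
    refine le_antisymm ?_ (dotProduct_self_nonneg_int _)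
    rw [sub_dotProduct, dotProduct_sub, dotProduct_sub, dotProduct_comm r v, hvr, hrr]
    linarith
  rw [← hdot, sub_eq_zero.1 h0]

theorem isRun_succ {i : ℤ} (hi : i ∈ P) (hi' : i + 1 ∈ P) (h3 : 3 ≤ a i) (h3' : 3 ≤ a (i + 1)) :
    IsRun a P i (i + 1) :=
  ⟨by omega, fun p h1 h2 => by omega, fun _ => h3, fun _ => h3', fun _ => ⟨hi, hi'⟩⟩

theorem runFlow_succ {i : ℤ} (h : IsRun a P i (i + 1)) :
    runFlow a P i (i + 1) = Pi.single (i, a i - 2) 1 + Pi.single (i + 1, 1) 1 -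
      Pi.single (i + 1, 0) 1 := by
  obtain ⟨hi, hi'⟩ := h.nonempty rfl
  have h3 := h.left hi
  have h4 : a i - 2 ≠ 0 := by omega
  funext ⟨p, t⟩
  simp only [runFlow, Pi.sub_apply, Pi.add_apply, Pi.single_apply, Prod.mk.injEq, hi, hi', and_true]
  have hn : (((p - i).negOnePow : ℤˣ) : ℤ) = -1 ∨ p ≠ i + 1 := by
    by_cases hp : p = i + 1
    · subst hp; simp
    · exact Or.inr hp
  split_ifs <;> first | omega | simp

theorem pairing_runFlow_succ {i : ℤ} (h : IsRun a P i (i + 1)) (y : ℤ × ℕ → ℤ) :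
    pairing a P (runFlow a P i (i + 1)) y = y (i, a i - 2) + y (i + 1, 1) - y (i + 1, 0) := by
  obtain ⟨hi, hi'⟩ := h.nonempty rfl
  have h3 := h.left hi
  have h3' := h.right hi'
  rw [runFlow_succ h, pairing_sub_left, pairing_add_left, pairing_single_left, pairing_single_left,
    pairing_single_left]
  · exact block_subset_cells hi (mem_block.2 (Or.inl rfl))
  · exact block_subset_cells hi' (mem_block.2 (Or.inr ⟨rfl, by simp; omega⟩))
  · exact block_subset_cells hi (mem_block.2 (Or.inr ⟨rfl, by simp; omega⟩))

theorem pairing_runFlow_succ_self {i : ℤ} (h : IsRun a P i (i + 1)) :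
    pairing a P (runFlow a P i (i + 1)) (runFlow a P i (i + 1)) = 3 := by
  have h3 := h.left (h.nonempty rfl).1
  have h4 : a i - 2 ≠ 0 := by omega
  rw [pairing_runFlow_succ h, runFlow_succ h]
  simp [h4]

/-- These are test flows on the right of `Y`: `y` pairs to `1` with a run flow that arrives at `Y`
from `Y - 1`. If possible, `y` is a difference of own coordinates, of square `2`; otherwise it
continues along the next run. When that run is empty and leads to a weight at most `-5`, `y` has
square `3` and `z` is a root at `Y + 1` that meets it. -/
theorem exists_right_flow (h2 : ∀ i ∈ P, 2 ≤ a i) (hY : Y ∈ P) (h3 : 3 ≤ a Y) :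
    ∃ y z, IsFlow a P y ∧ IsFlow a P z ∧ y (Y, 1) = 1 ∧ z (Y, 1) = 0 ∧
      (∀ c : ℤ × ℕ, c.1 < Y ∨ c = (Y, 0) → y c = 0 ∧ z c = 0) ∧
      ((a Y = 3 → Y + 1 ∈ P → 5 ≤ a (Y + 1)) → pairing a P y y = 2 ∨
        pairing a P y y = 3 ∧ pairing a P z z = 2 ∧ pairing a P z y = 1) := by
  have hown : ∀ {Z}, Z ∈ P → ∀ {c}, c ∈ own a P Z ↔ _ := fun {Z} hZ {c} =>
    mem_own (c := c) hZ (h2 Z hZ) (h2 _) (h2 _)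
  have h1 : (Y, 1) ∈ own a P Y := (hown hY).2 (Or.inl ⟨rfl, by simp, by simp; omega⟩)
  have h0 : IsFlow a P (0 : ℤ × ℕ → ℤ) := fun i _ => by simp
  by_cases hd : ∃ d ∈ own a P Y, d ≠ (Y, 1) ∧ d ≠ (Y, 0) ∧ Y ≤ d.1
  · obtain ⟨d, hd, hd1, hd0, hdY⟩ := hd
    refine ⟨diff (Y, 1) d, 0, isFlow_diff hY h1 hd, h0, by simp [diff, hd1.symm], rfl, ?_,
      fun _ => Or.inl (pairing_diff_self (own_subset_cells hY h1) (own_subset_cells hY hd)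
        hd1.symm)⟩
    intro c hc
    have e1 : c ≠ (Y, 1) := by rintro rfl; simp at hc
    have e2 : c ≠ d := by
      rintro rfl
      rcases hc with hc | hc
      · omega
      · exact hd0 hc
    simp [diff, e1, e2]
  have hY1 : Y + 1 ∈ P := by
    by_contra hY1
    exact hd ⟨(Y + 1, 0), (hown hY).2 (Or.inr (Or.inr ⟨rfl, hY1⟩)), by simp, by simp, by simp⟩
  have hY3 : a Y = 3 := by
    by_contra hne
    exact hd ⟨(Y, 2), (hown hY).2 (Or.inl ⟨rfl, by simp, by simp; omega⟩), by simp, by simp,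
      le_rfl⟩
  have hval : ∀ j, runFlow a P Y j (Y, 1) = 1 := fun j => by simp [runFlow, hY3, hY]
  have hsupp : ∀ j, Y < j → ∀ c : ℤ × ℕ, c.1 < Y ∨ c = (Y, 0) → runFlow a P Y j c = 0 := by
    rintro j hj ⟨p, t⟩ hc
    simp only [Prod.mk.injEq] at hc
    simp only [runFlow, Prod.mk.injEq]
    split_ifs <;> omega
  by_cases h5 : 5 ≤ a (Y + 1)
  · have hr : IsRun a P Y (Y + 1) := isRun_succ hY hY1 h3 (by omega)
    have e1 : (Y + 1, 1) ∈ own a P (Y + 1) := (hown hY1).2 (Or.inl ⟨rfl, by simp, by simp; omega⟩)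
    have e2 : (Y + 1, 2) ∈ own a P (Y + 1) := (hown hY1).2 (Or.inl ⟨rfl, by simp, by simp; omega⟩)
    refine ⟨runFlow a P Y (Y + 1), diff (Y + 1, 1) (Y + 1, 2), isFlow_runFlow hr,
      isFlow_diff hY1 e1 e2, hval _, by simp [diff], fun c hc => ⟨hsupp _ (by omega) c hc, ?_⟩,
      fun _ => Or.inr ⟨pairing_runFlow_succ_self hr, ?_, ?_⟩⟩
    · have d1 : c ≠ (Y + 1, 1) := by rintro rfl; simp at hc
      have d2 : c ≠ (Y + 1, 2) := by rintro rfl; simp at hc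
      simp [diff, d1, d2]
    · exact pairing_diff_self (own_subset_cells hY1 e1) (own_subset_cells hY1 e2) (by simp)
    · rw [pairing_comm, pairing_runFlow_succ hr]
      simp [diff]
  · obtain ⟨j, hr⟩ := exists_isRun_right h2 hY h3 hY1
    exact ⟨runFlow a P Y j, 0, isFlow_runFlow hr, h0, hval j, rfl,
      fun c hc => ⟨hsupp j hr.lt c hc, rfl⟩, fun h => absurd (h hY3 hY1) h5⟩

/-- Mirror image of `exists_right_flow`; the sign of a run flow has to be normalised at its right
end. -/
theorem exists_left_flow (h2 : ∀ i ∈ P, 2 ≤ a i) (hY : Y ∈ P) (h3 : 3 ≤ a Y) :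
    ∃ y z, IsFlow a P y ∧ IsFlow a P z ∧ y (Y, a Y - 2) = 1 ∧ z (Y, a Y - 2) = 0 ∧
      (∀ c : ℤ × ℕ, Y < c.1 → y c = 0 ∧ z c = 0) ∧
      ((a Y = 3 → Y - 1 ∈ P → 5 ≤ a (Y - 1)) → pairing a P y y = 2 ∨
        pairing a P y y = 3 ∧ pairing a P z z = 2 ∧ pairing a P z y = 1) := by
  have hown : ∀ {Z}, Z ∈ P → ∀ {c}, c ∈ own a P Z ↔ _ := fun {Z} hZ {c} =>
    mem_own (c := c) hZ (h2 Z hZ) (h2 _) (h2 _)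
  have h1 : (Y, a Y - 2) ∈ own a P Y := (hown hY).2 (Or.inl ⟨rfl, by simp; omega, by simp; omega⟩)
  have h0 : IsFlow a P (0 : ℤ × ℕ → ℤ) := fun i _ => by simp
  by_cases hd : ∃ d ∈ own a P Y, d ≠ (Y, a Y - 2) ∧ d.1 ≤ Y
  · obtain ⟨d, hd, hd1, hdY⟩ := hd
    refine ⟨diff (Y, a Y - 2) d, 0, isFlow_diff hY h1 hd, h0, by simp [diff, hd1.symm], rfl, ?_,
      fun _ => Or.inl (pairing_diff_self (own_subset_cells hY h1) (own_subset_cells hY hd)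
        hd1.symm)⟩
    intro c hc
    have e1 : c ≠ (Y, a Y - 2) := by rintro rfl; simp at hc
    have e2 : c ≠ d := by rintro rfl; omega
    simp [diff, e1, e2]
  have hY1 : Y - 1 ∈ P := by
    by_contra hY1
    exact hd ⟨(Y, 0), (hown hY).2 (Or.inr (Or.inl ⟨rfl, hY1⟩)), by simp; omega, le_rfl⟩
  have hY3 : a Y = 3 := by
    by_contra hne
    exact hd ⟨(Y, 1), (hown hY).2 (Or.inl ⟨rfl, by simp, by simp; omega⟩), by simp; omega, le_rfl⟩
  have hsupp : ∀ i, i < Y → ∀ c : ℤ × ℕ, Y < c.1 → runFlow a P i Y c = 0 := by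
    rintro i hi ⟨p, t⟩ hc
    simp only [runFlow, Prod.mk.injEq]
    split_ifs <;> omega
  rw [hY3]
  by_cases h5 : 5 ≤ a (Y - 1)
  · have hr : IsRun a P (Y - 1) (Y - 1 + 1) := isRun_succ hY1 (by simpa) (by omega) (by simpa)
    have e1 : (Y - 1, a (Y - 1) - 2) ∈ own a P (Y - 1) :=
      (hown hY1).2 (Or.inl ⟨rfl, by simp; omega, by simp; omega⟩)
    have e2 : (Y - 1, 1) ∈ own a P (Y - 1) := (hown hY1).2 (Or.inl ⟨rfl, by simp, by simp; omega⟩)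
    have hne : ((Y - 1, a (Y - 1) - 2) : ℤ × ℕ) ≠ (Y - 1, 1) := by simp; omega
    refine ⟨runFlow a P (Y - 1) (Y - 1 + 1), diff (Y - 1, a (Y - 1) - 2) (Y - 1, 1),
      isFlow_runFlow hr, isFlow_diff hY1 e1 e2, ?_, by simp [diff], fun c hc => ⟨?_, ?_⟩,
      fun _ => Or.inr ⟨pairing_runFlow_succ_self hr, ?_, ?_⟩⟩
    · rw [runFlow_succ hr]; simp
    · rw [sub_add_cancel]; exact hsupp _ (by omega) c hc
    · have d1 : c ≠ (Y - 1, a (Y - 1) - 2) := by rintro rfl; simp at hc; omega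
      have d2 : c ≠ (Y - 1, 1) := by rintro rfl; simp at hc; omega
      simp [diff, d1, d2]
    · exact pairing_diff_self (own_subset_cells hY1 e1) (own_subset_cells hY1 e2) hne
    · rw [pairing_comm, pairing_runFlow_succ hr]
      simp [diff, hne]
  · obtain ⟨i, hr⟩ := exists_isRun_left h2 hY h3 hY1
    refine ⟨(-((Y - i).negOnePow : ℤ)) • runFlow a P i Y, 0, (isFlow_runFlow hr).smul _, h0, ?_,
      rfl, fun c hc => ⟨by simp [hsupp i hr.lt c hc], rfl⟩, fun h => absurd (h rfl hY1) h5⟩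
    have hsq : ((Y - i).negOnePow : ℤ) * (Y - i).negOnePow = 1 := by
      rw [← abs_mul_abs_self, Int.abs_negOnePow]; rfl
    simp [runFlow, hr.lt.ne', hY, hsq]

/-- A vertex of weight `-2` or `-4`, or one of two adjacent vertices of weight `-3`. -/
def IsSeed (a : ℤ → ℕ) (P : Finset ℤ) (Y : ℤ) : Prop :=
  Y ∈ P ∧ (a Y = 2 ∨ a Y = 4 ∨ a Y = 3 ∧ (Y + 1 ∈ P ∧ a (Y + 1) = 3 ∨ Y - 1 ∈ P ∧ a (Y - 1) = 3))

/-- A vertex that is far from all seeds, and is isolated unless its weight is at most `-5`. -/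
structure IsSparse (a : ℤ → ℕ) (P : Finset ℤ) (X : ℤ) : Prop where
  mem : X ∈ P
  far : ∀ Y, IsSeed a P Y → X + 2 < Y ∨ Y + 2 < X
  big : 5 ≤ a X ∨ X - 1 ∉ P ∧ X + 1 ∉ P

theorem IsSparse.three_le (hX : IsSparse a P X) (h2 : ∀ i ∈ P, 2 ≤ a i) {Y : ℤ} (hY : Y ∈ P)
    (h1 : X ≤ Y + 2) (h1' : Y ≤ X + 2) : 3 ≤ a Y ∧ a Y ≠ 4 := by
  have := h2 Y hY
  constructor
  · by_contra h
    have := hX.far Y ⟨hY, Or.inl (by omega)⟩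
    omega
  · intro h
    have := hX.far Y ⟨hY, Or.inr (Or.inl h)⟩
    omega

theorem card_own_add (h2 : ∀ i ∈ P, 2 ≤ a i) (hX : X ∈ P) :
    (X - 1 ∉ P → a X ≤ (own a P X).card + 1) ∧ (X + 1 ∉ P → a X ≤ (own a P X).card + 1) ∧
      (X - 1 ∉ P → X + 1 ∉ P → (own a P X).card = a X) := by
  have h3 := Finset.card_sdiff_add_card_eq_card (s := own a P X) (t := block a X)
    Finset.sdiff_subset
  rw [card_block (by have := h2 X hX; omega)] at h3
  have key : ∀ c ∈ block a X \ own a P X, (c = (X, 0) ∧ X - 1 ∈ P) ∨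
      (c = (X + 1, 0) ∧ X + 1 ∈ P) := by
    intro c hc
    obtain ⟨h1, h4⟩ := Finset.mem_sdiff.1 hc
    rw [mem_own hX (h2 X hX) (h2 _) (h2 _)] at h4
    rw [mem_block] at h1
    rcases c with ⟨p, t⟩
    simp only [Prod.mk.injEq] at h1 h4 ⊢
    push Not at h4
    obtain ⟨h4, h5, h6⟩ := h4
    rcases h1 with h1 | h1
    · exact Or.inr ⟨h1, h6 h1⟩
    · by_cases ht : t = 0
      · exact Or.inl ⟨⟨h1.1, ht⟩, h5 ⟨h1.1, ht⟩⟩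
      · have := h4 h1.1 ht; omega
  refine ⟨fun h => ?_, fun h => ?_, fun h h' => ?_⟩
  · have : block a X \ own a P X ⊆ {(X + 1, 0)} := fun c hc => by
      rcases key c hc with h1 | h1
      · exact absurd h1.2 h
      · simp [h1.1]
    have := Finset.card_le_card this
    simp only [Finset.card_singleton] at this
    omega
  · have : block a X \ own a P X ⊆ {(X, 0)} := fun c hc => by
      rcases key c hc with h1 | h1
      · simp [h1.1]
      · exact absurd h1.2 h
    have := Finset.card_le_card this
    simp only [Finset.card_singleton] at this
    omega
  · have : block a X \ own a P X = ∅ := Finset.eq_empty_of_forall_notMem fun c hc => by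
      rcases key c hc with h1 | h1
      · exact h h1.2
      · exact h' h1.2
    rw [this, Finset.card_empty] at h3
    omega

theorem IsSparse.three_le_card_own (hX : IsSparse a P X) (h2 : ∀ i ∈ P, 2 ≤ a i) :
    3 ≤ (own a P X).card := by
  rcases hX.big with h | ⟨h, h'⟩
  · have := le_card_own hX.mem h2; omega
  · have := (card_own_add h2 hX.mem).2.2 h h'
    have := hX.three_le h2 hX.mem (by omega) (by omega)
    omega

section Rep

variable {J : Type} [Fintype J] {φ : (ℤ × ℕ → ℤ) → J → ℤ} {U : ℤ × ℕ → J → ℤ}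
  {τ : (ℤ × ℕ → ℤ) → ℤ}

/-- With four own coordinates `X` has a neighbour, since otherwise its weight would be `-4` and it
would be a seed. The run flow towards the neighbour is then `±1` on exactly one own coordinate,
which excludes the triangle. -/
theorem IsSparse.exists_isUnits (hX : IsSparse a P X) (h2 : ∀ i ∈ P, 2 ≤ a i)
    (hφ : IsRep a P φ) : ∃ U τ, IsUnits a P φ X U τ := by
  have h3 := hX.three_le_card_own h2
  have hX3 := hX.three_le h2 hX.mem (by omega) (by omega)
  have key : (own a P X).card = 4 → ∃ c₀ ∈ own a P X, ∃ y, IsFlow a P y ∧ y c₀ = 1 ∧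
      ∀ c ∈ own a P X, c ≠ c₀ → y c = 0 := by
    intro h4
    have hnb : X - 1 ∈ P ∨ X + 1 ∈ P := by
      by_contra! hcon
      have := (card_own_add h2 hX.mem).2.2 hcon.1 hcon.2
      omega
    have h5 : 5 ≤ a X := hX.big.resolve_right fun h => by tauto
    rcases hnb with h | h
    · obtain ⟨i, hr⟩ := exists_isRun_left h2 hX.mem hX3.1 h
      have hij := hr.lt
      have hsq : ((X - i).negOnePow : ℤ) * (X - i).negOnePow = 1 := by
        rw [← abs_mul_abs_self, Int.abs_negOnePow]; rfl
      refine ⟨(X, 1), (mem_own hX.mem (by omega) (h2 _) (h2 _)).2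
        (Or.inl ⟨rfl, by simp, by simp; omega⟩), (-((X - i).negOnePow : ℤ)) • runFlow a P i X,
        (isFlow_runFlow hr).smul _, by simp [runFlow, hij.ne', hX.mem, hsq], fun c hc hne => ?_⟩
      by_contra h0
      rcases runFlow_own hr hX.mem hX3.1 (h2 _) (h2 _) hc (fun h => h0 (by simp [h])) with h | h
      · omega
      · exact hne h.2
    · obtain ⟨j, hr⟩ := exists_isRun_right h2 hX.mem hX3.1 h
      have hij := hr.lt
      refine ⟨(X, a X - 2), (mem_own hX.mem (by omega) (h2 _) (h2 _)).2
        (Or.inl ⟨rfl, by simp; omega, by simp; omega⟩), runFlow a P X j, isFlow_runFlow hr, ?_,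
        fun c hc hne => ?_⟩
      · have : a X - 2 ≠ 0 := by omega
        simp [runFlow, this, hX.mem]
      by_contra h0
      rcases runFlow_own hr hX.mem hX3.1 (h2 _) (h2 _) hc h0 with h | h
      · exact hne h.2
      · omega
  by_cases h4 : (own a P X).card = 4
  · obtain ⟨c₀, hc₀, hy⟩ := key h4
    obtain ⟨U, τ, h5, h6⟩ := exists_units hφ hX.mem hc₀ h3 fun _ => hy
    exact ⟨U, τ, h5, h6⟩
  · obtain ⟨c₀, hc₀⟩ : (own a P X).Nonempty := Finset.card_pos.1 (by omega)
    obtain ⟨U, τ, h5, h6⟩ := exists_units hφ hX.mem hc₀ h3 fun h => absurd h h4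
    exact ⟨U, τ, h5, h6⟩

end Rep

end LinearPlumbing

/-! ### Divisibility and the exceptional vertex of weight `-5`. -/

namespace LinearPlumbing

variable {a : ℤ → ℕ} {P Q : Finset ℤ} {k : ℕ} {X Y : ℤ} {x y : ℤ × ℕ → ℤ}

theorem lt_or_eq_of_mem_own {c : ℤ × ℕ} (hc : c ∈ own a P X) (h : X < Y) :
    c.1 < Y ∨ c = (Y, 0) := by
  rcases mem_block.1 (Finset.mem_sdiff.1 hc).1 with rfl | ⟨h1, -⟩
  · by_cases hY : X + 1 = Y
    · exact Or.inr (by rw [hY])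
    · exact Or.inl (by simp; omega)
  · exact Or.inl (by omega)

theorem lt_of_mem_own {c : ℤ × ℕ} (hc : c ∈ own a P X) (h : Y < X) : Y < c.1 := by
  rcases mem_block.1 (Finset.mem_sdiff.1 hc).1 with rfl | ⟨h1, -⟩
  · simp; omega
  · omega

section Rep

variable {J : Type} [Fintype J] {φ : (ℤ × ℕ → ℤ) → J → ℤ} {U : ℤ × ℕ → J → ℤ}
  {τ : (ℤ × ℕ → ℤ) → ℤ}

/-- The vectors `U c` with `c ∈ S` exhaust the norm of `φ x`, so `φ x` is `τ x` times their sum. A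
flow `y` that vanishes on `S` has the same product `τ y` with each of them. -/
theorem IsUnits.card_dvd_pairing (hU : IsUnits a P φ X U τ) (hφ : IsRep a P φ)
    (hx : IsFlow a P x) (hy : IsFlow a P y) {S : Finset (ℤ × ℕ)} (hS : S ⊆ own a P X)
    (hxS : ∀ c ∈ S, x c = 0) (hyS : ∀ c ∈ S, y c = 0)
    (hn : pairing a P x x ≤ S.card * τ x ^ 2) : (S.card : ℤ) ∣ pairing a P y x := by
  have h1 := dotProduct_eq_sum_of_bessel_eq S U
    (fun c hc d hd => hU.orth c (hS hc) d (hS hd)) (v := φ x) (by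
      rw [hφ x x hx hx]
      refine hn.trans (le_of_eq ?_)
      rw [Finset.sum_congr rfl (g := fun _ => τ x ^ 2) fun c hc => by
        rw [hU.eval x hx c (hS hc), hxS c hc, zero_add]]
      simp) (φ y)
  rw [hφ y x hy hx, Finset.sum_congr rfl (g := fun _ => τ x * τ y) fun c hc => by
    rw [hU.eval x hx c (hS hc), hxS c hc, zero_add, hU.eval y hy c (hS hc), hyS c hc,
      zero_add]] at h1
  rw [h1]
  simp

/-- Three own coordinates and two neighbours mean weight `-5`. The flows `u`, `v` to the two
neighbours and test flows beyond them then form the configuration excluded by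
`false_of_nonstandard_five`; sparseness supplies the small norms of the test flows. -/
theorem IsSparse.false_of_card_eq_three (hX : IsSparse a P X) (h2 : ∀ i ∈ P, 2 ≤ a i)
    (hU : IsUnits a P φ X U τ) (hφ : IsRep a P φ) (hl : X - 1 ∈ P) (hr : X + 1 ∈ P)
    (h3 : (own a P X).card = 3)
    (hτ : τ (runFlow a P X (X + 1)) = -1 ∨ τ (runFlow a P (X - 1) (X - 1 + 1)) = -1) : False := by
  have h5 : a X = 5 := by
    have h6 := hX.big.resolve_right fun h => h.1 hl
    have := le_card_own hX.mem h2
    omega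
  have hl3 := hX.three_le h2 hl (by omega) (by omega)
  have hr3 := hX.three_le h2 hr (by omega) (by omega)
  have hR : IsRun a P X (X + 1) := isRun_succ hX.mem hr (by omega) hr3.1
  have hL : IsRun a P (X - 1) (X - 1 + 1) := isRun_succ hl (by simpa using hX.mem) hl3.1
    (by simp; omega)
  have hvR := runFlow_succ hR
  have hvL := runFlow_succ hL
  have hnR := pairing_runFlow_succ_self hR
  have hnL := pairing_runFlow_succ_self hL
  have hpR := pairing_runFlow_succ hR
  have hpL := pairing_runFlow_succ hL
  have hfR := isFlow_runFlow hR
  have hfL := isFlow_runFlow hL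
  obtain ⟨w, z', hw, hz', hw1, hz1, hws, hwn⟩ := exists_right_flow h2 hr hr3.1
  obtain ⟨y, z, hy, hz, hy1, hz1', hys, hyn⟩ := exists_left_flow h2 hl hl3.1
  replace hwn := hwn fun h h' => by
    have h4 := hX.three_le h2 h' (by omega) (by omega)
    by_contra hlt
    have := hX.far (X + 1) ⟨hr, Or.inr (Or.inr ⟨h, Or.inl ⟨h', by omega⟩⟩)⟩
    omega
  replace hyn := hyn fun h h' => by
    have h4 := hX.three_le h2 h' (by omega) (by omega)
    by_contra hlt
    have := hX.far (X - 1) ⟨hl, Or.inr (Or.inr ⟨h, Or.inr ⟨h', by omega⟩⟩)⟩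
    omega
  set v := runFlow a P X (X + 1)
  set u := runFlow a P (X - 1) (X - 1 + 1)
  have hown : ∀ t, t ≠ 0 → t < 4 → (X, t) ∈ own a P X := fun t ht ht' =>
    (mem_own hX.mem (by omega) (h2 _) (h2 _)).2 (Or.inl ⟨rfl, ht, by simp; omega⟩)
  have m1 := hown 1 (by simp) (by simp)
  have m2 := hown 2 (by simp) (by simp)
  have m3 := hown 3 (by simp) (by simp)
  have o := hU.orth
  have ev := hU.eval
  have wX : ∀ t, w (X, t) = 0 ∧ z' (X, t) = 0 := fun t => hws _ (Or.inl (by simp))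
  have yX : ∀ t, y (X, t) = 0 ∧ z (X, t) = 0 := fun t => hys _ (by simp)
  have hyw : ∀ c, y c = 0 ∧ z c = 0 ∨ w c = 0 ∧ z' c = 0 := fun c => by
    by_cases hc : X - 1 < c.1
    · exact Or.inl (hys c hc)
    · exact Or.inr (hws c (Or.inl (by omega)))
  have vR : v (X, 1) = 0 ∧ v (X, 2) = 0 ∧ v (X, 3) = 1 := by rw [hvR, h5]; simp
  have uL : u (X, 1) = 1 ∧ u (X, 2) = 0 ∧ u (X, 3) = 0 := by rw [hvL]; simp
  have pvw : pairing a P v w = 1 := by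
    rw [hpR, (wX _).1, hw1, (hws _ (Or.inr rfl)).1]; norm_num
  have pvz' : pairing a P v z' = 0 := by
    rw [hpR, (wX _).2, hz1, (hws _ (Or.inr rfl)).2]; norm_num
  have puy : pairing a P u y = 1 := by
    rw [hpL, hy1]; simp [yX]
  have puz : pairing a P u z = 0 := by
    rw [hpL, hz1']; simp [yX]
  have pvy : pairing a P v y = 0 := by
    rw [hpR, (yX _).1, (hys _ (by simp)).1, (hys _ (by simp)).1]; norm_num
  have pvz : pairing a P v z = 0 := by
    rw [hpR, (yX _).2, (hys _ (by simp)).2, (hys _ (by simp)).2]; norm_num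
  have puw : pairing a P u w = 0 := by
    rw [hpL, (hws _ (Or.inl (by simp))).1]; simp [wX]
  have puz' : pairing a P u z' = 0 := by
    rw [hpL, (hws _ (Or.inl (by simp))).2]; simp [wX]
  have puv : pairing a P u v = 0 := by
    rw [hpL, hvR, h5]
    have : X - 1 ≠ X + 1 := by omega
    simp [this]
  have pyw : pairing a P y w = 0 := pairing_eq_zero fun c => by have := hyw c; tauto
  have pzw : pairing a P z w = 0 := pairing_eq_zero fun c => by have := hyw c; tauto
  have pyz' : pairing a P y z' = 0 := pairing_eq_zero fun c => by have := hyw c; tauto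
  have pzz' : pairing a P z z' = 0 := pairing_eq_zero fun c => by have := hyw c; tauto
  have ho : ∀ s t, (X, s) ∈ own a P X → (X, t) ∈ own a P X →
      U (X, s) ⬝ᵥ U (X, t) = if s = t then 1 else 0 := fun s t hs ht => by
    rw [hU.orth _ hs _ ht]; simp
  have hc : ∀ x s t, IsFlow a P x → (X, s) ∈ own a P X → (X, t) ∈ own a P X →
      x (X, s) = x (X, t) → φ x ⬝ᵥ U (X, s) = φ x ⬝ᵥ U (X, t) := fun x s t hx hs ht h => by
    rw [ev x hx _ hs, ev x hx _ ht, h]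
  have hp : ∀ {x x' n}, IsFlow a P x → IsFlow a P x' → pairing a P x' x = n → φ x ⬝ᵥ φ x' = n :=
    fun hx hx' h => by rw [hφ _ _ hx hx', pairing_comm, h]
  have hwn' : φ w ⬝ᵥ φ w = 2 ∨ φ w ⬝ᵥ φ w = 3 ∧ φ z' ⬝ᵥ φ z' = 2 ∧ φ z' ⬝ᵥ φ w = 1 := by
    rwa [hφ _ _ hw hw, hφ _ _ hz' hz', hφ _ _ hz' hw]
  have hyn' : φ y ⬝ᵥ φ y = 2 ∨ φ y ⬝ᵥ φ y = 3 ∧ φ z ⬝ᵥ φ z = 2 ∧ φ z ⬝ᵥ φ y = 1 := by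
    rwa [hφ _ _ hy hy, hφ _ _ hz hz, hφ _ _ hz hy]
  have hw0 : ∀ s t, w (X, s) = w (X, t) := fun s t => by rw [(wX s).1, (wX t).1]
  have hz0' : ∀ s t, z' (X, s) = z' (X, t) := fun s t => by rw [(wX s).2, (wX t).2]
  have hy0 : ∀ s t, y (X, s) = y (X, t) := fun s t => by rw [(yX s).1, (yX t).1]
  have hz0 : ∀ s t, z (X, s) = z (X, t) := fun s t => by rw [(yX s).2, (yX t).2]
  rcases hτ with hτ | hτ
  · exact false_of_nonstandard_five (U (X, 1)) (U (X, 2)) (U (X, 3)) (φ u) (φ v) (φ w) (φ y)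
      (φ z) (φ z') (ho 1 1 m1 m1) (ho 2 2 m2 m2) (ho 3 3 m3 m3) (ho 1 2 m1 m2) (ho 1 3 m1 m3)
      (ho 2 3 m2 m3) (hp hfR hfR hnR) (by rw [ev _ hfR _ m1, vR.1, hτ]; rfl)
      (by rw [ev _ hfR _ m2, vR.2.1, hτ]; rfl) (by rw [ev _ hfR _ m3, vR.2.2, hτ]; rfl)
      (hp hfL hfL hnL) (by rw [ev _ hfL _ m1, ev _ hfL _ m2, uL.1, uL.2.1]; ring)
      (hc u 3 2 hfL m3 m2 (by rw [uL.2.1, uL.2.2])) (hp hfL hfR (by rw [pairing_comm, puv]))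
      hwn' (hc w 1 2 hw m1 m2 (hw0 _ _)) (hc w 3 2 hw m3 m2 (hw0 _ _)) (hp hw hfR pvw)
      (hp hw hfL puw) hyn' (hc y 1 2 hy m1 m2 (hy0 _ _)) (hc y 3 2 hy m3 m2 (hy0 _ _))
      (hp hy hfL puy) (hp hy hfR pvy) (hp hy hw (by rw [pairing_comm, pyw]))
      (hc z 1 2 hz m1 m2 (hz0 _ _)) (hc z 3 2 hz m3 m2 (hz0 _ _)) (hp hz hfL puz) (hp hz hfR pvz)
      (hp hz hw (by rw [pairing_comm, pzw])) (hc z' 1 2 hz' m1 m2 (hz0' _ _))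
      (hc z' 3 2 hz' m3 m2 (hz0' _ _)) (hp hz' hfL puz') (hp hz' hfR pvz') (hp hz' hy pyz')
      (hp hz hz' (by rw [pairing_comm, pzz']))
  -- The mirror case exchanges left and right, that is, the own coordinates `1` and `3`.
  · exact false_of_nonstandard_five (U (X, 3)) (U (X, 2)) (U (X, 1)) (φ v) (φ u) (φ y) (φ w)
      (φ z') (φ z) (ho 3 3 m3 m3) (ho 2 2 m2 m2) (ho 1 1 m1 m1) (ho 3 2 m3 m2) (ho 3 1 m3 m1)
      (ho 2 1 m2 m1) (hp hfL hfL hnL) (by rw [ev _ hfL _ m3, uL.2.2, hτ]; rfl)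
      (by rw [ev _ hfL _ m2, uL.2.1, hτ]; rfl) (by rw [ev _ hfL _ m1, uL.1, hτ]; rfl)
      (hp hfR hfR hnR) (by rw [ev _ hfR _ m3, ev _ hfR _ m2, vR.2.1, vR.2.2]; ring)
      (hc v 1 2 hfR m1 m2 (by rw [vR.1, vR.2.1])) (hp hfR hfL puv)
      hyn' (hc y 3 2 hy m3 m2 (hy0 _ _)) (hc y 1 2 hy m1 m2 (hy0 _ _)) (hp hy hfL puy)
      (hp hy hfR pvy) hwn' (hc w 3 2 hw m3 m2 (hw0 _ _)) (hc w 1 2 hw m1 m2 (hw0 _ _))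
      (hp hw hfR pvw) (hp hw hfL puw) (hp hw hy pyw)
      (hc z' 3 2 hz' m3 m2 (hz0' _ _)) (hc z' 1 2 hz' m1 m2 (hz0' _ _)) (hp hz' hfR pvz')
      (hp hz' hfL puz') (hp hz' hy pyz') (hc z 3 2 hz m3 m2 (hz0 _ _))
      (hc z 1 2 hz m1 m2 (hz0 _ _)) (hp hz hfR pvz) (hp hz hfL puz)
      (hp hz hw (by rw [pairing_comm, pzw])) (hp hz' hz pzz')

end Rep

end LinearPlumbing

/-! ### Counting sparse vertices and the bound on the number of vertices. -/

namespace LinearPlumbing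

variable {a : ℤ → ℕ} {P Q : Finset ℤ} {k : ℕ} {X Y : ℤ} {x y : ℤ × ℕ → ℤ}

theorem IsRun.unique {i j j' : ℤ} (h : IsRun a P i j) (h' : IsRun a P i j') : j = j' := by
  by_contra hne
  wlog hlt : j < j' generalizing j j'
  · exact this h' h (Ne.symm hne) (by omega)
  obtain ⟨h1, h2⟩ := h'.two j h.lt hlt
  have := h.right h1
  omega

theorem IsRun.own_eq_zero (h2 : ∀ i ∈ P, 2 ≤ a i) (hX : X ∈ P) (h3 : 3 ≤ a X) {i j : ℤ}
    (h : IsRun a P i j) (hi : X ≠ i) (hj : X ≠ j) {c : ℤ × ℕ} (hc : c ∈ own a P X) :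
    runFlow a P i j c = 0 := by
  by_contra h0
  rcases runFlow_own h hX h3 (h2 _) (h2 _) hc h0 with h | h
  · exact hi h.1
  · exact hj h.1

/-- A vertex far from seeds has weight `-3` or at most `-5`. A nonisolated `-3` has a neighbour that
is no `-2`, `-3` or `-4`, and this neighbour is sparse; being one step away costs one unit of the
distance to the seeds. -/
theorem exists_sparse_near (h2 : ∀ i ∈ P, 2 ≤ a i) (hX : X ∈ P)
    (hfar : ∀ Y, IsSeed a P Y → X + 3 < Y ∨ Y + 3 < X) :
    ∃ Z, IsSparse a P Z ∧ X ≤ Z + 1 ∧ Z ≤ X + 1 := by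
  have hX2 := h2 X hX
  have hns : ¬ IsSeed a P X := fun h => by have := hfar X h; omega
  by_cases h5 : 5 ≤ a X
  · exact ⟨X, ⟨hX, fun Y hY => by have := hfar Y hY; omega, Or.inl h5⟩, by omega, by omega⟩
  have h3 : a X = 3 := by
    have h1 : a X ≠ 2 := fun h => hns ⟨hX, Or.inl h⟩
    have h4 : a X ≠ 4 := fun h => hns ⟨hX, Or.inr (Or.inl h)⟩
    omega
  by_cases hiso : X - 1 ∉ P ∧ X + 1 ∉ P
  · exact ⟨X, ⟨hX, fun Y hY => by have := hfar Y hY; omega, Or.inr hiso⟩, by omega, by omega⟩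
  have key : ∀ Z ∈ P, (Z = X - 1 ∨ Z = X + 1) → IsSparse a P Z := by
    intro Z hZ hZX
    have hZ2 := h2 Z hZ
    have hZs : ¬ IsSeed a P Z := fun h => by have := hfar Z h; omega
    have h1 : a Z ≠ 2 := fun h => hZs ⟨hZ, Or.inl h⟩
    have h4 : a Z ≠ 4 := fun h => hZs ⟨hZ, Or.inr (Or.inl h)⟩
    have h3' : a Z ≠ 3 := by
      intro h
      refine hns ⟨hX, Or.inr (Or.inr ⟨h3, ?_⟩)⟩
      rcases hZX with rfl | rfl
      · exact Or.inr ⟨hZ, h⟩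
      · exact Or.inl ⟨hZ, h⟩
    exact ⟨hZ, fun Y hY => by have := hfar Y hY; omega, Or.inl (by omega)⟩
  by_cases hl : X - 1 ∈ P
  · exact ⟨X - 1, key _ hl (Or.inl rfl), by omega, by omega⟩
  · have hr : X + 1 ∈ P := by tauto
    exact ⟨X + 1, key _ hr (Or.inr rfl), by omega, by omega⟩

/-- A seed `-3` may be the second of its pair, so pieces can start one position earlier; distance
`4` between seeds still leaves `3` between the starts. -/
theorem exists_isPack_of_seeds {S : Finset ℤ} (hS : ∀ s ∈ S, IsSeed a P s)
    (hsep : ∀ s ∈ S, ∀ t ∈ S, s < t → s + 4 ≤ t) : ∃ T, IsPack a P T ∧ T.card = S.card := by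
  classical
  have hex : ∀ s, ∃ p, s ∈ S → (p = s ∨ p = s - 1) ∧ p ∈ P ∧
      (a p = 2 ∨ a p = 4 ∨ a p = 3 ∧ p + 1 ∈ P ∧ a (p + 1) = 3) := by
    intro s
    by_cases hs : s ∈ S
    · obtain ⟨hP, h | h | ⟨h3, h | h⟩⟩ := hS s hs
      · exact ⟨s, fun _ => ⟨Or.inl rfl, hP, Or.inl h⟩⟩
      · exact ⟨s, fun _ => ⟨Or.inl rfl, hP, Or.inr (Or.inl h)⟩⟩
      · exact ⟨s, fun _ => ⟨Or.inl rfl, hP, Or.inr (Or.inr ⟨h3, h⟩)⟩⟩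
      · exact ⟨s - 1, fun _ => ⟨Or.inr rfl, h.1, Or.inr (Or.inr ⟨h.2, by simp [hP, h3]⟩)⟩⟩
    · exact ⟨s, fun h => absurd h hs⟩
  choose f hf using hex
  have hlt : ∀ s ∈ S, ∀ t ∈ S, s < t → f s + 3 ≤ f t := by
    intro s hs t ht hst
    have := hsep s hs t ht hst
    have := (hf s hs).1
    have := (hf t ht).1
    omega
  refine ⟨S.image f, ⟨?_, ?_⟩, Finset.card_image_of_injOn ?_⟩
  · intro p hp
    obtain ⟨s, hs, rfl⟩ := Finset.mem_image.1 hp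
    exact (hf s hs).2
  · intro p hp q hq hpq
    obtain ⟨s, hs, rfl⟩ := Finset.mem_image.1 hp
    obtain ⟨t, ht, rfl⟩ := Finset.mem_image.1 hq
    rcases lt_trichotomy s t with h | rfl | h
    · have := hlt s hs t ht h; omega
    · omega
    · have := hlt t ht s hs h; omega
  · intro s hs t ht hst
    rcases lt_trichotomy s t with h | h | h
    · have := hlt s hs t ht h; omega
    · exact h
    · have := hlt t ht s hs h; omega

section Rep

variable {J : Type} [Fintype J] {φ : (ℤ × ℕ → ℤ) → J → ℤ} {U V : ℤ × ℕ → J → ℤ}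
  {τ σ : (ℤ × ℕ → ℤ) → ℤ}

/-- The flow of an empty run has square `3`. If it vanishes on the own coordinates of `X`, or if `X`
is an end of the run and has four own coordinates, then a nonzero `τ` makes three of the `U c`
exhaust this square. Every flow that vanishes on the corresponding coordinates would pair with it to
a multiple of `3`, but a test flow gives `1`. An end with three own coordinates is the exceptional
case of weight `-5`. -/
theorem IsSparse.succ_ne_of_tau_ne_zero (hX : IsSparse a P X) (h2 : ∀ i ∈ P, 2 ≤ a i)
    (hU : IsUnits a P φ X U τ) (hφ : IsRep a P φ) {i : ℤ} (hr : IsRun a P i (i + 1))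
    (hτ : τ (runFlow a P i (i + 1)) ≠ 0) : False := by
  have hcard : (3 : ℤ) ≤ (own a P X).card := by exact_mod_cast hX.three_le_card_own h2
  have hX3 := (hX.three_le h2 hX.mem (by omega) (by omega)).1
  obtain ⟨hi, hi'⟩ := hr.nonempty rfl
  have hn := pairing_runFlow_succ_self hr
  have hpair := pairing_runFlow_succ hr
  have hf := isFlow_runFlow hr
  have hpos : 1 ≤ τ (runFlow a P i (i + 1)) ^ 2 := by
    have : 0 < τ (runFlow a P i (i + 1)) ^ 2 := by positivity
    omega
  have hright : ∀ S ⊆ own a P X, X < i + 1 → (∀ c ∈ S, runFlow a P i (i + 1) c = 0) →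
      S.card = 3 → False := by
    intro S hS hlt h0 h3
    obtain ⟨y, z, hy, -, hy1, -, hys, -⟩ := exists_right_flow h2 hi' (hr.right hi')
    have := hU.card_dvd_pairing hφ hf hy hS h0
      (fun c hc => (hys c (lt_or_eq_of_mem_own (hS hc) hlt)).1) (by rw [hn, h3]; push_cast; linarith)
    rw [pairing_comm, hpair, hy1, (hys _ (Or.inl (by simp))).1, (hys _ (Or.inr rfl)).1, h3] at this
    norm_num at this
  have hleft : ∀ S ⊆ own a P X, i < X → (∀ c ∈ S, runFlow a P i (i + 1) c = 0) →
      S.card = 3 → False := by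
    intro S hS hlt h0 h3
    obtain ⟨y, z, hy, -, hy1, -, hys, -⟩ := exists_left_flow h2 hi (hr.left hi)
    have := hU.card_dvd_pairing hφ hf hy hS h0
      (fun c hc => (hys c (lt_of_mem_own (hS hc) hlt)).1) (by rw [hn, h3]; push_cast; linarith)
    rw [pairing_comm, hpair, hy1, (hys _ (by simp)).1, (hys _ (by simp)).1, h3] at this
    norm_num at this
  have hmid : ∀ e ∈ own a P X, runFlow a P i (i + 1) e = 1 →
      (∀ c ∈ own a P X, c ≠ e → runFlow a P i (i + 1) c = 0) → (X = i ∨ X = i + 1) → False := by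
    intro e he he1 h0 hXi
    have hb := hU.bessel_of_one hφ hf he h0
    rw [hn, he1] at hb
    have h5 : 5 ≤ a X := by
      refine hX.big.resolve_right fun h => ?_
      rcases hXi with rfl | rfl
      · exact h.2 hi'
      · exact h.1 (by simpa using hi)
    have hτ1 : τ (runFlow a P i (i + 1)) = -1 := by
      set t := τ (runFlow a P i (i + 1))
      have hb' : (1 + t) ^ 2 + 2 * t ^ 2 ≤ 3 := by nlinarith
      have : t ≤ 0 := by by_contra h; nlinarith
      have : -1 ≤ t := by by_contra h; nlinarith
      omega
    rw [hτ1] at hb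
    have hs : (own a P X).card = 3 ∨ (own a P X).card = 4 := by omega
    rcases hs with hs | hs
    · have hl : X - 1 ∈ P := by
        by_contra h
        have := (card_own_add h2 hX.mem).1 h
        omega
      have hr' : X + 1 ∈ P := by
        by_contra h
        have := (card_own_add h2 hX.mem).2.1 h
        omega
      refine hX.false_of_card_eq_three h2 hU hφ hl hr' hs ?_
      rcases hXi with rfl | rfl
      · exact Or.inl hτ1
      · rw [add_sub_cancel_right]; exact Or.inr hτ1
    · have h3 : ((own a P X).erase e).card = 3 := by rw [Finset.card_erase_of_mem he, hs]
      have h0' : ∀ c ∈ (own a P X).erase e, runFlow a P i (i + 1) c = 0 := fun c hc =>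
        h0 c (Finset.mem_of_mem_erase hc) (Finset.ne_of_mem_erase hc)
      rcases hXi with h | h
      · exact hright _ (Finset.erase_subset _ _) (by omega) h0' h3
      · exact hleft _ (Finset.erase_subset _ _) (by omega) h0' h3
  by_cases hXi : X = i
  · subst hXi
    refine hmid (X, a X - 2) ((mem_own hX.mem (by omega) (h2 _) (h2 _)).2
      (Or.inl ⟨rfl, by simp; omega, by simp; omega⟩)) ?_ ?_ (Or.inl rfl)
    · have : a X - 2 ≠ 0 := by omega
      simp [runFlow, this, hi]
    · intro c hc hne
      by_contra h0
      rcases runFlow_own hr hX.mem hX3 (h2 _) (h2 _) hc h0 with h | h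
      · exact hne h.2
      · omega
  by_cases hXi' : X = i + 1
  · subst hXi'
    refine hmid (i + 1, 1) ((mem_own hX.mem (by omega) (h2 _) (h2 _)).2
      (Or.inl ⟨rfl, by simp, by simp; omega⟩)) ?_ ?_ (Or.inr rfl)
    · simp [runFlow, hi']
    · intro c hc hne
      by_contra h0
      rcases runFlow_own hr hX.mem hX3 (h2 _) (h2 _) hc h0 with h | h
      · omega
      · exact hne h.2
  have h0 : ∀ c ∈ own a P X, runFlow a P i (i + 1) c = 0 := fun c hc =>
    hr.own_eq_zero h2 hX.mem hX3 hXi hXi' hc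
  have hb := hU.bessel_of_zero hφ hf h0
  rw [hn] at hb
  have hs : (own a P X).card = 3 := by
    have : ((own a P X).card : ℤ) ≤ 3 := by nlinarith
    omega
  rcases lt_or_gt_of_ne hXi with h | h
  · exact hright _ subset_rfl (by omega) h0 hs
  · exact hleft _ subset_rfl (by omega) h0 hs

/-- Differences of the `U c` are images of differences of coordinates, which `V d` does not see. So
`V d` has the same product with at least three orthonormal vectors, and as a unit vector it must be
orthogonal to them. -/
theorem IsUnits.dotProduct_eq_zero (hU : IsUnits a P φ X U τ) (hV : IsUnits a P φ Y V σ)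
    (hφ : IsRep a P φ) (hX : X ∈ P) (hY : Y ∈ P) (hne : X ≠ Y) (h3 : 3 ≤ (own a P X).card)
    (h3' : 3 ≤ (own a P Y).card) {c d : ℤ × ℕ} (hc : c ∈ own a P X) (hd : d ∈ own a P Y) :
    U c ⬝ᵥ V d = 0 := by
  have hdisj : ∀ e ∈ own a P X, d ≠ e := by
    rintro e he rfl
    exact notMem_own_of_mem_block hX hne (Finset.mem_sdiff.1 he).1 hd
  have hconst : ∀ e ∈ own a P X, V d ⬝ᵥ U e = V d ⬝ᵥ U c := by
    intro e he
    by_cases hce : c = e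
    · rw [hce]
    have hf := isFlow_diff hX hc he
    have h1 : φ (diff c e) = U c - U e := by
      rw [← sub_eq_zero, ← dotProduct_self_eq_zero]
      have e1 := hU.eval _ hf c hc
      have e2 := hU.eval _ hf e he
      rw [hU.tau_diff hφ hX h3 hX hc he] at e1 e2
      simp only [sub_dotProduct, dotProduct_sub]
      rw [dotProduct_comm (U c) (φ _), dotProduct_comm (U e) (φ _), e1, e2, hφ _ _ hf hf,
        pairing_diff_self (own_subset_cells hX hc) (own_subset_cells hX he) hce, hU.orth c hc c hc,
        hU.orth e he e he, hU.orth c hc e he, hU.orth e he c hc]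
      simp [diff, hce, Ne.symm hce]
    have h2 := hV.eval _ hf d hd
    rw [hV.tau_diff hφ hY h3' hX hc he, h1, sub_dotProduct] at h2
    simp only [diff, Pi.sub_apply, Pi.single_eq_of_ne (hdisj c hc),
      Pi.single_eq_of_ne (hdisj e he)] at h2
    rw [dotProduct_comm _ (U e), dotProduct_comm _ (U c)]
    linarith
  have hb := LinearPlumbing.bessel (own a P X) U hU.orth (V d)
  rw [Finset.sum_congr rfl (g := fun _ => (V d ⬝ᵥ U c) ^ 2) fun e he => by rw [hconst e he],
    hV.orth d hd d hd, Finset.sum_const, nsmul_eq_mul] at hb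
  simp only [if_true] at hb
  have h4 : (3 : ℤ) ≤ (own a P X).card := by exact_mod_cast h3
  rw [dotProduct_comm]
  by_contra h0
  have : 0 < (V d ⬝ᵥ U c) ^ 2 := by positivity
  nlinarith

/-- The run is nonempty, and its end vertices are seeds, so sparse vertices lie away from its ends
and its flow vanishes on their own coordinates. By orthogonality each contributes at least `3` to a
square of at most `j - i + 2`; for `j - i ≥ 2` this gives the bound. -/
theorem card_sparse_of_run_le (h2 : ∀ i ∈ P, 2 ≤ a i) (hφ : IsRep a P φ) {i j : ℤ}
    (hr : IsRun a P i j) (F : Finset ℤ) (U : ℤ → ℤ × ℕ → J → ℤ) (τ : ℤ → (ℤ × ℕ → ℤ) → ℤ)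
    (hF : ∀ X ∈ F, IsSparse a P X) (hU : ∀ X ∈ F, IsUnits a P φ X (U X) (τ X))
    (hτ : ∀ X ∈ F, τ X (runFlow a P i j) ≠ 0) : (F.card : ℤ) ≤ (j - i) / 2 := by
  have hij := hr.lt
  rcases F.eq_empty_or_nonempty with rfl | ⟨X₀, hX₀⟩
  · simp; omega
  have hj : i + 1 ≠ j := by
    rintro rfl
    exact (hF X₀ hX₀).succ_ne_of_tau_ne_zero h2 (hU X₀ hX₀) hφ hr (hτ X₀ hX₀)
  have hf := isFlow_runFlow hr
  have hzero : ∀ X ∈ F, ∀ c ∈ own a P X, runFlow a P i j c = 0 := by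
    intro X hX c hc
    have hs1 : IsSeed a P (i + 1) :=
      ⟨(hr.two _ (by omega) (by omega)).1, Or.inl (hr.two _ (by omega) (by omega)).2⟩
    have hs2 : IsSeed a P (j - 1) :=
      ⟨(hr.two _ (by omega) (by omega)).1, Or.inl (hr.two _ (by omega) (by omega)).2⟩
    have f1 := (hF X hX).far _ hs1
    have f2 := (hF X hX).far _ hs2
    exact hr.own_eq_zero h2 (hF X hX).mem
      ((hF X hX).three_le h2 (hF X hX).mem (by omega) (by omega)).1 (by omega) (by omega) hc
  have hb := LinearPlumbing.bessel (F.sigma fun X => own a P X)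
    (fun p : (_ : ℤ) × (ℤ × ℕ) => U p.1 p.2) (by
      rintro ⟨X, c⟩ hc ⟨Y, d⟩ hd
      obtain ⟨hX, hc⟩ := Finset.mem_sigma.1 hc
      obtain ⟨hY, hd⟩ := Finset.mem_sigma.1 hd
      simp only at hX hc hY hd ⊢
      by_cases hXY : X = Y
      · subst hXY
        rw [(hU X hX).orth c hc d hd]
        simp
      · rw [(hU X hX).dotProduct_eq_zero (hU Y hY) hφ (hF X hX).mem (hF Y hY).mem hXY
          ((hF X hX).three_le_card_own h2) ((hF Y hY).three_le_card_own h2) hc hd]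
        simp [hXY]) (φ (runFlow a P i j))
  rw [hφ _ _ hf hf, Finset.sum_sigma] at hb
  have hle : ∑ X ∈ F, (3 : ℤ) ≤
      ∑ X ∈ F, ∑ c ∈ own a P X, (φ (runFlow a P i j) ⬝ᵥ U X c) ^ 2 := by
    refine Finset.sum_le_sum fun X hX => ?_
    rw [Finset.sum_congr rfl (g := fun _ => τ X (runFlow a P i j) ^ 2) fun c hc => by
      rw [(hU X hX).eval _ hf c hc, hzero X hX c hc, zero_add], Finset.sum_const, nsmul_eq_mul]
    have h3 : (3 : ℤ) ≤ (own a P X).card := by exact_mod_cast (hF X hX).three_le_card_own h2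
    have h1 : 0 < τ X (runFlow a P i j) ^ 2 := by have := hτ X hX; positivity
    nlinarith
  replace hle := hle.trans hb
  rw [Finset.sum_const, nsmul_eq_mul] at hle
  have := pairing_runFlow_le hr
  omega

end Rep

/-- Assign to each sparse vertex a run on which its correction is nonzero. A run serves at most as
many sparse vertices as it contributes pieces to the pack of all these runs. -/
theorem IsMinimal.card_sparse_le (h : IsMinimal a P k) (hp : ∀ T, IsPack a P T → T.card ≤ k)
    (C : Finset ℤ) (hC : ∀ X ∈ C, IsSparse a P X) : C.card ≤ k := by
  classical
  obtain ⟨J, _, φ, hk, hφ⟩ := h.compressible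
  have hex : ∀ X, ∃ (U : ℤ × ℕ → J → ℤ) (τ : (ℤ × ℕ → ℤ) → ℤ) (i j : ℤ), X ∈ C →
      IsUnits a P φ X U τ ∧ IsRun a P i j ∧ τ (runFlow a P i j) ≠ 0 := by
    intro X
    by_cases hX : X ∈ C
    · obtain ⟨U, τ, hU⟩ := (hC X hX).exists_isUnits h.two_le hφ
      obtain ⟨i, j, hr, hτ⟩ := hU.exists_run hφ h hk (hC X hX).mem
        ((hC X hX).three_le_card_own h.two_le)
      exact ⟨U, τ, i, j, fun _ => ⟨hU, hr, hτ⟩⟩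
    · exact ⟨0, 0, 0, 0, fun h => absurd h hX⟩
  choose U τ i j hall using hex
  have hJ : ∀ p, ∃ q, p ∈ C.image i → IsRun a P p q := by
    intro p
    by_cases hpC : p ∈ C.image i
    · obtain ⟨X, hX, rfl⟩ := Finset.mem_image.1 hpC
      exact ⟨j X, fun _ => (hall X hX).2.1⟩
    · exact ⟨0, fun h => absurd h hpC⟩
  choose q hq using hJ
  have h1 := hp _ (isPack_biUnion_runPack (C.image i) q hq)
  have h3 := card_biUnion_runPack (C.image i) q hq
  have h4 : (C.card : ℤ) ≤ ∑ p ∈ C.image i, (q p - p) / 2 := by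
    rw [Finset.card_eq_sum_card_image i C]
    push_cast
    refine Finset.sum_le_sum fun p hpC => ?_
    refine card_sparse_of_run_le h.two_le hφ (hq p hpC) _ U τ ?_ ?_ ?_
    · exact fun X hX => hC X (Finset.mem_filter.1 hX).1
    · exact fun X hX => (hall X (Finset.mem_filter.1 hX).1).1
    · intro X hX
      obtain ⟨hXC, rfl⟩ := Finset.mem_filter.1 hX
      rw [(hq _ hpC).unique (hall X hXC).2.1]
      exact (hall X hXC).2.2
  omega

/-- A minimal compressible plumbing for `k` has at most `13 k` vertices, of weight at least
`-(2 k + 7)`. -/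
theorem IsMinimal.bounds (h : IsMinimal a P k) (hk : 1 ≤ k) :
    P.card ≤ 13 * k ∧ ∀ i ∈ P, a i ≤ 2 * k + 7 := by
  classical
  rcases h.pack_card_le with hp | ⟨h1, h2⟩
  swap
  · exact ⟨by omega, fun i hi => (h2 i hi).trans (by omega)⟩
  refine ⟨?_, fun i hi => h.weight_le hp hi⟩
  set C := P.filter fun X => IsSparse a P X
  obtain ⟨S, hSA, hsep, hcov⟩ := exists_spaced_subset (P.filter fun X => IsSeed a P X)
  obtain ⟨T, hT, hTS⟩ := exists_isPack_of_seeds (a := a) (P := P)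
    (fun s hs => (Finset.mem_filter.1 (hSA hs)).2) hsep
  have hS : S.card ≤ k := hTS ▸ hp T hT
  have hCk : C.card ≤ k := h.card_sparse_le hp C fun X hX => (Finset.mem_filter.1 hX).2
  -- A vertex within `3` of a seed lies in `[s - 3, s + 6]` for some selected seed `s`, as each seed
  -- lies in some `[s, s + 3]`. These intervals have `10` positions and those around sparse vertices
  -- have `3`.
  have hsub : P ⊆ (C.biUnion fun Z => Finset.Icc (Z - 1) (Z + 1)) ∪
      S.biUnion fun s => Finset.Icc (s - 3) (s + 6) := by
    intro X hX
    rw [Finset.mem_union, Finset.mem_biUnion, Finset.mem_biUnion]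
    by_cases hfar : ∀ Y, IsSeed a P Y → X + 3 < Y ∨ Y + 3 < X
    · obtain ⟨Z, hZ, h1, h2⟩ := exists_sparse_near h.two_le hX hfar
      exact Or.inl ⟨Z, Finset.mem_filter.2 ⟨hZ.mem, hZ⟩, Finset.mem_Icc.2 ⟨by omega, by omega⟩⟩
    · push Not at hfar
      obtain ⟨Y, hY, h1, h2⟩ := hfar
      obtain ⟨s, hs, h3, h4⟩ := hcov Y (Finset.mem_filter.2 ⟨hY.1, hY⟩)
      exact Or.inr ⟨s, hs, Finset.mem_Icc.2 ⟨by omega, by omega⟩⟩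
  have h1 := Finset.card_biUnion_le_card_mul C (fun Z => Finset.Icc (Z - 1) (Z + 1)) 3
    fun Z _ => by rw [Int.card_Icc]; omega
  have h2 := Finset.card_biUnion_le_card_mul S (fun s => Finset.Icc (s - 3) (s + 6)) 10
    fun s _ => by rw [Int.card_Icc]; omega
  have := (Finset.card_le_card hsub).trans (Finset.card_union_le _ _)
  omega

end LinearPlumbing

/-! ### Riemenschneider duality and continued fractions. -/

namespace LinearPlumbing

/-- Pairs of lists of weights that are dual to each other in the sense of Riemenschneider. -/
inductive DualPair : List ℕ → List ℕ → Prop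
  | base : DualPair [2] [2]
  | left {l l' : List ℕ} {b : ℕ} : DualPair l (b :: l') → DualPair (2 :: l) ((b + 1) :: l')
  | right {l l' : List ℕ} {n b : ℕ} :
      DualPair ((n + 2) :: l) (b :: l') → DualPair ((n + 3) :: l) (2 :: b :: l')

/-- The sum over the coordinates met by a chain of vertices that starts at the position `o`. -/
def chainSum : ℤ → List ℕ → (ℤ × ℕ → ℤ) → ℤ
  | o, [], f => f (o, 0)
  | o, a :: l, f => ∑ t ∈ Finset.range (a - 1), f (o, t) + chainSum (o + 1) l f

/-- The orthogonal complement of a chain of vertices that starts at the position `o`. -/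
def IsChainFlow : ℤ → List ℕ → (ℤ × ℕ → ℤ) → Prop
  | _, [], _ => True
  | o, a :: l, x =>
    x (o + 1, 0) + ∑ t ∈ Finset.range (a - 1), x (o, t) = 0 ∧ IsChainFlow (o + 1) l x

/-- The negative of the intersection form of a linear plumbing. -/
def chainForm : List ℕ → (ℕ → ℤ) → (ℕ → ℤ) → ℤ
  | [], _, _ => 0
  | [b], c, d => b * c 0 * d 0
  | b :: b' :: l, c, d => b * c 0 * d 0 - c 0 * d 1 - c 1 * d 0 +
      chainForm (b' :: l) (fun s => c (s + 1)) (fun s => d (s + 1))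

theorem chainSum_congr {l : List ℕ} : ∀ {o : ℤ} {f g : ℤ × ℕ → ℤ},
    (∀ p t, o ≤ p → f (p, t) = g (p, t)) → chainSum o l f = chainSum o l g := by
  induction l with
  | nil => intro o f g h; exact h o 0 le_rfl
  | cons a l ih =>
    intro o f g h
    rw [chainSum, chainSum, ih fun p t hp => h p t (by omega)]
    congr 1
    exact Finset.sum_congr rfl fun t _ => h o t le_rfl

theorem IsChainFlow.congr {l : List ℕ} : ∀ {o : ℤ} {x y : ℤ × ℕ → ℤ},
    IsChainFlow o l x → (∀ p t, o ≤ p → x (p, t) = y (p, t)) → IsChainFlow o l y := by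
  induction l with
  | nil => intro o x y _ _; trivial
  | cons a l ih =>
    intro o x y hx h
    refine ⟨?_, ih hx.2 fun p t hp => h p t (by omega)⟩
    rw [← hx.1, h (o + 1) 0 (by omega)]
    congr 1
    exact Finset.sum_congr rfl fun t _ => (h o t le_rfl).symm

theorem chainForm_succ_head (b : ℕ) (l : List ℕ) (c d : ℕ → ℤ) :
    chainForm ((b + 1) :: l) c d = chainForm (b :: l) c d + c 0 * d 0 := by
  cases l <;> simp only [chainForm] <;> push_cast <;> ring

/-- Since `b ≥ 2`, induction bounds the form below by `c₀² + (c₀ - c₁)²`. -/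
theorem sq_le_chainForm {l : List ℕ} : ∀ {b : ℕ} {c : ℕ → ℤ}, (∀ e ∈ b :: l, 2 ≤ e) →
    c 0 ^ 2 ≤ chainForm (b :: l) c c := by
  induction l with
  | nil =>
    intro b c h
    have h1 : (2 : ℤ) ≤ b := by exact_mod_cast h b (by simp)
    simp only [chainForm]
    nlinarith [sq_nonneg (c 0)]
  | cons b' l ih =>
    intro b c h
    have h1 : (2 : ℤ) ≤ b := by exact_mod_cast h b (by simp)
    have h2 := ih (b := b') (c := fun s => c (s + 1)) fun e he => h e (List.mem_cons_of_mem _ he)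
    simp only [chainForm, zero_add] at h2 ⊢
    nlinarith [sq_nonneg (c 0), sq_nonneg (c 0 - c 1)]

theorem eq_zero_of_chainForm_eq_zero {l : List ℕ} : ∀ {c : ℕ → ℤ}, (∀ e ∈ l, 2 ≤ e) →
    chainForm l c c = 0 → ∀ s < l.length, c s = 0 := by
  induction l with
  | nil => intro c _ _ s hs; simp at hs
  | cons b l ih =>
    intro c h h0 s hs
    have h1 := sq_le_chainForm (c := c) h
    rw [h0] at h1
    have hc0 : c 0 = 0 := by
      by_contra hne
      have : 0 < c 0 ^ 2 := by positivity
      omega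
    cases s with
    | zero => exact hc0
    | succ s =>
      cases l with
      | nil => simp at hs
      | cons b' l =>
        refine ih (c := fun s => c (s + 1)) (fun e he => h e (List.mem_cons_of_mem _ he)) ?_ s
          (by simpa using hs)
        simpa [chainForm, hc0] using h0

theorem chainForm_nonneg {l : List ℕ} {c : ℕ → ℤ} (h : ∀ e ∈ l, 2 ≤ e) : 0 ≤ chainForm l c c := by
  cases l with
  | nil => simp [chainForm]
  | cons b l => exact (sq_nonneg (c 0)).trans (sq_le_chainForm h)

/-- Each step of duality adds one coordinate and one entry to exactly one of the two lists. -/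
theorem DualPair.chainSum_one {l l' : List ℕ} (h : DualPair l l') :
    ∀ o, chainSum o l (fun _ => 1) = l.length + l'.length := by
  induction h with
  | base => intro o; simp [chainSum]
  | left _ ih => intro o; rw [chainSum, ih]; simp; ring
  | right _ ih =>
    intro o
    have := ih o
    simp only [chainSum] at this ⊢
    simp at this ⊢
    linarith

theorem DualPair.exists_toFlow {l l' : List ℕ} (h : DualPair l l') : ∀ o : ℤ,
    ∃ (ε : ℤ) (T : (ℕ → ℤ) → ℤ × ℕ → ℤ), ε * ε = 1 ∧
      (∀ c, IsChainFlow o l (T c) ∧ T c (o, 0) = ε * c 0) ∧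
      ∀ c d, chainSum o l (fun e => T c e * T d e) = chainForm l' c d := by
  induction h with
  | base =>
    intro o
    refine ⟨1, fun c e => if e = (o, 0) then c 0 else -c 0, by norm_num, fun c => ⟨?_, by simp⟩,
      fun c d => ?_⟩
    · simp [IsChainFlow]
    · simp [chainSum, chainForm]; ring
  | @left l l' b _ ih =>
    intro o
    obtain ⟨ε, T, hε, hT, hTT⟩ := ih (o + 1)
    have hlt : ∀ p : ℤ, o + 1 ≤ p → p ≠ o := fun p hp => by omega
    -- The new `-2` has two coordinates, so the flow on the new one is forced to be minus the old
    -- first value. This adds `c₀ d₀` to the form, as raising the head of the dual list does; the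
    -- sign `ε` flips.
    refine ⟨-ε, fun c => Function.update (T c) (o, 0) (-T c (o + 1, 0)), by linarith,
      fun c => ⟨⟨?_, ?_⟩, ?_⟩, fun c d => ?_⟩
    · simp [Function.update_apply]
    · refine (hT c).1.congr fun p t hp => ?_
      simp [hlt p hp]
    · simp [(hT c).2]
    · rw [chainSum, chainForm_succ_head, ← hTT,
        chainSum_congr (o := o + 1) (g := fun e => T c e * T d e) fun p t hp => by
          simp [hlt p hp]]
      simp [(hT _).2]
      linear_combination (c 0 * d 0) * hε
  | @right l l' n b _ ih =>
    intro o
    obtain ⟨ε, T, hε, hT, hTT⟩ := ih o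
    have hlt : ∀ p : ℤ, o + 1 ≤ p → p ≠ o := fun p hp => by omega
    -- The old first coordinate, with value `ε c₁`, is split into two with values `ε c₀` and `ε (c₁
    -- - c₀)`; the change of the form is that of a new `2` at the head of the dual list.
    refine ⟨ε, fun c => Function.update (Function.update (T fun s => c (s + 1)) (o, n + 1)
      (ε * (c 1 - c 0))) (o, 0) (ε * c 0), hε, fun c => ⟨⟨?_, ?_⟩, by simp⟩, fun c d => ?_⟩
    · obtain ⟨⟨h1, -⟩, h2⟩ := hT fun s => c (s + 1)
      rw [show n + 2 - 1 = n + 1 by omega, Finset.sum_range_succ', h2] at h1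
      rw [show n + 3 - 1 = n + 1 + 1 by omega, Finset.sum_range_succ, Finset.sum_range_succ',
        Finset.sum_congr rfl (g := fun t => T (fun s => c (s + 1)) (o, t + 1)) fun t ht => by
          have : t ≠ n := (Finset.mem_range.1 ht).ne
          simp [this]]
      simp at h1 ⊢
      linarith
    · refine (hT fun s => c (s + 1)).1.2.congr fun p t hp => ?_
      simp [hlt p hp]
    · have h1 := hTT (fun s => c (s + 1)) (fun s => d (s + 1))
      rw [chainSum, show n + 2 - 1 = n + 1 by omega, Finset.sum_range_succ', (hT _).2,
        (hT _).2] at h1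
      rw [chainSum, show n + 3 - 1 = n + 1 + 1 by omega, Finset.sum_range_succ,
        Finset.sum_range_succ', Finset.sum_congr rfl (g := fun t =>
          T (fun s => c (s + 1)) (o, t + 1) * T (fun s => d (s + 1)) (o, t + 1)) fun t ht => by
          have : t ≠ n := (Finset.mem_range.1 ht).ne
          simp [this],
        chainSum_congr (o := o + 1) (g := fun e =>
          T (fun s => c (s + 1)) e * T (fun s => d (s + 1)) e) fun p t hp => by
          simp [hlt p hp], chainForm, ← h1]
      simp
      linear_combination (2 * c 0 * d 0 - c 0 * d 1 - c 1 * d 0) * hε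

theorem DualPair.exists_ofFlow {l l' : List ℕ} (h : DualPair l l') : ∀ o : ℤ,
    ∃ (ε : ℤ) (C : (ℤ × ℕ → ℤ) → ℕ → ℤ), ε * ε = 1 ∧
      (∀ x, IsChainFlow o l x → x (o, 0) = ε * C x 0) ∧
      ∀ x y, IsChainFlow o l x → IsChainFlow o l y →
        chainForm l' (C x) (C y) = chainSum o l (fun e => x e * y e) := by
  induction h with
  | base =>
    intro o
    refine ⟨1, fun x _ => x (o, 0), by norm_num, fun x _ => by simp, fun x y hx hy => ?_⟩
    simp [IsChainFlow, chainSum, chainForm] at hx hy ⊢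
    have e1 : x (o + 1, 0) = -x (o, 0) := by linarith
    have e2 : y (o + 1, 0) = -y (o, 0) := by linarith
    rw [e1, e2]; ring
  | @left l l' b _ ih =>
    intro o
    obtain ⟨ε, C, hε, hC, hCC⟩ := ih (o + 1)
    have key : ∀ x, IsChainFlow o (2 :: l) x → x (o, 0) = -ε * C x 0 := by
      rintro x ⟨h1, h2⟩
      have := hC x h2
      simp at h1
      linarith
    refine ⟨-ε, C, by linarith, key, fun x y hx hy => ?_⟩
    rw [chainForm_succ_head, hCC x y hx.2 hy.2, chainSum]
    simp [key x hx, key y hy]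
    linear_combination (-(C x 0 * C y 0)) * hε
  | @right l l' n b _ ih =>
    intro o
    obtain ⟨ε, C, hε, hC, hCC⟩ := ih o
    have hlt : ∀ p : ℤ, o + 1 ≤ p → p ≠ o := fun p hp => by omega
    -- The inverse of the splitting: the two coordinates are merged by adding their values.
    let old : (ℤ × ℕ → ℤ) → ℤ × ℕ → ℤ := fun x =>
      Function.update x (o, 0) (x (o, 0) + x (o, n + 1))
    have hold : ∀ x, IsChainFlow o ((n + 3) :: l) x → IsChainFlow o ((n + 2) :: l) (old x) := by
      rintro x ⟨h1, h2⟩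
      refine ⟨?_, h2.congr fun p t hp => by simp [old, hlt p hp]⟩
      rw [show n + 3 - 1 = n + 1 + 1 by omega, Finset.sum_range_succ, Finset.sum_range_succ'] at h1
      rw [show n + 2 - 1 = n + 1 by omega, Finset.sum_range_succ']
      simp [old]
      linarith
    let D : (ℤ × ℕ → ℤ) → ℕ → ℤ := fun x s => Nat.casesOn s (ε * x (o, 0)) (C (old x))
    refine ⟨ε, D, hε, fun x _ => ?_, fun x y hx hy => ?_⟩
    · change x (o, 0) = ε * (ε * x (o, 0))
      linear_combination (-(x (o, 0))) * hε
    · have h1 := hCC _ _ (hold x hx) (hold y hy)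
      have hx1 := hC _ (hold x hx)
      have hy1 := hC _ (hold y hy)
      have ex : old x (o, 0) = x (o, 0) + x (o, n + 1) := by simp [old]
      have ey : old y (o, 0) = y (o, 0) + y (o, n + 1) := by simp [old]
      have hrec : chainForm (2 :: b :: l') (D x) (D y) = 2 * (ε * x (o, 0)) * (ε * y (o, 0)) -
          ε * x (o, 0) * C (old y) 0 - C (old x) 0 * (ε * y (o, 0)) +
          chainForm (b :: l') (C (old x)) (C (old y)) := rfl
      rw [chainSum, show n + 2 - 1 = n + 1 by omega, Finset.sum_range_succ',
        Finset.sum_congr rfl (g := fun t => x (o, t + 1) * y (o, t + 1)) fun t _ => by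
          simp [old],
        chainSum_congr (o := o + 1) (g := fun e => x e * y e) fun p t hp => by
          simp [old, hlt p hp]] at h1
      rw [hrec, h1, chainSum, show n + 3 - 1 = n + 1 + 1 by omega, Finset.sum_range_succ,
        Finset.sum_range_succ']
      rw [ex] at hx1 h1 ⊢
      rw [ey] at hy1 h1 ⊢
      linear_combination (2 * x (o, 0) * y (o, 0)) * hε + x (o, 0) * hy1 + y (o, 0) * hx1

theorem hjExpansion_add (p : ℕ) {q : ℕ} (hq : 0 < q) {b : ℕ} {l : List ℕ}
    (h : hjExpansion p q = b :: l) : hjExpansion (p + q) q = (b + 1) :: l := by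
  obtain ⟨q, rfl⟩ : ∃ q', q = q' + 1 := ⟨q - 1, by omega⟩
  rw [hjExpansion] at h ⊢
  rw [show p + (q + 1) + q = p + q + (q + 1) by ring, Nat.add_div_right _ (Nat.succ_pos q),
    Nat.add_mod_right]
  simp only [List.cons.injEq] at h ⊢
  exact ⟨by rw [h.1], h.2⟩

theorem hjExpansion_eq_cons {p q r b : ℕ} (hr : r < q) (h : p + r = b * q) :
    hjExpansion p q = b :: hjExpansion q r := by
  obtain ⟨q, rfl⟩ : ∃ q', q = q' + 1 := ⟨q - 1, by omega⟩
  have h1 : p + q = (q - r) + (q + 1) * b := by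
    have : (q + 1) * b = b * (q + 1) := mul_comm _ _
    omega
  rw [hjExpansion, h1, Nat.add_mul_div_left _ _ (Nat.succ_pos q), Nat.add_mul_mod_self_left,
    Nat.div_eq_of_lt (by omega), Nat.mod_eq_of_lt (by omega), zero_add]
  congr 2
  omega

theorem exists_hjExpansion_eq_cons {p q : ℕ} (hq : 0 < q) :
    ∃ b l, hjExpansion p q = b :: l := by
  obtain ⟨q, rfl⟩ : ∃ q', q = q' + 1 := ⟨q - 1, by omega⟩
  rw [hjExpansion]
  exact ⟨_, _, rfl⟩

theorem dualPair_hjExpansion {p : ℕ} : ∀ {q : ℕ}, 0 < q → q < p → Nat.Coprime p q →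
    DualPair (hjExpansion p q) (hjExpansion p (p - q)) := by
  induction p using Nat.strong_induction_on with
  | _ p ih =>
  intro q hq hqp hc
  -- If `p < 2 q`, the expansion of `p / q` starts with `2`, and `p / (p - q) = 1 + q / (p - q)`
  -- only raises a head; removing both gives the pair for `q`. The case `p > 2 q` is the same with
  -- the roles exchanged, and `p = 2 q` forces `q = 1`.
  rcases lt_trichotomy p (2 * q) with h | h | h
  · obtain ⟨b, l, hb⟩ := exists_hjExpansion_eq_cons (p := q) (q := p - q) (by omega)
    have h1 := ih q hqp (q := 2 * q - p) (by omega) (by omega) (by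
      have h2 : Nat.Coprime q (p - q) :=
        (Nat.coprime_sub_self_right hqp.le).2 hc.symm
      have h3 := (Nat.coprime_self_sub_right (m := p - q) (n := q) (by omega)).2 h2
      rwa [show q - (p - q) = 2 * q - p by omega] at h3)
    rw [show q - (2 * q - p) = p - q by omega, hb] at h1
    have h2 := hjExpansion_add q (q := p - q) (by omega) hb
    rw [show q + (p - q) = p by omega] at h2
    rw [h2, hjExpansion_eq_cons (p := p) (q := q) (r := 2 * q - p) (b := 2) (by omega) (by omega)]
    exact h1.left
  · subst h
    have : q = 1 := by
      have h1 : q ∣ Nat.gcd (2 * q) q := Nat.dvd_gcd (dvd_mul_left q 2) dvd_rfl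
      rw [hc] at h1
      exact Nat.dvd_one.1 h1
    subst this
    rw [hjExpansion_eq_cons (p := 2 * 1) (q := 1) (r := 0) (b := 2) (by omega) (by omega)]
    simp only [hjExpansion]
    exact DualPair.base
  · obtain ⟨b, l, hb⟩ := exists_hjExpansion_eq_cons (p := p - q) (q := q) hq
    obtain ⟨b', l', hb'⟩ := exists_hjExpansion_eq_cons (p := p - q) (q := p - q - q) (by omega)
    have h1 := ih (p - q) (by omega) (q := q) hq (by omega)
      ((Nat.coprime_sub_self_left hqp.le).2 hc)
    have h2b := two_le_of_mem_hjExpansion (show q < p - q by omega) b (by rw [hb]; simp)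
    obtain ⟨n, rfl⟩ : ∃ n, b = n + 2 := ⟨b - 2, by omega⟩
    have h2 := hjExpansion_add (p - q) (q := q) hq hb
    rw [show p - q + q = p by omega] at h2
    rw [hb, hb'] at h1
    rw [h2, hjExpansion_eq_cons (p := p) (q := p - q) (r := p - q - q) (b := 2) (by omega)
      (by omega), hb']
    exact h1.right

theorem _root_.LensSpace.dualPair (L : LensSpace) : DualPair L.coeffs L.reverse.coeffs :=
  dualPair_hjExpansion L.q_pos L.q_lt_p L.coprime

theorem exists_coeffs_eq {l : List ℕ} (hl : l ≠ []) (h : ∀ b ∈ l, 2 ≤ b) :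
    ∃ L : LensSpace, L.coeffs = l := by
  induction l with
  | nil => exact absurd rfl hl
  | cons b l ih =>
    have hb := h b (by simp)
    cases l with
    | nil =>
      refine ⟨⟨b, 1, by omega, by omega, Nat.coprime_one_right b⟩, ?_⟩
      rw [LensSpace.coeffs, hjExpansion_eq_cons (r := 0) (b := b) Nat.one_pos (by simp)]
      simp [hjExpansion]
    | cons b' l =>
      obtain ⟨L, hL⟩ := ih (by simp) fun e he => h e (List.mem_cons_of_mem _ he)
      have h1 := L.q_lt_p
      have h2 : 2 * L.p ≤ b * L.p := Nat.mul_le_mul_right _ hb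
      -- The fraction is `b - q / p = (b p - q) / p`, where `p / q` is the fraction of the tail.
      refine ⟨⟨b * L.p - L.q, L.p, by omega, by omega, ?_⟩, ?_⟩
      · have h3 : L.q + (b * L.p - L.q) = b * L.p := by omega
        have h4 : Nat.Coprime L.q L.p := L.coprime.symm
        rw [Nat.coprime_iff_gcd_eq_one] at h4 ⊢
        refine Nat.dvd_one.1 (h4 ▸ Nat.dvd_gcd ?_ (Nat.gcd_dvd_right _ _))
        refine (Nat.dvd_add_left (Nat.gcd_dvd_left _ _)).1 ?_
        rw [h3]
        exact (Nat.gcd_dvd_right _ _).trans (dvd_mul_left _ _)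
      · rw [LensSpace.coeffs, hjExpansion_eq_cons (r := L.q) (b := b) h1 (by simp only; omega)]
        exact congrArg _ hL

end LinearPlumbing

/-! ### Translation of Property `X_k` into compressibility. -/

namespace LinearPlumbing

variable {a : ℤ → ℕ} {P Q : Finset ℤ} {k : ℕ} {x y : ℤ × ℕ → ℤ}

theorem IsFlow.congr (hx : IsFlow a P x) (h : ∀ c ∈ cells a P, x c = y c) : IsFlow a P y := by
  intro i hi
  rw [← hx i hi]
  exact Finset.sum_congr rfl fun c hc => (h c (block_subset_cells hi hc)).symm

theorem isChainFlow_iff {l : List ℕ} : ∀ {o : ℤ}, (∀ s (hs : s < l.length), a (o + s) = l[s]) →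
    (IsChainFlow o l x ↔ IsFlow a (Finset.Ico o (o + l.length)) x) := by
  induction l with
  | nil => intro o _; simp [IsChainFlow, IsFlow]
  | cons b l ih =>
    intro o h
    have h0 : a o = b := by
      have h0 := h 0 (by simp)
      rw [Nat.cast_zero, add_zero] at h0
      exact h0
    have h1 : ∀ s (hs : s < l.length), a (o + 1 + s) = l[s] := fun s hs => by
      have := h (s + 1) (by simpa using hs)
      rw [List.getElem_cons_succ] at this
      rw [← this]; push_cast; congr 1; ring
    rw [IsChainFlow, ih h1]
    have e : ∀ p, p ∈ Finset.Ico o (o + (b :: l).length) ↔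
        p = o ∨ p ∈ Finset.Ico (o + 1) (o + 1 + l.length) := by
      intro p
      simp only [Finset.mem_Ico, List.length_cons]; push_cast; omega
    simp only [IsFlow, e, forall_eq_or_imp]
    rw [sum_block, h0]

theorem chainSum_eq {l : List ℕ} (hl : l ≠ []) (h2 : ∀ b ∈ l, 2 ≤ b) (f : ℤ × ℕ → ℤ) :
    ∀ {o : ℤ}, (∀ s (hs : s < l.length), a (o + s) = l[s]) →
    chainSum o l f = ∑ c ∈ cells a (Finset.Ico o (o + l.length)), f c := by
  induction l with
  | nil => exact absurd rfl hl
  | cons b l ih =>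
    intro o h
    have h0 : a o = b := by
      have h0 := h 0 (by simp)
      rw [Nat.cast_zero, add_zero] at h0
      exact h0
    have h1 : ∀ s (hs : s < l.length), a (o + 1 + s) = l[s] := fun s hs => by
      have := h (s + 1) (by simpa using hs)
      rw [List.getElem_cons_succ] at this
      rw [← this]; push_cast; congr 1; ring
    have e : Finset.Ico o (o + (b :: l).length) =
        {o} ∪ Finset.Ico (o + 1) (o + 1 + l.length) := by
      ext p
      simp only [Finset.mem_Ico, List.length_cons, Finset.mem_union, Finset.mem_singleton]
      push_cast; omega
    cases l with
    | nil =>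
      simp only [List.length_cons, List.length_nil] at e ⊢
      rw [e]
      simp [chainSum, cells, sum_block, h0, add_comm]
    | cons b' l =>
      have hb' : a (o + 1) = b' := by
        have h0 := h1 0 (by simp)
        rw [Nat.cast_zero, add_zero] at h0
        exact h0
      have hb2 := h2 b' (by simp)
      have hcells : cells a (Finset.Ico o (o + (b :: b' :: l).length)) =
          ((Finset.range (b - 1)).image fun t => (o, t)) ∪
            cells a (Finset.Ico (o + 1) (o + 1 + (b' :: l).length)) := by
        have hmem : ((o + 1, 0) : ℤ × ℕ) ∈
            cells a (Finset.Ico (o + 1) (o + 1 + (b' :: l).length)) :=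
          mem_cells.2 ⟨o + 1, by simp, mem_block.2 (Or.inr ⟨rfl, by simp; omega⟩)⟩
        rw [e, cells, Finset.union_biUnion, Finset.singleton_biUnion, ← cells, block, h0,
          Finset.insert_union, Finset.insert_eq_of_mem]
        · exact Finset.mem_union_right _ hmem
      rw [hcells, Finset.sum_union, Finset.sum_image (by simp), chainSum,
        ih (by simp) (fun e he => h2 e (List.mem_cons_of_mem _ he)) h1]
      rw [Finset.disjoint_left]
      intro c hc hd
      obtain ⟨t, -, rfl⟩ := Finset.mem_image.1 hc
      obtain ⟨i, hi, hci⟩ := mem_cells.1 hd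
      rw [Finset.mem_Ico] at hi
      rcases mem_block.1 hci with h | ⟨h, -⟩
      · have := (Prod.mk.inj h).1; omega
      · simp at h; omega

theorem fst_mem_of_mem_cells {o : ℤ} {n : ℕ} {c : ℤ × ℕ}
    (hc : c ∈ cells a (Finset.Ico o (o + n))) : o ≤ c.1 ∧ c.1 ≤ o + n := by
  obtain ⟨i, hi, hci⟩ := mem_cells.1 hc
  rw [Finset.mem_Ico] at hi
  rcases mem_block.1 hci with rfl | ⟨h, -⟩
  · simp; omega
  · omega

theorem sum_eq_chainForm {l : List ℕ} : ∀ c d : ℕ → ℤ,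
    ∑ s : Fin l.length, ∑ t : Fin l.length, c s * (if s = t then (l.get s : ℤ) else
      if s.val + 1 = t.val ∨ t.val + 1 = s.val then -1 else 0) * d t = chainForm l c d := by
  induction l with
  | nil => intro c d; simp [chainForm]
  | cons b l ih =>
    intro c d
    have h1 := ih (fun s => c (s + 1)) (fun s => d (s + 1))
    cases l with
    | nil => simp [chainForm]; ring_nf; simp
    | cons b' l =>
      rw [chainForm, ← h1]
      simp only [List.length_cons, Fin.sum_univ_succ, Finset.sum_add_distrib]
      simp [Fin.ext_iff]
      ring_nf

theorem additive_of_isometric {M J : Type*} [AddCommGroup M] [Fintype J]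
    (B : LinearMap.BilinForm ℤ M) (f : M → J → ℤ) (h : ∀ x y, f x ⬝ᵥ f y = B x y) (x y : M) :
    f (x + y) = f x + f y := by
  rw [← sub_eq_zero, ← dotProduct_self_eq_zero]
  simp only [sub_dotProduct, dotProduct_sub, add_dotProduct, dotProduct_add, h, map_add,
    LinearMap.add_apply]
  ring

end LinearPlumbing

namespace LinearPlumbing

variable {a : ℤ → ℕ} {P Q : Finset ℤ} {k : ℕ} {x y : ℤ × ℕ → ℤ}

/-- The vertices of a weighted graph are identified with the positions in `P`, so that the adjacent
vertices are those at consecutive positions. -/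
structure IsModel {V : Type*} (G : WeightedGraph V) (a : ℤ → ℕ) (P : Finset ℤ) (f : V → ℤ) :
    Prop where
  inj : Function.Injective f
  mem : ∀ p, p ∈ P ↔ ∃ v, f v = p
  adj : ∀ u v, G.graph.Adj u v ↔ (f v = f u + 1 ∨ f u = f v + 1)
  weight : ∀ v, G.weight v = -(a (f v) : ℤ)

section Chains

variable {m N : ℕ} {l l' : Fin m → List ℕ}

/-- The weights for the `i`-th chain placed at the multiple `i N` of `N`. -/
def chainWeight (N : ℕ) (l : Fin m → List ℕ) (p : ℤ) : ℕ :=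
  if h : (p / N).toNat < m then (l ⟨_, h⟩).getD (p % N).toNat 0 else 0

/-- The positions of the `i`-th chain. -/
noncomputable def chainRun (N : ℕ) (l : Fin m → List ℕ) (i : Fin m) : Finset ℤ :=
  Finset.Ico (i * N : ℤ) (i * N + (l i).length)

/-- The positions of all chains. -/
noncomputable def chainPositions (N : ℕ) (l : Fin m → List ℕ) : Finset ℤ :=
  Finset.univ.biUnion (chainRun N l)

/-- The function that is given by `x i` on the coordinates of the `i`-th chain. -/
def glue (N : ℕ) (x : Fin m → ℤ × ℕ → ℤ) (c : ℤ × ℕ) : ℤ :=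
  if h : (c.1 / N).toNat < m then x ⟨_, h⟩ c else 0

theorem add_ediv_and_emod {i s : ℤ} (h0 : 0 ≤ s) (h : s < N) :
    (i * N + s) / N = i ∧ (i * N + s) % N = s := by
  have hN : (N : ℤ) ≠ 0 := by omega
  refine ⟨?_, ?_⟩
  · rw [add_comm, Int.add_mul_ediv_right _ _ hN, Int.ediv_eq_zero_of_lt h0 h, zero_add]
  · rw [add_comm, Int.add_mul_emod_self_right, Int.emod_eq_of_lt h0 h]

theorem chainWeight_apply (hN : ∀ i, (l i).length < N) (i : Fin m) (s : ℕ)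
    (hs : s < (l i).length) : chainWeight N l (i * N + s) = (l i)[s] := by
  have := hN i
  obtain ⟨h1, h2⟩ := add_ediv_and_emod (N := N) (i := i) (s := s) (by omega) (by omega)
  simp only [chainWeight, h1, h2, Int.toNat_natCast, Fin.is_lt, dif_pos, Fin.eta]
  exact List.getD_eq_getElem _ _ hs

theorem glue_eq (hN : ∀ i, (l i).length < N) (x : Fin m → ℤ × ℕ → ℤ) {i : Fin m} {c : ℤ × ℕ}
    (hc : c ∈ cells a (chainRun N l i)) : glue N x c = x i c := by
  have := hN i
  obtain ⟨h1, h2⟩ := fst_mem_of_mem_cells hc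
  obtain ⟨h3, -⟩ := add_ediv_and_emod (N := N) (i := i) (s := c.1 - i * N) (by omega) (by omega)
  rw [add_sub_cancel] at h3
  simp only [glue, h3, Int.toNat_natCast, Fin.is_lt, dif_pos, Fin.eta]

theorem chainRun_separated (hN : ∀ i, (l i).length < N) {i j : Fin m} (hij : i ≠ j) :
    ∀ p ∈ chainRun N l i, ∀ q ∈ chainRun N l j, p + 2 ≤ q ∨ q + 2 ≤ p := by
  intro p hp q hq
  rw [chainRun, Finset.mem_Ico] at hp hq
  have hi := hN i
  have hj := hN j
  obtain ⟨h1, h2⟩ := add_ediv_and_emod (N := N) (i := i) (s := p - i * N) (by omega) (by omega)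
  rcases lt_or_gt_of_ne hij with h | h
  · have h3 : (i : ℤ) + 1 ≤ j := by exact_mod_cast h
    have : ((i : ℤ) + 1) * N ≤ j * N := by gcongr
    left; linarith
  · have h3 : (j : ℤ) + 1 ≤ i := by exact_mod_cast h
    have : ((j : ℤ) + 1) * N ≤ i * N := by gcongr
    right; linarith

theorem sum_cells_chainPositions (hN : ∀ i, (l i).length < N) (f : ℤ × ℕ → ℤ) :
    ∑ c ∈ cells a (chainPositions N l), f c = ∑ i, ∑ c ∈ cells a (chainRun N l i), f c := by
  rw [chainPositions, cells, Finset.biUnion_biUnion]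
  exact Finset.sum_biUnion fun i _ j _ hij => disjoint_cells (chainRun_separated hN hij)

theorem isFlow_chainPositions :
    IsFlow a (chainPositions N l) x ↔ ∀ i, IsFlow a (chainRun N l i) x := by
  simp only [IsFlow, chainPositions, Finset.mem_biUnion, Finset.mem_univ, true_and]
  exact ⟨fun h i p hp => h p ⟨i, hp⟩, fun h p ⟨i, hp⟩ => h i p hp⟩

theorem DualPair.ne_nil {l l' : List ℕ} (h : DualPair l l') : l ≠ [] := by
  cases h <;> simp

theorem card_cells_chainPositions (hN : ∀ i, (l i).length < N) (hd : ∀ i, DualPair (l i) (l' i))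
    (h2 : ∀ i, ∀ b ∈ l i, 2 ≤ b) : ((cells (chainWeight N l) (chainPositions N l)).card : ℤ) =
      ∑ i, ((l i).length + (l' i).length : ℤ) := by
  have h := sum_cells_chainPositions (a := chainWeight N l) hN fun _ => 1
  simp only [Finset.sum_const, nsmul_eq_mul, mul_one] at h
  rw [h]
  refine Finset.sum_congr rfl fun i _ => ?_
  rw [← (hd i).chainSum_one (i * N), chainSum_eq (hd i).ne_nil (h2 i) _ (chainWeight_apply hN i)]
  simp [chainRun]

theorem exists_toFlow (hN : ∀ i, (l i).length < N) (hd : ∀ i, DualPair (l i) (l' i))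
    (h2 : ∀ i, ∀ b ∈ l i, 2 ≤ b) : ∃ T : (Fin m → ℕ → ℤ) → ℤ × ℕ → ℤ,
      (∀ c, IsFlow (chainWeight N l) (chainPositions N l) (T c)) ∧
      ∀ c d, pairing (chainWeight N l) (chainPositions N l) (T c) (T d) =
        ∑ i, chainForm (l' i) (c i) (d i) := by
  have h := fun i => (hd i).exists_toFlow (i * N)
  choose ε T _ hT hTT using h
  refine ⟨fun c => glue N fun i => T i (c i), fun c => isFlow_chainPositions.2 fun i => ?_,
    fun c d => ?_⟩
  · exact ((isChainFlow_iff (chainWeight_apply hN i)).1 (hT i (c i)).1).congr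
      fun e he => (glue_eq hN (fun i => T i (c i)) he).symm
  · rw [pairing, sum_cells_chainPositions hN]
    refine Finset.sum_congr rfl fun i _ => ?_
    rw [← hTT, chainSum_eq (hd i).ne_nil (h2 i) _ (chainWeight_apply hN i)]
    exact Finset.sum_congr rfl fun e he => congrArg₂ (· * ·)
      (glue_eq hN (fun i => T i (c i)) he) (glue_eq hN (fun i => T i (d i)) he)

theorem exists_ofFlow (hN : ∀ i, (l i).length < N) (hd : ∀ i, DualPair (l i) (l' i))
    (h2 : ∀ i, ∀ b ∈ l i, 2 ≤ b) : ∃ C : (ℤ × ℕ → ℤ) → Fin m → ℕ → ℤ,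
      ∀ x y, IsFlow (chainWeight N l) (chainPositions N l) x →
        IsFlow (chainWeight N l) (chainPositions N l) y →
        ∑ i, chainForm (l' i) (C x i) (C y i) =
          pairing (chainWeight N l) (chainPositions N l) x y := by
  have h := fun i => (hd i).exists_ofFlow (i * N)
  choose ε C _ _ hCC using h
  refine ⟨fun x i => C i x, fun x y hx hy => ?_⟩
  rw [isFlow_chainPositions] at hx hy
  rw [pairing, sum_cells_chainPositions hN]
  refine Finset.sum_congr rfl fun i _ => ?_
  rw [hCC i x y ((isChainFlow_iff (chainWeight_apply hN i)).2 (hx i))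
    ((isChainFlow_iff (chainWeight_apply hN i)).2 (hy i)),
    chainSum_eq (hd i).ne_nil (h2 i) _ (chainWeight_apply hN i)]
  rfl

end Chains

section LensSpaces

variable {m : ℕ} (L : Fin m → LensSpace)

theorem two_le_of_mem_coeffs (L : LensSpace) : ∀ b ∈ L.coeffs, 2 ≤ b :=
  two_le_of_mem_hjExpansion L.q_lt_p

theorem intersectionForm_apply (c d : Fin m → ℕ → ℤ) :
    (canonicalPlumbingGraph L).intersectionForm (fun v => c v.1 v.2) (fun v => d v.1 v.2) =
      -∑ i, chainForm (L i).coeffs (c i) (d i) := by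
  classical
  refine (@Matrix.toBilin'_apply _ _ _ _ (fun a b => Classical.propDecidable (a = b))
    _ _ _).trans ?_
  rw [Fintype.sum_sigma, ← Finset.sum_neg_distrib]
  refine Finset.sum_congr rfl fun i _ => ?_
  rw [← sum_eq_chainForm, ← Finset.sum_neg_distrib]
  refine Finset.sum_congr rfl fun s _ => ?_
  rw [Fintype.sum_sigma, Finset.sum_eq_single i, ← Finset.sum_neg_distrib]
  · refine Finset.sum_congr rfl fun t _ => ?_
    simp only [Matrix.of_apply, canonicalPlumbingGraph, Sigma.mk.injEq, heq_eq_eq, true_and]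
    split_ifs <;> ring
  · intro j _ hj
    refine Finset.sum_eq_zero fun t _ => ?_
    simp [canonicalPlumbingGraph, Ne.symm hj]
  · simp

theorem bettiTwo_canonicalPlumbingGraph :
    (canonicalPlumbingGraph L).bettiTwo = ∑ i, (L i).coeffs.length := by
  rw [WeightedGraph.bettiTwo, Module.finrank_fintype_fun_eq_card, Fintype.card_sigma]
  simp

theorem standardNegativeForm_apply {n : ℕ} (x y : Fin n → ℤ) :
    standardNegativeForm n x y = -(x ⬝ᵥ y) := by
  rw [standardNegativeForm, Matrix.toBilin'_apply', Matrix.neg_mulVec, Matrix.one_mulVec,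
    dotProduct_neg]

/-- The flows on the chains and the lattice of the dual plumbing are isometric up to the overall
sign, and the number of coordinates is the sum of the two Betti numbers. -/
theorem propertyX_iff_not_compressible {N : ℕ} (hN : ∀ i, (L i).coeffs.length < N) :
    PropertyX k L ↔ ¬ Compressible (chainWeight N fun i => (L i).coeffs)
      (chainPositions N fun i => (L i).coeffs) k := by
  classical
  have hd := fun i => (L i).dualPair
  have h2 := fun i => two_le_of_mem_coeffs (L i)
  have hcard := card_cells_chainPositions hN hd h2
  have hb : (((canonicalPlumbingGraph L).bettiTwo : ℤ) + (dualPlumbingGraph L).bettiTwo) =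
      (cells (chainWeight N fun i => (L i).coeffs)
        (chainPositions N fun i => (L i).coeffs)).card := by
    rw [hcard, dualPlumbingGraph, bettiTwo_canonicalPlumbingGraph, bettiTwo_canonicalPlumbingGraph,
      Finset.sum_add_distrib]
    push_cast; rfl
  rw [PropertyX, not_iff_not, hb]
  constructor
  · rintro ⟨n, hn, f, -, hf⟩
    obtain ⟨C, hC⟩ := exists_ofFlow hN hd h2
    refine ⟨Fin n, inferInstance, fun x => f fun v => C x v.1 v.2, ?_, fun x y hx hy => ?_⟩
    · rw [Fintype.card_fin]; omega
    · rw [← neg_neg (_ ⬝ᵥ _), ← standardNegativeForm_apply, hf, dualPlumbingGraph,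
        intersectionForm_apply, neg_neg, hC x y hx hy]
  · rintro ⟨J, _, φ, hJ, hφ⟩
    obtain ⟨T, hT, hTT⟩ := exists_toFlow hN hd h2
    let e := Fintype.equivFin J
    let r : ((Σ i : Fin m, Fin (L i).reverse.coeffs.length) → ℤ) → Fin m → ℕ → ℤ :=
      fun c i s => if h : s < (L i).reverse.coeffs.length then c ⟨i, s, h⟩ else 0
    have hr : ∀ c, (fun v : Σ i : Fin m, Fin (L i).reverse.coeffs.length => r c v.1 v.2) = c := by
      intro c; funext v; simp [r]
    have hform : ∀ c d, (dualPlumbingGraph L).intersectionForm c d =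
        -∑ i, chainForm (L i).reverse.coeffs (r c i) (r d i) := by
      intro c d
      have := intersectionForm_apply (fun i => (L i).reverse) (r c) (r d)
      rwa [hr, hr] at this
    let ψ : ((Σ i : Fin m, Fin (L i).reverse.coeffs.length) → ℤ) → Fin (Fintype.card J) → ℤ :=
      fun c j => φ (T (r c)) (e.symm j)
    have hψ : ∀ c d, ψ c ⬝ᵥ ψ d = (-(dualPlumbingGraph L).intersectionForm) c d := by
      intro c d
      rw [LinearMap.neg_apply, LinearMap.neg_apply, hform, neg_neg, ← hTT,
        ← hφ _ _ (hT _) (hT _)]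
      exact Equiv.sum_comp e.symm fun j => φ (T (r c)) j * φ (T (r d)) j
    refine ⟨Fintype.card J, by omega,
      (AddMonoidHom.mk' ψ (additive_of_isometric _ ψ hψ)).toIntLinearMap, ?_, fun c d => ?_⟩
    -- Injectivity comes from definiteness of the dual form.
    · rw [injective_iff_map_eq_zero]
      intro c hc
      have h0 := hψ c c
      change ψ c = 0 at hc
      rw [hc, zero_dotProduct, LinearMap.neg_apply, LinearMap.neg_apply, hform, neg_neg] at h0
      have h3 := (Finset.sum_eq_zero_iff_of_nonneg fun i _ =>
        chainForm_nonneg (two_le_of_mem_coeffs (L i).reverse)).1 h0.symm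
      rw [← hr c]
      funext v
      exact eq_zero_of_chainForm_eq_zero (two_le_of_mem_coeffs (L v.1).reverse)
        (h3 v.1 (Finset.mem_univ _)) v.2 v.2.2
    · change standardNegativeForm _ (ψ c) (ψ d) = _
      rw [standardNegativeForm_apply, hψ]
      simp

theorem exists_isModel : ∃ (a : ℤ → ℕ) (P : Finset ℤ)
    (f : (Σ i : Fin m, Fin (L i).coeffs.length) → ℤ), IsModel (canonicalPlumbingGraph L) a P f ∧
      (∀ p ∈ P, 2 ≤ a p) ∧ ∀ k, PropertyX k L ↔ ¬ Compressible a P k := by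
  -- The strict inequality leaves an empty position between consecutive chains.
  obtain ⟨N, hN⟩ : ∃ N, ∀ i, (L i).coeffs.length < N :=
    ⟨∑ i, (L i).coeffs.length + 1, fun i => Nat.lt_succ_of_le
      (Finset.single_le_sum (f := fun i => (L i).coeffs.length) (fun _ _ => Nat.zero_le _)
        (Finset.mem_univ i))⟩
  have hw := chainWeight_apply hN
  have hlt : ∀ v : Σ i : Fin m, Fin (L i).coeffs.length, ((v.2 : ℕ) : ℤ) + 1 < N := by
    intro v
    have := hN v.1
    have := v.2.2
    omega
  have hdiv : ∀ (i j : ℤ) (s t : ℤ), 0 ≤ s → s < N → 0 ≤ t → t < N →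
      i * N + s = j * N + t → i = j ∧ s = t := by
    intro i j s t h1 h2 h3 h4 h
    obtain ⟨h5, h6⟩ := add_ediv_and_emod (i := i) h1 h2
    obtain ⟨h7, h8⟩ := add_ediv_and_emod (i := j) h3 h4
    rw [h] at h5 h6
    exact ⟨h5.symm.trans h7, h6.symm.trans h8⟩
  have hmem : ∀ p, p ∈ chainPositions N (fun i => (L i).coeffs) ↔
      ∃ v : Σ i : Fin m, Fin (L i).coeffs.length, (v.1 : ℤ) * N + (v.2 : ℕ) = p := by
    intro p
    simp only [chainPositions, Finset.mem_biUnion, Finset.mem_univ, true_and, chainRun,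
      Finset.mem_Ico]
    constructor
    · rintro ⟨i, h1, h2⟩
      exact ⟨⟨i, (p - i * N).toNat, by omega⟩, by simp only; omega⟩
    · rintro ⟨⟨i, s, hs⟩, rfl⟩
      exact ⟨i, by simp only; omega, by simp only; omega⟩
  refine ⟨chainWeight N fun i => (L i).coeffs, chainPositions N fun i => (L i).coeffs,
    fun v => v.1 * N + (v.2 : ℕ), ⟨?_, hmem, ?_, ?_⟩, ?_, fun k =>
    propertyX_iff_not_compressible L hN⟩
  · rintro ⟨i, s⟩ ⟨j, t⟩ h
    have h1 := hlt ⟨i, s⟩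
    have h2 := hlt ⟨j, t⟩
    obtain ⟨h3, h4⟩ := hdiv i j s t (by omega) (by simp only at h1; omega) (by omega)
      (by simp only at h2; omega) h
    obtain rfl : i = j := Fin.ext (by exact_mod_cast h3)
    obtain rfl : s = t := Fin.ext (by exact_mod_cast h4)
    rfl
  · rintro ⟨i, s⟩ ⟨j, t⟩
    have h1 := hlt ⟨i, s⟩
    have h2 := hlt ⟨j, t⟩
    simp only at h1 h2
    simp only [canonicalPlumbingGraph]
    constructor
    · rintro ⟨rfl, h | h⟩
      · left; rw [← h]; push_cast; ring
      · right; rw [← h]; push_cast; ring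
    · rintro (h | h)
      · obtain ⟨h3, h4⟩ := hdiv j i t (s + 1) (by omega) (by omega) (by omega) (by omega)
          (by linarith)
        exact ⟨Fin.ext (by exact_mod_cast h3.symm), Or.inl (by omega)⟩
      · obtain ⟨h3, h4⟩ := hdiv i j s (t + 1) (by omega) (by omega) (by omega) (by omega)
          (by linarith)
        exact ⟨Fin.ext (by exact_mod_cast h3), Or.inr (by omega)⟩
  · rintro ⟨i, s⟩
    simp only [canonicalPlumbingGraph]
    rw [hw i s s.2]
    rfl
  · intro p hp
    obtain ⟨⟨i, s⟩, rfl⟩ := (hmem p).1 hp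
    simp only
    rw [hw i s s.2]
    exact two_le_of_mem_coeffs (L i) _ (List.getElem_mem _)

end LensSpaces

end LinearPlumbing

/-! ### Isomorphism and finiteness of weighted graphs. -/

namespace WeightedGraph

variable {U V W : Type*} {F : WeightedGraph U} {G : WeightedGraph V} {H : WeightedGraph W}

theorem IsIsomorphic.symm (h : G.IsIsomorphic H) : H.IsIsomorphic G := by
  obtain ⟨f, hf⟩ := h
  exact ⟨f.symm, fun v => by rw [← hf, RelIso.apply_symm_apply]⟩

theorem IsIsomorphic.trans (h : F.IsIsomorphic G) (h' : G.IsIsomorphic H) : F.IsIsomorphic H := by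
  obtain ⟨f, hf⟩ := h
  obtain ⟨g, hg⟩ := h'
  exact ⟨f.trans g, fun v => by rw [RelIso.trans_apply, hg, hf]⟩

theorem IsIsomorphic.isInducedSubgraph (h : G.IsIsomorphic H) : G.IsInducedSubgraph H := by
  obtain ⟨f, hf⟩ := h
  exact ⟨f.toEmbedding, hf⟩

theorem IsInducedSubgraph.trans (h : F.IsInducedSubgraph G) (h' : G.IsInducedSubgraph H) :
    F.IsInducedSubgraph H := by
  obtain ⟨f, hf⟩ := h
  obtain ⟨g, hg⟩ := h'
  exact ⟨f.trans g, fun v => by rw [RelEmbedding.trans_apply, hg, hf]⟩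

theorem exists_isIsomorphic_fin [Fintype V] (G : WeightedGraph V) :
    ∃ G' : WeightedGraph (Fin (Fintype.card V)), G'.IsIsomorphic G := by
  let e := (Fintype.equivFin V).symm
  exact ⟨⟨G.graph.comap e, fun v => G.weight (e v)⟩, ⟨e, Iff.rfl⟩, fun _ => rfl⟩

theorem finite_setOf_weight_le (n : ℕ) (b : ℤ) :
    {G : WeightedGraph (Fin n) | ∀ v, |G.weight v| ≤ b}.Finite := by
  have hinj : Function.Injective fun G : WeightedGraph (Fin n) => (G.graph, G.weight) := by
    rintro ⟨g, w⟩ ⟨g', w'⟩ h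
    simpa using h
  refine ((Set.finite_univ.prod (Set.Finite.pi fun _ : Fin n => Set.finite_Icc (-b) b)).preimage
    hinj.injOn).subset fun G hG => ?_
  exact ⟨Set.mem_univ _, fun v _ => abs_le.1 (hG v)⟩

end WeightedGraph

/-! ### From minimal sets of positions to minimal configurations. -/

namespace LinearPlumbing

open WeightedGraph

variable {V W : Type*} {G : WeightedGraph V} {H : WeightedGraph W} {a a' : ℤ → ℕ}
  {P P' Q : Finset ℤ} {f : V → ℤ} {f' : W → ℤ} {k : ℕ}

theorem isMinimalConfiguration_congr (hG : IsMinimalConfiguration k G) (h : G.IsIsomorphic H) :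
    IsMinimalConfiguration k H := by
  obtain ⟨⟨m, L, hL, hX⟩, hmin⟩ := hG
  exact ⟨⟨m, L, h.symm.trans hL, hX⟩, fun m' L' hX' hL' =>
    (hmin m' L' hX' (hL'.trans h.symm.isInducedSubgraph)).trans h⟩

theorem exists_run_length (P : Finset ℤ) {p : ℤ} (hp : p ∈ P) :
    ∃ n : ℕ, 0 < n ∧ (∀ s < n, p + (s : ℕ) ∈ P) ∧ p + n ∉ P := by
  classical
  have hex : ∃ n : ℕ, p + n ∉ P := by
    by_contra! h
    obtain ⟨b, hb⟩ := P.bddAbove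
    have := hb (h (b - p + 1).toNat)
    omega
  refine ⟨Nat.find hex, ?_, fun s hs => not_not.1 (Nat.find_min hex hs), Nat.find_spec hex⟩
  rw [Nat.find_pos]
  simpa using hp

theorem exists_run_before (P : Finset ℤ) {p : ℤ} (hp : p ∈ P) :
    ∃ n : ℕ, (∀ s ≤ n, p - (s : ℕ) ∈ P) ∧ p - n - 1 ∉ P := by
  classical
  have hex : ∃ n : ℕ, p - n - 1 ∉ P := by
    by_contra! h
    obtain ⟨b, hb⟩ := P.bddBelow
    have := hb (h (p - b).toNat)
    omega
  refine ⟨Nat.find hex, fun s hs => ?_, Nat.find_spec hex⟩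
  cases s with
  | zero => simpa using hp
  | succ s =>
    have := not_not.1 (Nat.find_min hex (m := s) (by omega))
    push_cast
    rwa [← sub_sub]

theorem exists_lensSpaces (h2 : ∀ p ∈ P, 2 ≤ a p) : ∃ (m : ℕ) (L : Fin m → LensSpace)
    (f : (Σ i : Fin m, Fin (L i).coeffs.length) → ℤ),
      IsModel (canonicalPlumbingGraph L) a P f := by
  classical
  -- The first positions of the components of `P`; each component is read as the expansion of one
  -- lens space.
  set S := P.filter fun p => p - 1 ∉ P
  let st : Fin S.card → ℤ := fun i => S.equivFin.symm i
  have hst : ∀ i, st i ∈ P ∧ st i - 1 ∉ P := fun i => Finset.mem_filter.1 (S.equivFin.symm i).2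
  have hL : ∀ i, ∃ L : LensSpace, (∀ s (hs : s < L.coeffs.length),
      st i + s ∈ P ∧ L.coeffs[s] = a (st i + s)) ∧ st i + L.coeffs.length ∉ P := by
    intro i
    obtain ⟨n, h0, h1, h3⟩ := exists_run_length P (hst i).1
    obtain ⟨L, hL⟩ := exists_coeffs_eq (l := (List.range n).map fun s : ℕ => a (st i + s))
      (by simpa using h0.ne') (by
        intro b hb
        obtain ⟨s, hs, rfl⟩ := List.mem_map.1 hb
        exact h2 _ (h1 s (List.mem_range.1 hs)))
    refine ⟨L, fun s hs => ?_, ?_⟩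
    · simp only [hL, List.length_map, List.length_range] at hs
      refine ⟨h1 s hs, ?_⟩
      simp [hL]
    · simpa [hL] using h3
  choose L hL hend using hL
  let f : (Σ i : Fin S.card, Fin (L i).coeffs.length) → ℤ := fun v => st v.1 + (v.2 : ℕ)
  have hfP : ∀ v, f v ∈ P := fun v => (hL v.1 v.2 v.2.2).1
  have hle : ∀ u v, f u = f v → ¬ st u.1 < st v.1 := by
    intro u v h hlt
    have h1 := u.2.2
    simp only [f] at h
    refine (hst v.1).2 ?_
    have := (hL u.1 (st v.1 - st u.1 - 1).toNat (by omega)).1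
    rwa [show st u.1 + ((st v.1 - st u.1 - 1).toNat : ℤ) = st v.1 - 1 by omega] at this
  have hinj : Function.Injective f := by
    rintro ⟨i, s⟩ ⟨j, t⟩ h
    have h1 := hle _ _ h
    have h3 := hle _ _ h.symm
    simp only at h1 h3
    obtain rfl : i = j := S.equivFin.symm.injective (Subtype.ext (by
      change st i = st j
      omega))
    simp only [f, add_right_inj, Nat.cast_inj] at h
    rw [Fin.ext h]
  have hsucc : ∀ u v, f v = f u + 1 → u.1 = v.1 ∧ u.2.val + 1 = v.2.val := by
    rintro ⟨i, s⟩ ⟨j, t⟩ h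
    by_cases hs : s.val + 1 < (L i).coeffs.length
    · have h1 : f ⟨i, s.val + 1, hs⟩ = f ⟨j, t⟩ := by
        rw [h]; simp only [f]; push_cast; ring
      have h3 := hinj h1
      simp only [Sigma.mk.injEq] at h3
      obtain ⟨rfl, h3⟩ := h3
      rw [heq_eq_eq] at h3
      exact ⟨rfl, congrArg Fin.val h3⟩
    · exfalso
      refine hend i ?_
      have h1 := s.2
      have h3 := hfP ⟨j, t⟩
      rw [h] at h3
      simp only [f] at h3
      rwa [add_assoc, show ((s : ℕ) : ℤ) + 1 = (L i).coeffs.length by omega] at h3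
  refine ⟨S.card, L, f, hinj, fun p => ⟨fun hp => ?_, fun ⟨v, hv⟩ => hv ▸ hfP v⟩,
    fun u v => ⟨?_, ?_⟩, fun v => ?_⟩
  · obtain ⟨n, h1, h3⟩ := exists_run_before P hp
    let i := S.equivFin ⟨p - n, Finset.mem_filter.2 ⟨h1 n le_rfl, h3⟩⟩
    have hi : st i = p - n := by simp [st, i]
    have hn : n < (L i).coeffs.length := by
      by_contra hlt
      have := h1 (n - (L i).coeffs.length) (by omega)
      refine hend i ?_
      rwa [hi, show p - n + ((L i).coeffs.length : ℤ) = p - ((n - (L i).coeffs.length : ℕ) : ℤ)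
        by omega]
    exact ⟨⟨i, n, hn⟩, by simp [f, hi]⟩
  · obtain ⟨i, s⟩ := u
    obtain ⟨j, t⟩ := v
    rintro ⟨h, h' | h'⟩
    · obtain rfl : i = j := h
      left; simp only [f]; simp only at h'; rw [← h']; push_cast; ring
    · obtain rfl : i = j := h
      right; simp only [f]; simp only at h'; rw [← h']; push_cast; ring
  · rintro (h | h)
    · obtain ⟨h1, h3⟩ := hsucc u v h
      exact ⟨h1, Or.inl h3⟩
    · obtain ⟨h1, h3⟩ := hsucc v u h
      exact ⟨h1.symm, Or.inr h3⟩
  · simp only [canonicalPlumbingGraph]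
    rw [← (hL v.1 v.2 v.2.2).2]
    rfl

theorem IsModel.compressible_image (hG : IsModel G a P f) (hH : IsModel H a' P' f')
    (h2 : ∀ p ∈ P, 2 ≤ a p) (g : G.graph ↪g H.graph) (hg : ∀ v, H.weight (g v) = G.weight v)
    (h : Compressible a P k) : ∃ Q ⊆ P', Compressible a' Q k ∧ ∀ p ∈ Q, ∃ v, f' (g v) = p := by
  classical
  let F : ℤ → ℤ := Function.extend f (f' ∘ g) 0
  have hF : ∀ v, F (f v) = f' (g v) := fun v => hG.inj.extend_apply _ _ v
  refine ⟨P.image F, ?_, h.image F h2 ?_ ?_ ?_, ?_⟩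
  · intro p hp
    obtain ⟨q, hq, rfl⟩ := Finset.mem_image.1 hp
    obtain ⟨v, rfl⟩ := (hG.mem q).1 hq
    exact (hH.mem _).2 ⟨g v, (hF v).symm⟩
  · intro p hp q hq hpq
    obtain ⟨u, rfl⟩ := (hG.mem p).1 hp
    obtain ⟨v, rfl⟩ := (hG.mem q).1 hq
    rw [hF, hF] at hpq
    rw [g.injective (hH.inj hpq)]
  · intro p hp q hq
    obtain ⟨u, rfl⟩ := (hG.mem p).1 hp
    obtain ⟨v, rfl⟩ := (hG.mem q).1 hq
    rw [hF, hF, ← hG.adj, ← hH.adj, g.map_adj_iff]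
  · intro p hp
    obtain ⟨v, rfl⟩ := (hG.mem p).1 hp
    have h1 := hg v
    rw [hG.weight, hH.weight] at h1
    rw [hF]
    omega
  · intro p hp
    obtain ⟨q, hq, rfl⟩ := Finset.mem_image.1 hp
    obtain ⟨v, rfl⟩ := (hG.mem q).1 hq
    exact ⟨v, (hF v).symm⟩

theorem propertyX_iff_of_isModel {m : ℕ} {L : Fin m → LensSpace}
    {f : (Σ i : Fin m, Fin (L i).coeffs.length) → ℤ} (h : IsModel (canonicalPlumbingGraph L) a P f)
    (h2 : ∀ p ∈ P, 2 ≤ a p) : PropertyX k L ↔ ¬ Compressible a P k := by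
  obtain ⟨a', P', f', h', h2', hX⟩ := exists_isModel L
  rw [hX, not_iff_not]
  constructor
  · intro hc
    obtain ⟨Q, hQ, hc, -⟩ := h'.compressible_image h h2' SimpleGraph.Embedding.refl
      (fun _ => rfl) hc
    exact hc.superset hQ
  · intro hc
    obtain ⟨Q, hQ, hc, -⟩ := h.compressible_image h' h2 SimpleGraph.Embedding.refl
      (fun _ => rfl) hc
    exact hc.superset hQ

theorem not_propertyX_of_isInducedSubgraph {m n : ℕ} {L : Fin m → LensSpace}
    {L' : Fin n → LensSpace} (hX : ¬ PropertyX k L)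
    (h : (canonicalPlumbingGraph L).IsInducedSubgraph (canonicalPlumbingGraph L')) :
    ¬ PropertyX k L' := by
  obtain ⟨a, P, f, hm, h2, hX1⟩ := exists_isModel L
  obtain ⟨a', P', f', hm', h2', hX2⟩ := exists_isModel L'
  obtain ⟨g, hg⟩ := h
  rw [hX1, not_not] at hX
  rw [hX2, not_not]
  obtain ⟨Q, hQ, hc, -⟩ := hm.compressible_image hm' h2 g hg hX
  exact hc.superset hQ

theorem exists_isMinimal_subset (h2 : ∀ p ∈ P, 2 ≤ a p) (h : Compressible a P k) :
    ∃ Q ⊆ P, IsMinimal a Q k := by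
  induction hn : P.card using Nat.strong_induction_on generalizing P with
  | _ n ih =>
  by_cases hmin : ∀ i ∈ P, ¬ Compressible a (P.erase i) k
  · exact ⟨P, subset_rfl, h2, h, hmin⟩
  · push Not at hmin
    obtain ⟨i, hi, hc⟩ := hmin
    obtain ⟨Q, hQ, hQm⟩ := ih _ (hn ▸ Finset.card_erase_lt_of_mem hi)
      (fun p hp => h2 p (Finset.mem_of_mem_erase hp)) hc rfl
    exact ⟨Q, hQ.trans (Finset.erase_subset _ _), hQm⟩

/-- An embedded configuration without the property has a compressible image. By minimality the image
is all of `Q`, so the embedding is onto. -/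
theorem IsMinimal.isMinimalConfiguration (hQ : IsMinimal a Q k) {m : ℕ} {L : Fin m → LensSpace}
    {f : (Σ i : Fin m, Fin (L i).coeffs.length) → ℤ}
    (hf : IsModel (canonicalPlumbingGraph L) a Q f) :
    IsMinimalConfiguration k (canonicalPlumbingGraph L) := by
  refine ⟨⟨m, L, ⟨SimpleGraph.Iso.refl, fun _ => rfl⟩, ?_⟩, fun m' L' hX ⟨g, hg⟩ => ?_⟩
  · rw [propertyX_iff_of_isModel hf hQ.two_le, not_not]
    exact hQ.compressible
  · obtain ⟨a', P', f', hm', h2', hX'⟩ := exists_isModel L'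
    rw [hX', not_not] at hX
    obtain ⟨R, hR, hc, hRg⟩ := hm'.compressible_image hf h2' g hg hX
    have hRQ := hQ.eq_of_subset hR hc
    have hsurj : Function.Surjective g := by
      intro w
      obtain ⟨v, hv⟩ := hRg (f w) (hRQ ▸ (hf.mem _).2 ⟨w, rfl⟩)
      exact ⟨v, hf.inj hv⟩
    exact ⟨RelIso.ofSurjective g hsurj, hg⟩

theorem exists_minimal_subconfiguration (hk : 0 < k) {m : ℕ} {L : Fin m → LensSpace}
    (hX : ¬ PropertyX k L) : ∃ (n : ℕ) (G : WeightedGraph (Fin n)), IsMinimalConfiguration k G ∧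
      G.IsInducedSubgraph (canonicalPlumbingGraph L) ∧ n ≤ 13 * k ∧
      ∀ v, |G.weight v| ≤ 2 * (k : ℤ) + 7 := by
  obtain ⟨a, P, f, hm, h2, hX'⟩ := exists_isModel L
  rw [hX', not_not] at hX
  obtain ⟨Q, hQP, hQ⟩ := exists_isMinimal_subset h2 hX
  obtain ⟨hcard, hweight⟩ := hQ.bounds hk
  obtain ⟨m', L', f', hm'⟩ := exists_lensSpaces hQ.two_le
  obtain ⟨G, hG⟩ := exists_isIsomorphic_fin (canonicalPlumbingGraph L')
  have hind : (canonicalPlumbingGraph L').IsInducedSubgraph (canonicalPlumbingGraph L) := by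
    have hex : ∀ v, ∃ w, f w = f' v := fun v =>
      (hm.mem _).1 (hQP ((hm'.mem _).2 ⟨v, rfl⟩))
    choose g hg using hex
    have hinj : Function.Injective g := fun u v h => hm'.inj (by rw [← hg, ← hg, h])
    refine ⟨⟨⟨g, hinj⟩, ?_⟩, fun v => ?_⟩
    · intro u v
      change (canonicalPlumbingGraph L).graph.Adj (g u) (g v) ↔ _
      rw [hm.adj, hm'.adj, hg, hg]
    · change (canonicalPlumbingGraph L).weight (g v) = _
      rw [hm.weight, hm'.weight, hg]
  refine ⟨_, G, isMinimalConfiguration_congr (hQ.isMinimalConfiguration hm') hG.symm,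
    hG.isInducedSubgraph.trans hind, ?_, fun v => ?_⟩
  · rw [← Finset.card_univ, ← Finset.card_image_of_injective _ hm'.inj]
    refine (Finset.card_le_card fun p hp => ?_).trans hcard
    obtain ⟨v, -, rfl⟩ := Finset.mem_image.1 hp
    exact (hm'.mem _).2 ⟨v, rfl⟩
  · obtain ⟨g, hg⟩ := hG
    rw [← hg, hm'.weight, abs_neg, Nat.abs_cast]
    exact_mod_cast hweight _ ((hm'.mem _).2 ⟨_, rfl⟩)

end LinearPlumbing

theorem theoremA (k : ℕ) (hk : 0 < k) :
    ∃ S : Finset (Σ n : ℕ, WeightedGraph (Fin n)),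
      (∀ G ∈ S, IsMinimalConfiguration k G.2) ∧
      (∀ G ∈ S, ∀ H ∈ S, G.2.IsIsomorphic H.2 → G = H) ∧
      (∀ (m : ℕ) (L : Fin m → LensSpace),
        PropertyX k L ↔ ∀ G ∈ S, ¬ G.2.IsInducedSubgraph (canonicalPlumbingGraph L)) ∧
      (∀ G ∈ S, ∀ v : Fin G.1, |G.2.weight v| ≤ 2 * (k : ℤ) + 7) ∧
      (∀ G ∈ S, G.1 ≤ 13 * k) := by
  classical
  set A : Set (Σ n : ℕ, WeightedGraph (Fin n)) := {G | IsMinimalConfiguration k G.2 ∧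
    G.1 ≤ 13 * k ∧ ∀ v, |G.2.weight v| ≤ 2 * (k : ℤ) + 7}
  have hA : A.Finite := by
    refine ((Set.finite_Iic (13 * k)).biUnion fun n _ =>
      (WeightedGraph.finite_setOf_weight_le n (2 * k + 7)).image (Sigma.mk n)).subset ?_
    rintro ⟨n, G⟩ ⟨-, h1, h2⟩
    exact Set.mem_biUnion (show n ∈ Set.Iic (13 * k) from h1) ⟨G, h2, rfl⟩
  let s : Setoid (Σ n : ℕ, WeightedGraph (Fin n)) :=
    ⟨fun G H => G.2.IsIsomorphic H.2, fun G => ⟨SimpleGraph.Iso.refl, fun _ => rfl⟩,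
      fun h => h.symm, fun h h' => h.trans h'⟩
  -- Choose one representative from each isomorphism class of the finite set of bounded minimal
  -- configurations.
  obtain ⟨B, hBA, hB, hinj⟩ := (A.surjOn_image (Quotient.mk s)).exists_subset_injOn_image_eq
  have hfin := hA.subset hBA
  have hmem : ∀ G ∈ hfin.toFinset, G ∈ A := fun G hG => hBA (hfin.mem_toFinset.1 hG)
  refine ⟨hfin.toFinset, fun G hG => (hmem G hG).1, fun G hG H hH h => ?_, fun m L => ⟨?_, ?_⟩,
    fun G hG => (hmem G hG).2.2, fun G hG => (hmem G hG).2.1⟩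
  · exact hB (hfin.mem_toFinset.1 hG) (hfin.mem_toFinset.1 hH) (Quotient.sound h)
  · intro hX G hG hind
    obtain ⟨⟨m', L', hL', hX'⟩, -⟩ := (hmem G hG).1
    exact LinearPlumbing.not_propertyX_of_isInducedSubgraph hX'
      (hL'.symm.isInducedSubgraph.trans hind) hX
  · intro h
    by_contra hX
    obtain ⟨n, G, hG, hind, hn, hw⟩ := LinearPlumbing.exists_minimal_subconfiguration hk hX
    have hGA : (⟨n, G⟩ : Σ n : ℕ, WeightedGraph (Fin n)) ∈ A := ⟨hG, hn, hw⟩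
    have h1 : Quotient.mk s ⟨n, G⟩ ∈ Quotient.mk s '' B := by
      rw [hinj]; exact ⟨_, hGA, rfl⟩
    obtain ⟨H, hH, hHG⟩ := h1
    have h2 : H.2.IsIsomorphic G := Quotient.exact hHG
    exact h H (hfin.mem_toFinset.2 hH) (h2.isInducedSubgraph.trans hind)
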